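/- Let $m\in\mathbb{N}$ and $1\le p<\infty$, and let $f:\mathbb{R}^{m\times 2}\times\mathbb{R}^{m\times 2\times 2}\to\mathbb{R}$ be Borel measurable. For $v\in\mathbb{R}^{m\times 2}$, $\xi\in\mathbb{R}^{m\times 2\times 2}$ let \[ Q_2f(v,\xi)=\inf\left\{\int_{Q}f(v,\xi+\nabla^2\varphi)\,dx:\ \varphi\in W^{2,\infty}_0(Q;\mathbb{R}^m)\right\},\qquad Q=[-1/2,1/2]^2, \] be the 2-quasiconvexification of $f$ in its second variable, where $W^{2,\infty}_0=W^{2,\infty}\cap W^{2,1}_0$ and $W^{2,1}_0$ is the closure of $C_c^\infty$ in $W^{2,1}$. Assume that there is a constant $C$ such that for all $v,\tilde v\in\mathbb{R}^{m\times 2}$ and $\xi\in\mathbb{R}^{m\times 2\times 2}$ \[ \begin{split} 0\le f(v,\xi)&\le C(1+|\xi|^p),\\ |f(v,\xi)-f(\tilde v,\xi)|&\le C|v-\tilde v|\max\big(f(v,\xi),f(\tilde v,\xi)\big),\\ |Q_2f(v,\xi)-Q_2f(\tilde v,\xi)|&\le C|v-\tilde v|\max\big(Q_2f(v,\xi),Q_2f(\tilde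 v,\xi)\big). \end{split} \] Let $\Omega\subset\mathbb{R}^2$ be open and bounded with smooth boundary, let $u\in W^{2,p}(\Omega;\mathbb{R}^m)$ and $\delta>0$. Then there exists $w\in W^{2,p}(\Omega;\mathbb{R}^m)$ such that \[ \|u-w\|_{W^{1,p}(\Omega;\mathbb{R}^m)}<\delta \qquad\text{and}\qquad \int_\Omega f(\nabla w,\nabla^2w)\,dx<\int_\Omega Q_2f(\nabla u,\nabla^2u)\,dx+\delta, \] where the integrands $f(\nabla w,\nabla^2 w)$ and $Q_2f(\nabla u,\nabla^2u)$ are integrable over $\Omega$. -/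

import Mathlib

open MeasureTheory Set
open scoped ENNReal ContDiff

/-- The Euclidean plane `ℝ²`. -/
abbrev Plane : Type := EuclideanSpace ℝ (Fin 2)

/-- The values of the maps: `ℝᵐ`. -/
abbrev Vec (m : ℕ) : Type := EuclideanSpace ℝ (Fin m)

/-- `ℝ^{m×2}` with the Euclidean (Frobenius) norm; the entry `(i, j)` of a gradient is `∂ⱼ uᵢ`. -/
abbrev GradSpace (m : ℕ) : Type := EuclideanSpace ℝ (Fin m × Fin 2)

/-- `ℝ^{m×2×2}` with the Euclidean norm; the entry `(i, j, k)` of a Hessian is `∂ₖ ∂ⱼ uᵢ`. -/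
abbrev HessSpace (m : ℕ) : Type := EuclideanSpace ℝ (Fin m × Fin 2 × Fin 2)

/-- The `k`-th standard basis vector of the plane. -/
noncomputable def planeBasis (k : Fin 2) : Plane := EuclideanSpace.single k (1 : ℝ)

/-- `h` is the weak partial derivative `∂ₖ g` on the open set `Ω`. -/
def HasWeakPartial (Ω : Set Plane) (k : Fin 2) (g h : Plane → ℝ) : Prop :=
  LocallyIntegrableOn g Ω volume ∧ LocallyIntegrableOn h Ω volume ∧
    ∀ φ : Plane → ℝ, ContDiff ℝ ∞ φ → HasCompactSupport φ → tsupport φ ⊆ Ω →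
      ∫ x in Ω, g x * fderiv ℝ φ x (planeBasis k) = - ∫ x in Ω, h x * φ x

/-- `u ∈ W^{2,q}(Ω; ℝᵐ)`, with weak gradient (represented by) `Du` and weak Hessian
(represented by) `D2u`. Both are determined by `u` almost everywhere in `Ω`. -/
structure IsSobolev2 {m : ℕ} (Ω : Set Plane) (q : ℝ≥0∞) (u : Plane → Vec m)
    (Du : Plane → GradSpace m) (D2u : Plane → HessSpace m) : Prop where
  memLp : MemLp u q (volume.restrict Ω)
  memLp_grad : MemLp Du q (volume.restrict Ω)
  memLp_hess : MemLp D2u q (volume.restrict Ω)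
  weak_grad : ∀ i j, HasWeakPartial Ω j (fun x => u x i) (fun x => Du x (i, j))
  weak_hess : ∀ i j k, HasWeakPartial Ω k (fun x => Du x (i, j)) (fun x => D2u x (i, j, k))

/-- The norm `(∫_Ω |u|^p + ∫_Ω |∇u|^p)^{1/p}` of `W^{1,p}(Ω; ℝᵐ)`, for a map `u` with weak
gradient `Du`. -/
noncomputable def sobolev1Norm {m : ℕ} (Ω : Set Plane) (p : ℝ) (u : Plane → Vec m)
    (Du : Plane → GradSpace m) : ℝ≥0∞ :=
  ((∫⁻ x in Ω, ‖u x‖ₑ ^ p) + ∫⁻ x in Ω, ‖Du x‖ₑ ^ p) ^ (1 / p)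

/-- The classical gradient of a smooth map. -/
noncomputable def classicalGrad {m : ℕ} (ψ : Plane → Vec m) (x : Plane) : GradSpace m :=
  WithLp.toLp 2 fun a => fderiv ℝ (fun y => ψ y a.1) x (planeBasis a.2)

/-- The classical Hessian of a smooth map. -/
noncomputable def classicalHess {m : ℕ} (ψ : Plane → Vec m) (x : Plane) : HessSpace m :=
  WithLp.toLp 2 fun a =>
    fderiv ℝ (fun y => classicalGrad ψ y (a.1, a.2.1)) x (planeBasis a.2.2)

/-- `φ ∈ W^{2,∞}_0(Ω; ℝᵐ) = W^{2,∞}(Ω; ℝᵐ) ∩ W^{2,1}_0(Ω; ℝᵐ)`, with weak gradient `Dφ` and weak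
Hessian `D2φ`, where `W^{2,1}_0` is the closure of the smooth maps with compact support in `Ω`
with respect to the norm of `W^{2,1}`. -/
structure IsSobolev2InfZero {m : ℕ} (Ω : Set Plane) (φ : Plane → Vec m)
    (Dφ : Plane → GradSpace m) (D2φ : Plane → HessSpace m) : Prop where
  isSobolev : IsSobolev2 Ω ⊤ φ Dφ D2φ
  approx : ∀ ε : ℝ, 0 < ε → ∃ ψ : Plane → Vec m,
    ContDiff ℝ ∞ ψ ∧ HasCompactSupport ψ ∧ tsupport ψ ⊆ Ω ∧
      (∫⁻ x in Ω, ‖φ x - ψ x‖ₑ) + (∫⁻ x in Ω, ‖Dφ x - classicalGrad ψ x‖ₑ)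
        + (∫⁻ x in Ω, ‖D2φ x - classicalHess ψ x‖ₑ) < ENNReal.ofReal ε

/-- The (open) unit square centred at the origin; its boundary is a null set. -/
def unitSquare : Set Plane := {x | ∀ i, |x i| < 1 / 2}

/-- The 2-quasiconvexification of `g : ℝ^{m×2×2} → ℝ`: the infimum of `∫_Q g(ξ + ∇²φ) dx` over
`φ ∈ W^{2,∞}_0(Q; ℝᵐ)`, where `Q` is the unit square. -/
noncomputable def quasiconvexification2 {m : ℕ} (g : HessSpace m → ℝ) (ξ : HessSpace m) : ℝ :=
  sInf {I : ℝ | ∃ (φ : Plane → Vec m) (Dφ : Plane → GradSpace m) (D2φ : Plane → HessSpace m),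
    IsSobolev2InfZero unitSquare φ Dφ D2φ ∧ I = ∫ x in unitSquare, g (ξ + D2φ x)}

/-- The set `Ω` has smooth boundary: near each boundary point it is the sublevel set of a smooth
function with non-vanishing differential. -/
def HasSmoothBoundary (Ω : Set Plane) : Prop :=
  ∀ x ∈ frontier Ω, ∃ (U : Set Plane) (ρ : Plane → ℝ), IsOpen U ∧ x ∈ U ∧ ContDiff ℝ ∞ ρ ∧
    ρ x = 0 ∧ fderiv ℝ ρ x ≠ 0 ∧ Ω ∩ U = {y | ρ y < 0} ∩ U

/-!
On a large compact part of `Ω` the map `u` is replaced by a smooth map: one cuts `u` off and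
mollifies only the compactly supported part, which gives some `z`, close to `u` in `W^{2,p}`, that
coincides with a test function `ψ` on an open set `V` of almost full measure. The relaxed
functional is continuous along this approximation. Indeed `Q₂f` inherits the relative Lipschitz
bound in `v` from `f`, and it is controlled in `ξ` by shrinking a competitor to a slightly smaller
square and correcting it by a quadratic map that is cut off in the remaining layer.

Small disjoint squares, on which `∇ψ` and `∇²ψ` are nearly constant, fill most of `V` by Vitali's
covering theorem. On each of them one adds a rescaled, nearly optimal competitor from the
definition of `Q₂f`; as it scales like `r² φ(x / r)`, the sum is small in `C¹`. The set not covered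
has small measure, and the growth bound together with absolute continuity of the integral takes
care of it.
-/

lemma fderiv_comp_add_smul {E F : Type*} [NormedAddCommGroup E] [NormedSpace ℝ E]
    [NormedAddCommGroup F] [NormedSpace ℝ F] (f : E → F) (a x : E) (r : ℝ) :
    fderiv ℝ (fun y => f (a + r • y)) x = r • fderiv ℝ f (a + r • x) := by
  rw [fderiv_comp_smul (f := fun y => f (a + y)), fderiv_comp_add_left]

section Rescaling

variable {E F : Type*} [NormedAddCommGroup E] [NormedSpace ℝ E] [MeasurableSpace E] [BorelSpace E]
  [FiniteDimensional ℝ E] {μ : Measure E} [μ.IsAddHaarMeasure] [NormedAddCommGroup F]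

lemma integrable_comp_inv_smul_sub {f : E → F} (hf : Integrable f μ) (a : E) {r : ℝ}
    (hr : r ≠ 0) : Integrable (fun x => f (r⁻¹ • (x - a))) μ :=
  (hf.comp_smul (inv_ne_zero hr)).comp_sub_right a

variable (μ) in
lemma integral_comp_inv_smul_sub [NormedSpace ℝ F] (f : E → F) (a : E) (r : ℝ) :
    ∫ x, f (r⁻¹ • (x - a)) ∂μ = |r ^ Module.finrank ℝ E| • ∫ x, f x ∂μ := by
  rw [integral_sub_right_eq_self (fun x => f (r⁻¹ • x)) a, Measure.integral_comp_inv_smul]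

end Rescaling

/-- `φ` is a test function on `Ω`, that is, `φ ∈ C_c^∞(Ω; F)`. -/
structure IsTestFunction {F : Type*} [NormedAddCommGroup F] [NormedSpace ℝ F] (Ω : Set Plane)
    (φ : Plane → F) : Prop where
  contDiff : ContDiff ℝ ∞ φ
  hasCompactSupport : HasCompactSupport φ
  tsupport_subset : tsupport φ ⊆ Ω

lemma contDiff_fderiv_apply {F : Type*} [NormedAddCommGroup F] [NormedSpace ℝ F]
    {ψ : Plane → F} (hψ : ContDiff ℝ ∞ ψ) (e : Plane) :
    ContDiff ℝ ∞ (fun x => fderiv ℝ ψ x e) :=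
  (hψ.fderiv_right (m := ∞) (by simp)).clm_apply contDiff_const

namespace IsTestFunction

variable {F : Type*} [NormedAddCommGroup F] [NormedSpace ℝ F] {Ω : Set Plane}

lemma mono {φ : Plane → F} (hφ : IsTestFunction Ω φ) {Ω' : Set Plane} (h : Ω ⊆ Ω') :
    IsTestFunction Ω' φ :=
  ⟨hφ.contDiff, hφ.hasCompactSupport, hφ.tsupport_subset.trans h⟩

lemma eq_zero {φ : Plane → F} (hφ : IsTestFunction Ω φ) {x : Plane} (hx : x ∉ Ω) : φ x = 0 :=
  image_eq_zero_of_notMem_tsupport fun h => hx (hφ.tsupport_subset h)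

lemma fderiv_apply {φ : Plane → F} (hφ : IsTestFunction Ω φ) (e : Plane) :
    IsTestFunction Ω (fun x => fderiv ℝ φ x e) :=
  ⟨contDiff_fderiv_apply hφ.contDiff e, hφ.hasCompactSupport.fderiv_apply ℝ e,
    (tsupport_fderiv_apply_subset ℝ e).trans hφ.tsupport_subset⟩

lemma smul {χ : Plane → ℝ} {g : Plane → F} (hχ : IsTestFunction Ω χ) (hg : ContDiff ℝ ∞ g) :
    IsTestFunction Ω (fun x => χ x • g x) :=
  ⟨hχ.contDiff.smul hg, hχ.hasCompactSupport.smul_right,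
    (tsupport_smul_subset_left χ g).trans hχ.tsupport_subset⟩

lemma exists_norm_le {φ : Plane → F} (hφ : IsTestFunction Ω φ) : ∃ B, ∀ x, ‖φ x‖ ≤ B :=
  hφ.contDiff.continuous.bounded_above_of_compact_support hφ.hasCompactSupport

lemma memLp {φ : Plane → F} (hφ : IsTestFunction Ω φ) (q : ℝ≥0∞) : MemLp φ q volume :=
  hφ.contDiff.continuous.memLp_of_hasCompactSupport hφ.hasCompactSupport

variable {χ g : Plane → ℝ}

lemma integrable_mul (hχ : IsTestFunction Ω χ) (hg : LocallyIntegrableOn g Ω volume) :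
    Integrable (fun x => g x * χ x) volume := by
  have h := (hg.integrableOn_compact_subset hχ.tsupport_subset
    hχ.hasCompactSupport).mul_continuousOn hχ.contDiff.continuous.continuousOn
    hχ.hasCompactSupport
  refine h.integrable_of_forall_notMem_eq_zero fun x hx => ?_
  rw [image_eq_zero_of_notMem_tsupport hx, mul_zero]

lemma setIntegral_mul (hχ : IsTestFunction Ω χ) (g : Plane → ℝ) :
    ∫ x in Ω, g x * χ x = ∫ x, g x * χ x :=
  setIntegral_eq_integral_of_forall_compl_eq_zero fun x hx => by rw [hχ.eq_zero hx, mul_zero]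

end IsTestFunction

namespace HasWeakPartial

variable {Ω : Set Plane} {k : Fin 2} {g h g' h' : Plane → ℝ}

lemma integral_eq {φ : Plane → ℝ} (H : HasWeakPartial Ω k g h) (hφ : IsTestFunction Ω φ) :
    ∫ x, g x * fderiv ℝ φ x (planeBasis k) = - ∫ x, h x * φ x := by
  rw [← (hφ.fderiv_apply _).setIntegral_mul, ← hφ.setIntegral_mul]
  exact H.2.2 φ hφ.contDiff hφ.hasCompactSupport hφ.tsupport_subset

lemma of_integral_eq (hg : LocallyIntegrableOn g Ω volume) (hh : LocallyIntegrableOn h Ω volume)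
    (H : ∀ φ : Plane → ℝ, IsTestFunction Ω φ →
      ∫ x, g x * fderiv ℝ φ x (planeBasis k) = - ∫ x, h x * φ x) : HasWeakPartial Ω k g h := by
  refine ⟨hg, hh, fun φ hφ hc hs => ?_⟩
  have hφ : IsTestFunction Ω φ := ⟨hφ, hc, hs⟩
  rw [(hφ.fderiv_apply _).setIntegral_mul, hφ.setIntegral_mul, H φ hφ]

lemma mono (H : HasWeakPartial Ω k g h) {Ω' : Set Plane} (hs : Ω' ⊆ Ω) :
    HasWeakPartial Ω' k g h :=
  of_integral_eq (H.1.mono_set hs) (H.2.1.mono_set hs) fun _ hφ => H.integral_eq (hφ.mono hs)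

lemma add (H : HasWeakPartial Ω k g h) (H' : HasWeakPartial Ω k g' h') :
    HasWeakPartial Ω k (fun x => g x + g' x) (fun x => h x + h' x) := by
  refine of_integral_eq (H.1.add H'.1) (H.2.1.add H'.2.1) fun φ hφ => ?_
  have hφ' := hφ.fderiv_apply (planeBasis k)
  simp only [add_mul]
  rw [integral_add (hφ'.integrable_mul H.1) (hφ'.integrable_mul H'.1),
    integral_add (hφ.integrable_mul H.2.1) (hφ.integrable_mul H'.2.1),
    H.integral_eq hφ, H'.integral_eq hφ, neg_add]

lemma const_mul (H : HasWeakPartial Ω k g h) (c : ℝ) :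
    HasWeakPartial Ω k (fun x => c * g x) (fun x => c * h x) := by
  refine of_integral_eq (H.1.smul c) (H.2.1.smul c) fun φ hφ => ?_
  simp only [mul_assoc, integral_const_mul]
  rw [H.integral_eq hφ, mul_neg]

lemma zero (Ω : Set Plane) (k : Fin 2) : HasWeakPartial Ω k (fun _ => 0) (fun _ => 0) :=
  of_integral_eq (locallyIntegrable_zero.locallyIntegrableOn _)
    (locallyIntegrable_zero.locallyIntegrableOn _) fun φ _ => by simp

lemma of_contDiff (hg : ContDiff ℝ ∞ g) (k : Fin 2) :
    HasWeakPartial univ k g (fun x => fderiv ℝ g x (planeBasis k)) := by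
  have hg₀ : LocallyIntegrableOn g univ volume :=
    hg.continuous.locallyIntegrable.locallyIntegrableOn _
  have hg₁ : LocallyIntegrableOn (fun x => fderiv ℝ g x (planeBasis k)) univ volume :=
    (contDiff_fderiv_apply hg _).continuous.locallyIntegrable.locallyIntegrableOn _
  exact of_integral_eq hg₀ hg₁ fun φ hφ =>
    integral_mul_fderiv_eq_neg_fderiv_mul_of_integrable (hφ.integrable_mul hg₁)
      ((hφ.fderiv_apply _).integrable_mul hg₀) (hφ.integrable_mul hg₀)
      (fun x _ => hg.differentiable (by simp) x) fun x _ => hφ.contDiff.differentiable (by simp) x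

lemma cutoff_mul (H : HasWeakPartial Ω k g h) {χ : Plane → ℝ} (hχ : IsTestFunction Ω χ) :
    HasWeakPartial univ k (fun x => χ x * g x)
      (fun x => fderiv ℝ χ x (planeBasis k) * g x + χ x * h x) := by
  have hχ' := hχ.fderiv_apply (planeBasis k)
  have hχg : Integrable (fun x => χ x * g x) volume := by
    simpa only [mul_comm] using hχ.integrable_mul H.1
  have hDχgh : Integrable (fun x => fderiv ℝ χ x (planeBasis k) * g x + χ x * h x) volume := by
    simp only [mul_comm _ (g _), mul_comm _ (h _)]
    exact (hχ'.integrable_mul H.1).add (hχ.integrable_mul H.2.1)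
  refine of_integral_eq (hχg.locallyIntegrable.locallyIntegrableOn _)
    (hDχgh.locallyIntegrable.locallyIntegrableOn _) fun φ hφ => ?_
  have hχφ : IsTestFunction Ω (fun x => χ x * φ x) := hχ.smul hφ.contDiff
  have hχDφ : IsTestFunction Ω (fun x => χ x * fderiv ℝ φ x (planeBasis k)) :=
    hχ.smul (contDiff_fderiv_apply hφ.contDiff _)
  have hDχφ : IsTestFunction Ω (fun x => fderiv ℝ χ x (planeBasis k) * φ x) :=
    hχ'.smul hφ.contDiff
  have leibniz : ∀ x, fderiv ℝ (fun x => χ x * φ x) x (planeBasis k) =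
      χ x * fderiv ℝ φ x (planeBasis k) + fderiv ℝ χ x (planeBasis k) * φ x := fun x => by
    rw [fderiv_fun_mul (hχ.contDiff.differentiable (by simp) x)
      (hφ.contDiff.differentiable (by simp) x)]
    simp [mul_comm]
  have key := H.integral_eq hχφ
  simp only [leibniz, mul_add] at key
  rw [integral_add (hχDφ.integrable_mul H.1) (hDχφ.integrable_mul H.1)] at key
  calc ∫ x, χ x * g x * fderiv ℝ φ x (planeBasis k)
      = ∫ x, g x * (χ x * fderiv ℝ φ x (planeBasis k)) := by congr 1; ext x; ring
    _ = -((∫ x, g x * (fderiv ℝ χ x (planeBasis k) * φ x)) + ∫ x, h x * (χ x * φ x)) := by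
        linarith
    _ = -∫ x, (fderiv ℝ χ x (planeBasis k) * g x + χ x * h x) * φ x := by
        rw [← integral_add (hDχφ.integrable_mul H.1) (hχφ.integrable_mul H.2.1)]
        congr 2; ext x; ring

lemma comp_inv_smul_sub (H : HasWeakPartial univ k g h) (hg : Integrable g volume)
    (hh : Integrable h volume) (a : Plane) {r : ℝ} (hr : r ≠ 0) :
    HasWeakPartial univ k (fun x => g (r⁻¹ • (x - a))) (fun x => r⁻¹ * h (r⁻¹ • (x - a))) := by
  refine of_integral_eq
    ((integrable_comp_inv_smul_sub hg a hr).locallyIntegrable.locallyIntegrableOn _)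
    (((integrable_comp_inv_smul_sub hh a hr).const_mul r⁻¹).locallyIntegrable.locallyIntegrableOn _)
    fun φ hφ => ?_
  let e : Plane ≃ₜ Plane := (Homeomorph.smulOfNeZero r hr).trans (Homeomorph.addLeft a)
  have hφe : IsTestFunction univ (fun y => φ (a + r • y)) :=
    ⟨hφ.contDiff.comp (by fun_prop), hφ.hasCompactSupport.comp_homeomorph e, subset_univ _⟩
  have he : ∀ x, a + r • r⁻¹ • (x - a) = x := fun x => by simp [smul_smul, hr]
  have key := H.integral_eq hφe
  simp only [fderiv_comp_add_smul, smul_apply, smul_eq_mul] at key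
  have hl := integral_comp_inv_smul_sub volume
    (fun y => g y * fderiv ℝ φ (a + r • y) (planeBasis k)) a r
  have hr' := integral_comp_inv_smul_sub volume (fun y => h y * φ (a + r • y)) a r
  simp only [he] at hl hr'
  simp only [mul_left_comm, integral_const_mul] at key
  simp only [mul_assoc, integral_const_mul]
  rw [hl, hr', smul_eq_mul, smul_eq_mul, mul_left_comm, ← mul_neg, ← mul_neg, mul_left_comm,
    ← key]
  field_simp

lemma norm_integral_mul_fderiv_add_le (H : HasWeakPartial univ k g' h')
    (hg : Integrable g volume) (hh : Integrable h volume) (hg' : Integrable g' volume)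
    (hh' : Integrable h' volume) {φ : Plane → ℝ} (hφ : IsTestFunction univ φ) {B B' : ℝ}
    (hB : ∀ x, ‖φ x‖ ≤ B) (hB' : ∀ x, ‖fderiv ℝ φ x (planeBasis k)‖ ≤ B') :
    ‖(∫ x, g x * fderiv ℝ φ x (planeBasis k)) + ∫ x, h x * φ x‖ ≤
      (∫ x, ‖g x - g' x‖) * B' + (∫ x, ‖h x - h' x‖) * B := by
  have bound {G ζ : Plane → ℝ} {b : ℝ} (hG : Integrable G volume) (hζ : ∀ x, ‖ζ x‖ ≤ b) :
      ‖∫ x, G x * ζ x‖ ≤ (∫ x, ‖G x‖) * b := by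
    rw [← integral_mul_const]
    refine norm_integral_le_of_norm_le (hG.norm.mul_const b) (ae_of_all _ fun x => ?_)
    rw [norm_mul]
    gcongr
    exact hζ x
  have hφ' := hφ.fderiv_apply (planeBasis k)
  have int {ζ G : Plane → ℝ} (hζ : IsTestFunction univ ζ) (hG : Integrable G volume) :
      Integrable (fun x => G x * ζ x) volume :=
    hζ.integrable_mul (hG.locallyIntegrable.locallyIntegrableOn _)
  calc ‖(∫ x, g x * fderiv ℝ φ x (planeBasis k)) + ∫ x, h x * φ x‖
      = ‖(∫ x, (g x - g' x) * fderiv ℝ φ x (planeBasis k)) + ∫ x, (h x - h' x) * φ x‖ := by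
        simp only [sub_mul]
        rw [integral_sub (int hφ' hg) (int hφ' hg'), integral_sub (int hφ hh) (int hφ hh'),
          H.integral_eq hφ]
        congr 1; ring
    _ ≤ _ := (norm_add_le _ _).trans (add_le_add (bound (hg.sub hg') hB') (bound (hh.sub hh') hB))

lemma of_forall_approx (hg : Integrable g volume) (hh : Integrable h volume)
    (H : ∀ ε : ℝ, 0 < ε → ∃ g' h' : Plane → ℝ, HasWeakPartial univ k g' h' ∧
      Integrable g' volume ∧ Integrable h' volume ∧
      ∫ x, ‖g x - g' x‖ ≤ ε ∧ ∫ x, ‖h x - h' x‖ ≤ ε) :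
    HasWeakPartial univ k g h := by
  refine of_integral_eq (hg.locallyIntegrable.locallyIntegrableOn _)
    (hh.locallyIntegrable.locallyIntegrableOn _) fun φ hφ => ?_
  obtain ⟨B, hB⟩ := hφ.exists_norm_le
  obtain ⟨B', hB'⟩ := (hφ.fderiv_apply (planeBasis k)).exists_norm_le
  have hB₀ : 0 ≤ B := (norm_nonneg _).trans (hB 0)
  have hB₀' : 0 ≤ B' := (norm_nonneg _).trans (hB' 0)
  have small : ∀ ε : ℝ, 0 < ε →
      ‖(∫ x, g x * fderiv ℝ φ x (planeBasis k)) + ∫ x, h x * φ x‖ ≤ ε * (B' + B) := by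
    intro ε hε
    obtain ⟨g', h', H', hg', hh', hgε, hhε⟩ := H ε hε
    refine (H'.norm_integral_mul_fderiv_add_le hg hh hg' hh' hφ hB hB').trans ?_
    rw [mul_add]
    gcongr
  have lim : Filter.Tendsto (fun ε : ℝ => ε * (B' + B)) (nhdsWithin 0 (Ioi 0)) (nhds 0) :=
    ((continuous_mul_const (B' + B)).tendsto' 0 0 (zero_mul _)).mono_left nhdsWithin_le_nhds
  have h0 := ge_of_tendsto lim (eventually_mem_nhdsWithin.mono fun ε hε => small ε hε)
  exact eq_neg_of_add_eq_zero_left (norm_le_zero_iff.mp h0)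

end HasWeakPartial

section Mollify

variable {G E : Type*} [NormedAddCommGroup G] [NormedSpace ℝ G] [FiniteDimensional ℝ G]
  [MeasurableSpace G] {μ : Measure G} [NormedAddCommGroup E] [NormedSpace ℝ E]

variable (μ) in
/-- The mollification of `g`, that is, its convolution with the bump function `ρ` normalized to
have integral one. -/
noncomputable def mollify (ρ : ContDiffBump (0 : G)) (g : G → E) : G → E :=
  convolution (ρ.normed μ) g (ContinuousLinearMap.lsmul ℝ ℝ) μ

lemma mollify_apply (ρ : ContDiffBump (0 : G)) (g : G → E) (x : G) :
    mollify μ ρ g x = ∫ t, ρ.normed μ t • g (x - t) ∂μ := rfl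

variable [BorelSpace G] [μ.IsAddHaarMeasure]

lemma convolutionExists_mollify (ρ : ContDiffBump (0 : G)) {g : G → E}
    (hg : LocallyIntegrable g μ) :
    ConvolutionExists (ρ.normed μ) g (ContinuousLinearMap.lsmul ℝ ℝ) μ :=
  ρ.hasCompactSupport_normed.convolutionExists_left _ ρ.continuous_normed hg

lemma contDiff_mollify (ρ : ContDiffBump (0 : G)) {g : G → E} (hg : LocallyIntegrable g μ) :
    ContDiff ℝ ∞ (mollify μ ρ g) :=
  ρ.hasCompactSupport_normed.contDiff_convolution_left _ (n := ⊤) ρ.contDiff_normed hg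

lemma mollify_sub (ρ : ContDiffBump (0 : G)) {f g : G → E} (hf : LocallyIntegrable f μ)
    (hg : LocallyIntegrable g μ) : mollify μ ρ (f - g) = mollify μ ρ f - mollify μ ρ g := by
  ext x
  simp only [mollify_apply, Pi.sub_apply, smul_sub]
  exact integral_sub (convolutionExists_mollify ρ hf x) (convolutionExists_mollify ρ hg x)

open scoped Pointwise in
lemma support_mollify_subset (ρ : ContDiffBump (0 : G)) (g : G → E) :
    Function.support (mollify μ ρ g) ⊆ Metric.thickening ρ.rOut (Function.support g) := by
  rw [← add_ball_zero, add_comm, ← ρ.support_normed_eq (μ := μ)]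
  exact support_convolution_subset _

lemma hasCompactSupport_mollify (ρ : ContDiffBump (0 : G)) {g : G → E}
    (hg : HasCompactSupport g) : HasCompactSupport (mollify μ ρ g) :=
  ρ.hasCompactSupport_normed.convolution _ hg

/-- The probability measure whose density is the normalized bump function, so that `mollify μ ρ g`
averages translates of `g` with respect to it. -/
noncomputable def bumpMeasure (μ : Measure G) (ρ : ContDiffBump (0 : G)) : Measure G :=
  μ.withDensity fun t => ENNReal.ofReal (ρ.normed μ t)

instance isProbabilityMeasure_bumpMeasure (ρ : ContDiffBump (0 : G)) :
    IsProbabilityMeasure (bumpMeasure μ ρ) := ⟨by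
  rw [bumpMeasure, withDensity_apply _ MeasurableSet.univ, Measure.restrict_univ,
    ← ofReal_integral_eq_lintegral_ofReal ρ.integrable_normed
      (ae_of_all _ fun x => ρ.nonneg_normed x), ρ.integral_normed, ENNReal.ofReal_one]⟩

lemma enorm_mollify_rpow_le (ρ : ContDiffBump (0 : G)) {g : G → E} {p : ℝ≥0∞} (hp : 1 ≤ p)
    (hp' : p ≠ ⊤) (hg : AEStronglyMeasurable g μ) (x : G) :
    ‖mollify μ ρ g x‖ₑ ^ p.toReal ≤ ∫⁻ t, ‖g (x - t)‖ₑ ^ p.toReal ∂(bumpMeasure μ ρ) := by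
  have hp0 : p ≠ 0 := (zero_lt_one.trans_le hp).ne'
  have hgx : AEStronglyMeasurable (fun t => g (x - t)) μ :=
    hg.comp_quasiMeasurePreserving (quasiMeasurePreserving_sub_left_of_right_invariant μ x)
  have h1 : ‖mollify μ ρ g x‖ₑ ≤ eLpNorm (fun t => g (x - t)) 1 (bumpMeasure μ ρ) := by
    rw [mollify_apply, eLpNorm_one_eq_lintegral_enorm, bumpMeasure,
      lintegral_withDensity_eq_lintegral_mul₀
        ρ.continuous_normed.measurable.ennreal_ofReal.aemeasurable hgx.enorm]
    refine (enorm_integral_le_lintegral_enorm _).trans_eq (lintegral_congr fun t => ?_)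
    rw [enorm_smul, Pi.mul_apply, Real.enorm_eq_ofReal (ρ.nonneg_normed t)]
  have h2 := h1.trans (eLpNorm_le_eLpNorm_of_exponent_le hp
    (hgx.mono_ac (withDensity_absolutelyContinuous _ _)))
  rw [eLpNorm_eq_lintegral_rpow_enorm_toReal hp0 hp'] at h2
  calc ‖mollify μ ρ g x‖ₑ ^ p.toReal
      ≤ ((∫⁻ t, ‖g (x - t)‖ₑ ^ p.toReal ∂(bumpMeasure μ ρ)) ^ (1 / p.toReal)) ^ p.toReal := by
        gcongr
    _ = _ := by
        rw [← ENNReal.rpow_mul, one_div_mul_cancel (ENNReal.toReal_pos hp0 hp').ne',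
          ENNReal.rpow_one]

lemma eLpNorm_mollify_le (ρ : ContDiffBump (0 : G)) {g : G → E} {p : ℝ≥0∞} (hp : 1 ≤ p)
    (hp' : p ≠ ⊤) (hg : AEStronglyMeasurable g μ) :
    eLpNorm (mollify μ ρ g) p μ ≤ eLpNorm g p μ := by
  have hp0 : p ≠ 0 := (zero_lt_one.trans_le hp).ne'
  rw [eLpNorm_eq_lintegral_rpow_enorm_toReal hp0 hp',
    eLpNorm_eq_lintegral_rpow_enorm_toReal hp0 hp']
  gcongr ?_ ^ _
  calc ∫⁻ x, ‖mollify μ ρ g x‖ₑ ^ p.toReal ∂μ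
      ≤ ∫⁻ x, (∫⁻ t, ‖g (x - t)‖ₑ ^ p.toReal ∂(bumpMeasure μ ρ)) ∂μ :=
        lintegral_mono fun x => enorm_mollify_rpow_le ρ hp hp' hg x
    _ = ∫⁻ t, (∫⁻ x, ‖g (x - t)‖ₑ ^ p.toReal ∂μ) ∂(bumpMeasure μ ρ) :=
        lintegral_lintegral_swap ((hg.comp_quasiMeasurePreserving
          (quasiMeasurePreserving_sub_of_right_invariant μ (bumpMeasure μ ρ))).enorm.pow_const _)
    _ = ∫⁻ _t, (∫⁻ x, ‖g x‖ₑ ^ p.toReal ∂μ) ∂(bumpMeasure μ ρ) :=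
        lintegral_congr fun t => lintegral_sub_right_eq_self (fun x => ‖g x‖ₑ ^ p.toReal) t
    _ = _ := by simp

open Filter Topology

variable [CompleteSpace E] {ι : Type*} {l : Filter ι} {ρ : ι → ContDiffBump (0 : G)}

lemma tendsto_eLpNorm_sub_mollify_of_continuous {g : G → E} (hg : Continuous g)
    (hgc : HasCompactSupport g) (hρ : Tendsto (fun i => (ρ i).rOut) l (𝓝 0)) (p : ℝ≥0∞) :
    Tendsto (fun i => eLpNorm (g - mollify μ (ρ i) g) p μ) l (𝓝 0) := by
  set K := Metric.cthickening 1 (tsupport g)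
  have hK : μ K ^ p.toReal⁻¹ ≠ ⊤ :=
    ENNReal.rpow_ne_top_of_nonneg (by positivity) hgc.isCompact.cthickening.measure_lt_top.ne
  rw [ENNReal.tendsto_nhds_zero]
  intro ε hε
  obtain ⟨η, hη, hηε⟩ := ENNReal.exists_nnreal_pos_mul_lt hK hε.ne'
  obtain ⟨δ, hδ, hδg⟩ := Metric.uniformContinuous_iff.mp
    (hgc.uniformContinuous_of_continuous hg) η hη
  filter_upwards [hρ.eventually (gt_mem_nhds (lt_min hδ one_pos))] with i hi
  have hsupp : Function.support (g - mollify μ (ρ i) g) ⊆ K := by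
    refine (Function.support_sub _ _).trans (union_subset
      ((subset_tsupport g).trans (Metric.self_subset_cthickening _))
      ((support_mollify_subset (μ := μ) (ρ i) g).trans ?_))
    exact (Metric.thickening_mono (hi.le.trans (min_le_right _ _)) _).trans
      ((Metric.thickening_subset_of_subset _ (subset_tsupport g)).trans
        (Metric.thickening_subset_cthickening _ _))
  have hbound : ∀ x, ‖(g - mollify μ (ρ i) g) x‖ ≤ η := fun x => by
    rw [Pi.sub_apply, ← dist_eq_norm, dist_comm]
    exact (ρ i).dist_normed_convolution_le (μ := μ) hg.aestronglyMeasurable fun y hy =>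
      (hδg ((Metric.mem_ball.mp hy).trans (hi.trans_le (min_le_left _ _)))).le
  rw [← eLpNorm_restrict_eq_of_support_subset hsupp]
  refine (eLpNorm_le_of_ae_bound (ae_of_all _ hbound)).trans ?_
  simpa [mul_comm] using hηε.le

lemma tendsto_eLpNorm_sub_mollify {g : G → E} {p : ℝ≥0∞} (hp : 1 ≤ p) (hp' : p ≠ ⊤)
    (hg : MemLp g p μ) (hρ : Tendsto (fun i => (ρ i).rOut) l (𝓝 0)) :
    Tendsto (fun i => eLpNorm (g - mollify μ (ρ i) g) p μ) l (𝓝 0) := by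
  rw [ENNReal.tendsto_nhds_zero]
  intro ε hε
  have hε3 : ε / 3 ≠ 0 := by simp [hε.ne']
  obtain ⟨f, hfc, hgf, hf, hfp⟩ := hg.exists_hasCompactSupport_eLpNorm_sub_le hp' hε3
  have hgl := hg.locallyIntegrable hp
  have hfl := hf.locallyIntegrable (μ := μ)
  have hgfm : AEStronglyMeasurable (g - f) μ := (hg.sub hfp).aestronglyMeasurable
  filter_upwards [ENNReal.tendsto_nhds_zero.mp
    (tendsto_eLpNorm_sub_mollify_of_continuous (μ := μ) hf hfc hρ p) (ε / 3) hε3.bot_lt] with i hi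
  have hfm : AEStronglyMeasurable (f - mollify μ (ρ i) f) μ :=
    (hf.sub (contDiff_mollify (ρ i) hfl).continuous).aestronglyMeasurable
  have hgfm' : AEStronglyMeasurable (mollify μ (ρ i) (g - f)) μ :=
    (contDiff_mollify (ρ i) (hgl.sub hfl)).continuous.aestronglyMeasurable
  calc eLpNorm (g - mollify μ (ρ i) g) p μ
      = eLpNorm (g - f + (f - mollify μ (ρ i) f) - mollify μ (ρ i) (g - f)) p μ := by
        rw [mollify_sub (ρ i) hgl hfl]
        congr 1; abel
    _ ≤ eLpNorm (g - f) p μ + eLpNorm (f - mollify μ (ρ i) f) p μ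
        + eLpNorm (mollify μ (ρ i) (g - f)) p μ :=
        (eLpNorm_sub_le (hgfm.add hfm) hgfm' hp).trans
          (add_le_add_left (eLpNorm_add_le hgfm hfm hp) _)
    _ ≤ ε / 3 + ε / 3 + ε / 3 :=
        add_le_add (add_le_add hgf hi) ((eLpNorm_mollify_le (ρ i) hp hp' hgfm).trans hgf)
    _ = ε := ENNReal.add_thirds ε

end Mollify

lemma mollify_euclidean_apply {ι : Type*} [Fintype ι] {g : Plane → EuclideanSpace ℝ ι}
    (hg : LocallyIntegrable g volume) (ρ : ContDiffBump (0 : Plane)) (x : Plane) (i : ι) :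
    mollify volume ρ g x i = mollify volume ρ (fun y => g y i) x :=
  ((EuclideanSpace.proj (𝕜 := ℝ) i : EuclideanSpace ℝ ι →L[ℝ] ℝ).integral_comp_comm
    (convolutionExists_mollify ρ hg x)).symm

lemma HasWeakPartial.fderiv_mollify {k : Fin 2} {g h : Plane → ℝ} (H : HasWeakPartial univ k g h)
    (ρ : ContDiffBump (0 : Plane)) (x : Plane) :
    fderiv ℝ (mollify volume ρ g) x (planeBasis k) = mollify volume ρ h x := by
  have hg := locallyIntegrableOn_univ.mp H.1
  have hρ : ContDiff ℝ ∞ (ρ.normed volume) := ρ.contDiff_normed (n := ⊤)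
  have hfderiv := (ρ.hasCompactSupport_normed.hasFDerivAt_convolution_left (μ := volume)
    (ContinuousLinearMap.lsmul ℝ ℝ) (hρ.of_le (by simp)) hg x).fderiv
  have hInt := ((ρ.hasCompactSupport_normed.fderiv ℝ).convolutionExists_left
    (μ := volume) (ContinuousLinearMap.precompL Plane (ContinuousLinearMap.lsmul ℝ ℝ))
    (hρ.continuous_fderiv (by simp)) hg x).integrable_swap
  have htest : IsTestFunction univ (fun t => ρ.normed volume (x - t)) :=
    ⟨hρ.comp (contDiff_const.sub contDiff_id),
      ρ.hasCompactSupport_normed.comp_homeomorph (Homeomorph.subLeft x), subset_univ _⟩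
  have hD : ∀ t, fderiv ℝ (fun t => ρ.normed volume (x - t)) t (planeBasis k) =
      - fderiv ℝ (ρ.normed volume) (x - t) (planeBasis k) := fun t => by
    simpa [sub_eq_add_neg] using
      DFunLike.congr_fun (fderiv_comp_add_smul (ρ.normed volume) x t (-1)) (planeBasis k)
  have key := H.integral_eq htest
  simp only [hD, mul_neg, integral_neg, neg_inj] at key
  calc fderiv ℝ (mollify volume ρ g) x (planeBasis k)
      = ∫ t, g t * fderiv ℝ (ρ.normed volume) (x - t) (planeBasis k) := by
        rw [mollify, hfderiv, convolution_eq_swap, ContinuousLinearMap.integral_apply hInt]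
        simp [mul_comm]
    _ = mollify volume ρ h x := by
        rw [key, mollify, convolution_eq_swap]
        simp [mul_comm]

section EuclideanCoordinates

lemma tsupport_apply_subset {X ι : Type*} [TopologicalSpace X]
    (f : X → EuclideanSpace ℝ ι) (i : ι) :
    tsupport (fun x => f x i) ⊆ tsupport f :=
  tsupport_comp_subset (g := fun v : EuclideanSpace ℝ ι => v i) rfl f

variable {ι : Type*} [Fintype ι]

lemma euclidean_norm_le_of_forall_abs_le {x : EuclideanSpace ℝ ι} {c : ℝ} (h : ∀ i, |x i| ≤ c) :
    ‖x‖ ≤ Fintype.card ι * c := by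
  have hsum : ∑ i, ‖x i‖ ≤ Fintype.card ι * c := by
    simpa using Finset.sum_le_card_nsmul Finset.univ _ c fun i _ => h i
  have h0 : 0 ≤ ∑ i, ‖x i‖ := Finset.sum_nonneg fun i _ => norm_nonneg _
  rw [EuclideanSpace.norm_eq, Real.sqrt_le_left (h0.trans hsum)]
  exact (Finset.sum_sq_le_sq_sum_of_nonneg fun i _ => norm_nonneg _).trans
    (pow_le_pow_left₀ h0 hsum 2)

lemma IsTestFunction.of_apply {Ω : Set Plane} {ψ : Plane → EuclideanSpace ℝ ι}
    (h : ∀ i, IsTestFunction Ω (fun x => ψ x i)) : IsTestFunction Ω ψ := by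
  have hs : tsupport ψ ⊆ ⋃ i, tsupport (fun x => ψ x i) := by
    refine closure_minimal (fun x hx => ?_) (isClosed_iUnion_of_finite fun i => isClosed_tsupport _)
    by_contra hx'
    simp only [mem_iUnion, not_exists] at hx'
    exact hx (PiLp.ext fun i => image_eq_zero_of_notMem_tsupport (f := fun x => ψ x i) (hx' i))
  exact ⟨contDiff_euclidean.mpr fun i => (h i).contDiff,
    (isCompact_iUnion fun i => (h i).hasCompactSupport).of_isClosed_subset (isClosed_tsupport ψ) hs,
    hs.trans (iUnion_subset fun i => (h i).tsupport_subset)⟩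

lemma IsTestFunction.apply {Ω : Set Plane} {ψ : Plane → EuclideanSpace ℝ ι}
    (hψ : IsTestFunction Ω ψ) (i : ι) : IsTestFunction Ω (fun x => ψ x i) :=
  ⟨contDiff_euclidean.mp hψ.contDiff i,
    hψ.hasCompactSupport.of_isClosed_subset (isClosed_tsupport _) (tsupport_apply_subset ψ i),
    (tsupport_apply_subset ψ i).trans hψ.tsupport_subset⟩

end EuclideanCoordinates

section Classical

variable {m : ℕ} {Ω : Set Plane} {ψ : Plane → Vec m}

lemma contDiff_classicalGrad (hψ : ContDiff ℝ ∞ ψ) : ContDiff ℝ ∞ (classicalGrad ψ) :=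
  contDiff_euclidean.mpr fun a => contDiff_fderiv_apply (contDiff_euclidean.mp hψ a.1) _

lemma contDiff_classicalHess (hψ : ContDiff ℝ ∞ ψ) : ContDiff ℝ ∞ (classicalHess ψ) :=
  contDiff_euclidean.mpr fun _ =>
    contDiff_fderiv_apply (contDiff_euclidean.mp (contDiff_classicalGrad hψ) _) _

lemma IsTestFunction.classicalGrad (hψ : IsTestFunction Ω ψ) :
    IsTestFunction Ω (classicalGrad ψ) :=
  .of_apply fun a => (hψ.apply a.1).fderiv_apply _

lemma IsTestFunction.classicalHess (hψ : IsTestFunction Ω ψ) :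
    IsTestFunction Ω (classicalHess ψ) :=
  .of_apply fun a => (hψ.classicalGrad.apply (a.1, a.2.1)).fderiv_apply _

end Classical

/-- Symmetry of a Hessian in its two differentiation indices. -/
def IsSymmHess {m : ℕ} (ξ : HessSpace m) : Prop := ∀ i j k, ξ (i, j, k) = ξ (i, k, j)

lemma fderiv_fderiv_apply_comm {g : Plane → ℝ} (hg : ContDiff ℝ ∞ g) (x v w : Plane) :
    fderiv ℝ (fun y => fderiv ℝ g y v) x w = fderiv ℝ (fun y => fderiv ℝ g y w) x v := by
  have hdiff : DifferentiableAt ℝ (fderiv ℝ g) x :=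
    (hg.fderiv_right (m := ∞) (by simp)).differentiable (by simp) x
  have hsymm : IsSymmSndFDerivAt ℝ g x := hg.contDiffAt.isSymmSndFDerivAt (by
    simpa using WithTop.coe_le_coe.mpr (le_top : (2 : ℕ∞) ≤ ⊤))
  rw [fderiv_clm_apply hdiff (differentiableAt_const _),
    fderiv_clm_apply hdiff (differentiableAt_const _)]
  simpa using hsymm w v

lemma isSymmHess_classicalHess {m : ℕ} {ψ : Plane → Vec m} (hψ : ContDiff ℝ ∞ ψ) (x : Plane) :
    IsSymmHess (classicalHess ψ x) := fun i _ _ =>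
  fderiv_fderiv_apply_comm (contDiff_euclidean.mp hψ i) x _ _

/-- The weak gradient and the weak Hessian of `u` on `Ω` are `Du` and `D2u`; this is `IsSobolev2`
without the integrability conditions. -/
structure HasWeakDerivs {m : ℕ} (Ω : Set Plane) (u : Plane → Vec m)
    (Du : Plane → GradSpace m) (D2u : Plane → HessSpace m) : Prop where
  weak_grad : ∀ i j, HasWeakPartial Ω j (fun x => u x i) (fun x => Du x (i, j))
  weak_hess : ∀ i j k, HasWeakPartial Ω k (fun x => Du x (i, j)) (fun x => D2u x (i, j, k))

lemma IsSobolev2.hasWeakDerivs {m : ℕ} {Ω : Set Plane} {q : ℝ≥0∞} {u : Plane → Vec m}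
    {Du : Plane → GradSpace m} {D2u : Plane → HessSpace m} (H : IsSobolev2 Ω q u Du D2u) :
    HasWeakDerivs Ω u Du D2u := ⟨H.weak_grad, H.weak_hess⟩

namespace HasWeakDerivs

variable {m : ℕ} {Ω : Set Plane} {u v : Plane → Vec m} {Du Dv : Plane → GradSpace m}
  {D2u D2v : Plane → HessSpace m}

lemma mono (H : HasWeakDerivs Ω u Du D2u) {Ω' : Set Plane} (hs : Ω' ⊆ Ω) :
    HasWeakDerivs Ω' u Du D2u :=
  ⟨fun i j => (H.weak_grad i j).mono hs, fun i j k => (H.weak_hess i j k).mono hs⟩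

lemma add (H : HasWeakDerivs Ω u Du D2u) (H' : HasWeakDerivs Ω v Dv D2v) :
    HasWeakDerivs Ω (fun x => u x + v x) (fun x => Du x + Dv x) (fun x => D2u x + D2v x) :=
  ⟨fun i j => (H.weak_grad i j).add (H'.weak_grad i j),
    fun i j k => (H.weak_hess i j k).add (H'.weak_hess i j k)⟩

lemma const_smul (H : HasWeakDerivs Ω u Du D2u) (c : ℝ) :
    HasWeakDerivs Ω (fun x => c • u x) (fun x => c • Du x) (fun x => c • D2u x) :=
  ⟨fun i j => (H.weak_grad i j).const_mul c, fun i j k => (H.weak_hess i j k).const_mul c⟩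

lemma sub (H : HasWeakDerivs Ω u Du D2u) (H' : HasWeakDerivs Ω v Dv D2v) :
    HasWeakDerivs Ω (fun x => u x - v x) (fun x => Du x - Dv x) (fun x => D2u x - D2v x) := by
  simpa [sub_eq_add_neg] using H.add (H'.const_smul (-1))

lemma zero (Ω : Set Plane) : HasWeakDerivs Ω (fun _ => (0 : Vec m)) (fun _ => 0) (fun _ => 0) :=
  ⟨fun _ j => HasWeakPartial.zero Ω j, fun _ _ k => HasWeakPartial.zero Ω k⟩

lemma of_contDiff {ψ : Plane → Vec m} (hψ : ContDiff ℝ ∞ ψ) :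
    HasWeakDerivs univ ψ (classicalGrad ψ) (classicalHess ψ) :=
  ⟨fun i j => HasWeakPartial.of_contDiff (contDiff_euclidean.mp hψ i) j,
    fun i j k => HasWeakPartial.of_contDiff
      (contDiff_euclidean.mp (contDiff_classicalGrad hψ) (i, j)) k⟩

lemma integral_hess_mul (H : HasWeakDerivs Ω u Du D2u) {φ : Plane → ℝ}
    (hφ : IsTestFunction Ω φ) (i : Fin m) (j k : Fin 2) :
    ∫ x, D2u x (i, j, k) * φ x = ∫ x, u x i *
      fderiv ℝ (fun y => fderiv ℝ φ y (planeBasis k)) x (planeBasis j) := by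
  rw [(H.weak_grad i j).integral_eq (hφ.fderiv_apply (planeBasis k)),
    (H.weak_hess i j k).integral_eq hφ, neg_neg]

lemma isSymmHess_ae (H : HasWeakDerivs Ω u Du D2u) (hΩ : IsOpen Ω) :
    ∀ᵐ x ∂(volume.restrict Ω), IsSymmHess (D2u x) := by
  simp only [IsSymmHess, ae_all_iff]
  intro i j k
  have hjk := (H.weak_hess i j k).2.1
  have hkj := (H.weak_hess i k j).2.1
  have key : ∀ᵐ x, x ∈ Ω → D2u x (i, j, k) - D2u x (i, k, j) = 0 := by
    refine hΩ.ae_eq_zero_of_integral_contDiff_smul_eq_zero (hjk.sub hkj) fun φ hφ hc hs => ?_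
    have hφ : IsTestFunction Ω φ := ⟨hφ, hc, hs⟩
    simp only [smul_eq_mul, mul_comm (φ _), sub_mul]
    rw [integral_sub (hφ.integrable_mul hjk) (hφ.integrable_mul hkj), H.integral_hess_mul hφ,
      H.integral_hess_mul hφ, sub_eq_zero]
    simp only [fderiv_fderiv_apply_comm hφ.contDiff _ (planeBasis k)]
  exact (ae_restrict_iff' hΩ.measurableSet).mpr (key.mono fun x hx hxΩ => sub_eq_zero.mp (hx hxΩ))

lemma classicalGrad_mollify (H : HasWeakDerivs univ u Du D2u) (hu : LocallyIntegrable u volume)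
    (hDu : LocallyIntegrable Du volume) (ρ : ContDiffBump (0 : Plane)) :
    classicalGrad (mollify volume ρ u) = mollify volume ρ Du := by
  ext x ⟨i, j⟩
  rw [mollify_euclidean_apply hDu, ← (H.weak_grad i j).fderiv_mollify ρ x]
  simp only [classicalGrad, mollify_euclidean_apply hu]

lemma classicalHess_mollify (H : HasWeakDerivs univ u Du D2u) (hu : LocallyIntegrable u volume)
    (hDu : LocallyIntegrable Du volume) (hD2u : LocallyIntegrable D2u volume)
    (ρ : ContDiffBump (0 : Plane)) :
    classicalHess (mollify volume ρ u) = mollify volume ρ D2u := by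
  ext x ⟨i, j, k⟩
  rw [mollify_euclidean_apply hD2u, ← (H.weak_hess i j k).fderiv_mollify ρ x]
  simp only [classicalHess, H.classicalGrad_mollify hu hDu, mollify_euclidean_apply hDu]

open Filter Topology in
lemma exists_isTestFunction_approx (H : HasWeakDerivs univ u Du D2u) {p : ℝ≥0∞} (hp : 1 ≤ p)
    (hp' : p ≠ ⊤) (hu : MemLp u p volume) (hDu : MemLp Du p volume) (hD2u : MemLp D2u p volume)
    (huc : HasCompactSupport u) (hΩ : IsOpen Ω) (huΩ : tsupport u ⊆ Ω) {ε : ℝ≥0∞} (hε : ε ≠ 0) :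
    ∃ ψ : Plane → Vec m, IsTestFunction Ω ψ ∧ eLpNorm (u - ψ) p volume ≤ ε ∧
      eLpNorm (Du - classicalGrad ψ) p volume ≤ ε ∧
      eLpNorm (D2u - classicalHess ψ) p volume ≤ ε := by
  let ρ (n : ℕ) : ContDiffBump (0 : Plane) :=
    ⟨1 / (n + 1) / 2, 1 / (n + 1), by positivity, half_lt_self (by positivity)⟩
  have hρ : Tendsto (fun n => (ρ n).rOut) atTop (𝓝 0) := tendsto_one_div_add_atTop_nhds_zero_nat
  obtain ⟨r, hr, hrΩ⟩ := huc.exists_cthickening_subset_open hΩ huΩ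
  have small {ι : Type} [Fintype ι] {g : Plane → EuclideanSpace ℝ ι} (hg : MemLp g p volume) :
      ∀ᶠ n in atTop, eLpNorm (g - mollify volume (ρ n) g) p volume ≤ ε :=
    ENNReal.tendsto_nhds_zero.mp (tendsto_eLpNorm_sub_mollify hp hp' hg hρ) ε hε.bot_lt
  obtain ⟨n, hn, hn₀, hn₁, hn₂⟩ := (((hρ.eventually (gt_mem_nhds hr)).and ((small hu).and
    ((small hDu).and (small hD2u))))).exists
  have hul := hu.locallyIntegrable hp
  have hDul := hDu.locallyIntegrable hp
  refine ⟨mollify volume (ρ n) u, ⟨contDiff_mollify _ hul, hasCompactSupport_mollify _ huc, ?_⟩,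
    hn₀, ?_, ?_⟩
  · refine Subset.trans (closure_minimal ?_ Metric.isClosed_cthickening) hrΩ
    exact (support_mollify_subset _ _).trans ((Metric.thickening_mono hn.le _).trans
      ((Metric.thickening_subset_of_subset _ (subset_tsupport u)).trans
        (Metric.thickening_subset_cthickening _ _)))
  · rwa [H.classicalGrad_mollify hul hDul]
  · rwa [H.classicalHess_mollify hul hDul (hD2u.locallyIntegrable hp)]

end HasWeakDerivs

section Cutoff

variable {m : ℕ} {Ω : Set Plane} {χ : Plane → ℝ} {u : Plane → Vec m} {Du : Plane → GradSpace m}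
  {D2u : Plane → HessSpace m}

/-- The gradient of `χ u` according to the Leibniz rule. -/
noncomputable def cutoffGrad (χ : Plane → ℝ) (u : Plane → Vec m) (Du : Plane → GradSpace m)
    (x : Plane) : GradSpace m :=
  WithLp.toLp 2 fun a => fderiv ℝ χ x (planeBasis a.2) * u x a.1 + χ x * Du x a

/-- The Hessian of `χ u` according to the Leibniz rule. -/
noncomputable def cutoffHess (χ : Plane → ℝ) (u : Plane → Vec m) (Du : Plane → GradSpace m)
    (D2u : Plane → HessSpace m) (x : Plane) : HessSpace m :=
  WithLp.toLp 2 fun a =>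
    (fderiv ℝ (fun y => fderiv ℝ χ y (planeBasis a.2.1)) x (planeBasis a.2.2) * u x a.1 +
      fderiv ℝ χ x (planeBasis a.2.1) * Du x (a.1, a.2.2)) +
    (fderiv ℝ χ x (planeBasis a.2.2) * Du x (a.1, a.2.1) + χ x * D2u x a)

lemma HasWeakDerivs.cutoff (H : HasWeakDerivs Ω u Du D2u) (hχ : IsTestFunction Ω χ) :
    HasWeakDerivs univ (fun x => χ x • u x) (cutoffGrad χ u Du) (cutoffHess χ u Du D2u) :=
  ⟨fun i j => (H.weak_grad i j).cutoff_mul hχ, fun i j k =>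
    ((H.weak_grad i k).cutoff_mul (hχ.fderiv_apply _)).add ((H.weak_hess i j k).cutoff_mul hχ)⟩

lemma IsTestFunction.memLp_mul (hχ : IsTestFunction Ω χ) (hΩ : MeasurableSet Ω) {q : ℝ≥0∞}
    {g : Plane → ℝ} (hg : MemLp g q (volume.restrict Ω)) :
    MemLp (fun x => χ x * g x) q volume := by
  obtain ⟨B, hB⟩ := hχ.exists_norm_le
  have hmem : MemLp (fun x => χ x * g x) q (volume.restrict Ω) :=
    hg.of_le_mul (c := B) (hχ.contDiff.continuous.aestronglyMeasurable.mul hg.1)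
      (ae_of_all _ fun x => by rw [norm_mul]; gcongr; exact hB x)
  have hind : Ω.indicator (fun x => χ x * g x) = fun x => χ x * g x :=
    indicator_eq_self.mpr fun x hx => by_contra fun h => hx (by simp [hχ.eq_zero h])
  rwa [← hind, memLp_indicator_iff_restrict hΩ]

lemma IsSobolev2.memLp_cutoff (hΩ : MeasurableSet Ω) {q : ℝ≥0∞} (H : IsSobolev2 Ω q u Du D2u)
    (hχ : IsTestFunction Ω χ) :
    MemLp (fun x => χ x • u x) q volume ∧ MemLp (cutoffGrad χ u Du) q volume ∧
      MemLp (cutoffHess χ u Du D2u) q volume := by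
  have hu := memLp_piLp_iff.mp H.memLp
  have hDu := memLp_piLp_iff.mp H.memLp_grad
  have hD2u := memLp_piLp_iff.mp H.memLp_hess
  have hDχ (k) := hχ.fderiv_apply (planeBasis k)
  refine ⟨memLp_piLp_iff.mpr fun i => hχ.memLp_mul hΩ (hu i), memLp_piLp_iff.mpr fun a => ?_,
    memLp_piLp_iff.mpr fun a => ?_⟩
  · exact ((hDχ _).memLp_mul hΩ (hu _)).add (hχ.memLp_mul hΩ (hDu a))
  · exact ((((hDχ _).fderiv_apply _).memLp_mul hΩ (hu _)).add
      ((hDχ _).memLp_mul hΩ (hDu _))).add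
      (((hDχ _).memLp_mul hΩ (hDu _)).add (hχ.memLp_mul hΩ (hD2u a)))

lemma classicalGrad_smul (hχ : ContDiff ℝ ∞ χ) (hu : ContDiff ℝ ∞ u) :
    classicalGrad (fun x => χ x • u x) = cutoffGrad χ u (classicalGrad u) := by
  ext x a
  simp only [classicalGrad, cutoffGrad, PiLp.smul_apply, smul_eq_mul]
  rw [fderiv_fun_mul (hχ.differentiable (by simp) x)
    ((contDiff_euclidean.mp hu a.1).differentiable (by simp) x)]
  simp [mul_comm, add_comm]

lemma classicalHess_smul (hχ : ContDiff ℝ ∞ χ) (hu : ContDiff ℝ ∞ u) :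
    classicalHess (fun x => χ x • u x) =
      cutoffHess χ u (classicalGrad u) (classicalHess u) := by
  ext x a
  have hχ' := (hχ.differentiable (by simp)) x
  have hDχ := ((contDiff_fderiv_apply hχ (planeBasis a.2.1)).differentiable (by simp)) x
  have hu' := (contDiff_euclidean.mp hu a.1).differentiable (by simp) x
  have hDu := (contDiff_euclidean.mp (contDiff_classicalGrad hu) (a.1, a.2.1)).differentiable
    (by simp) x
  simp only [classicalHess, classicalGrad_smul hχ hu, cutoffGrad, cutoffHess]
  rw [fderiv_fun_add (hDχ.fun_mul hu') (hχ'.fun_mul hDu), fderiv_fun_mul hDχ hu',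
    fderiv_fun_mul hχ' hDu]
  simp [classicalGrad]
  ring

lemma cutoff_eq_of_eq_one {V : Set Plane} (hV : IsOpen V) (h1 : ∀ x ∈ V, χ x = 1)
    (u : Plane → Vec m) (Du : Plane → GradSpace m) (D2u : Plane → HessSpace m) {x : Plane}
    (hx : x ∈ V) :
    χ x • u x = u x ∧ cutoffGrad χ u Du x = Du x ∧ cutoffHess χ u Du D2u x = D2u x := by
  have hDχ : ∀ z ∈ V, fderiv ℝ χ z = 0 := fun z hz => by
    have : χ =ᶠ[nhds z] fun _ => (1 : ℝ) := Filter.eventuallyEq_of_mem (hV.mem_nhds hz) h1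
    rw [this.fderiv_eq]; simp
  have hD2χ (e w) : fderiv ℝ (fun y => fderiv ℝ χ y e) x w = 0 := by
    have : (fun y => fderiv ℝ χ y e) =ᶠ[nhds x] fun _ => (0 : ℝ) :=
      Filter.eventuallyEq_of_mem (hV.mem_nhds hx) fun z hz => by simp [hDχ z hz]
    rw [this.fderiv_eq]; simp
  refine ⟨by simp [h1 x hx], ?_, ?_⟩
  · ext a; simp [cutoffGrad, hDχ x hx, h1 x hx]
  · ext a; simp [cutoffHess, hDχ x hx, h1 x hx, hD2χ]

section Bounds

variable {M : ℝ} {x : Plane}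

lemma IsTestFunction.exists_abs_derivs_le (hχ : IsTestFunction Ω χ) :
    ∃ M : ℝ, ∀ x, |χ x| ≤ M ∧ (∀ k, |fderiv ℝ χ x (planeBasis k)| ≤ M) ∧
      ∀ j k, |fderiv ℝ (fun y => fderiv ℝ χ y (planeBasis j)) x (planeBasis k)| ≤ M := by
  obtain ⟨B, hB⟩ := hχ.exists_norm_le
  choose B₁ hB₁ using fun k => (hχ.fderiv_apply (planeBasis k)).exists_norm_le
  choose B₂ hB₂ using fun a : Fin 2 × Fin 2 =>
    ((hχ.fderiv_apply (planeBasis a.1)).fderiv_apply (planeBasis a.2)).exists_norm_le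
  obtain ⟨M₁, hM₁⟩ := Finite.exists_le B₁
  obtain ⟨M₂, hM₂⟩ := Finite.exists_le B₂
  exact ⟨max B (max M₁ M₂), fun x => ⟨le_max_of_le_left (hB x),
    fun k => le_max_of_le_right (le_max_of_le_left ((hB₁ k x).trans (hM₁ k))),
    fun j k => le_max_of_le_right (le_max_of_le_right ((hB₂ (j, k) x).trans (hM₂ (j, k))))⟩⟩

lemma norm_cutoffGrad_le (h0 : |χ x| ≤ M) (h1 : ∀ k, |fderiv ℝ χ x (planeBasis k)| ≤ M) :
    ‖cutoffGrad χ u Du x‖ ≤ Fintype.card (Fin m × Fin 2) * (M * (‖u x‖ + ‖Du x‖)) := by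
  have hM : 0 ≤ M := (abs_nonneg _).trans h0
  refine euclidean_norm_le_of_forall_abs_le fun a => ?_
  rw [mul_add]
  refine (abs_add_le _ _).trans ?_
  simp only [abs_mul]
  gcongr
  exacts [h1 a.2, PiLp.norm_apply_le (u x) a.1, PiLp.norm_apply_le (Du x) a]

lemma norm_cutoffHess_le (h0 : |χ x| ≤ M) (h1 : ∀ k, |fderiv ℝ χ x (planeBasis k)| ≤ M)
    (h2 : ∀ j k, |fderiv ℝ (fun y => fderiv ℝ χ y (planeBasis j)) x (planeBasis k)| ≤ M) :
    ‖cutoffHess χ u Du D2u x‖ ≤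
      Fintype.card (Fin m × Fin 2 × Fin 2) * (M * (‖u x‖ + ‖Du x‖ + (‖Du x‖ + ‖D2u x‖))) := by
  have hM : 0 ≤ M := (abs_nonneg _).trans h0
  refine euclidean_norm_le_of_forall_abs_le fun a => ?_
  simp only [mul_add]
  refine (abs_add_le _ _).trans (add_le_add ((abs_add_le _ _).trans ?_)
    ((abs_add_le _ _).trans ?_))
  all_goals
    simp only [abs_mul]
    gcongr
  exacts [h2 _ _, PiLp.norm_apply_le (u x) _, h1 _, PiLp.norm_apply_le (Du x) _, h1 _,
    PiLp.norm_apply_le (Du x) _, PiLp.norm_apply_le (D2u x) _]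

end Bounds

end Cutoff

section Squares

variable {a x : Plane} {r : ℝ}

/-- The open square with centre `a` and side `r`. -/
def square (a : Plane) (r : ℝ) : Set Plane := {x | ∀ i, |x i - a i| < r / 2}

/-- The closed square with centre `a` and side `r`. -/
def closedSquare (a : Plane) (r : ℝ) : Set Plane := {x | ∀ i, |x i - a i| ≤ r / 2}

lemma square_zero_one : square 0 1 = unitSquare := by
  ext x; simp [square, unitSquare]

lemma square_eq_preimage_ball (a : Plane) (hr : 0 < r) :
    square a r = WithLp.ofLp ⁻¹' Metric.ball a.ofLp (r / 2) := by
  ext x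
  simp [square, dist_pi_lt_iff (half_pos hr), Real.dist_eq]

lemma closedSquare_eq_preimage_closedBall (a : Plane) (hr : 0 ≤ r) :
    closedSquare a r = WithLp.ofLp ⁻¹' Metric.closedBall a.ofLp (r / 2) := by
  ext x
  simp [closedSquare, dist_pi_le_iff (div_nonneg hr zero_le_two), Real.dist_eq]

lemma isOpen_square (a : Plane) (r : ℝ) : IsOpen (square a r) := by
  simp only [square, ofPred_forall]
  exact isOpen_iInter_of_finite fun i => isOpen_lt (by fun_prop) continuous_const

lemma isClosed_closedSquare (a : Plane) (r : ℝ) : IsClosed (closedSquare a r) := by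
  simp only [closedSquare, ofPred_forall]
  exact isClosed_iInter fun i => isClosed_le (by fun_prop) continuous_const

lemma isOpen_unitSquare : IsOpen unitSquare := square_zero_one ▸ isOpen_square 0 1

lemma zero_mem_unitSquare : (0 : Plane) ∈ unitSquare := fun i => by simp

lemma convex_unitSquare : Convex ℝ unitSquare := by
  rw [← square_zero_one, square_eq_preimage_ball 0 one_pos]
  exact (convex_ball _ _).linear_preimage (WithLp.linearEquiv 2 ℝ (Fin 2 → ℝ)).toLinearMap

lemma square_subset_closedSquare (a : Plane) (r : ℝ) : square a r ⊆ closedSquare a r :=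
  fun _ hx i => (hx i).le

lemma closedSquare_subset_square (a : Plane) {s : ℝ} (h : r < s) :
    closedSquare a r ⊆ square a s := fun _ hx i => (hx i).trans_lt (by linarith)

lemma closedSquare_subset_closedBall (a : Plane) (r : ℝ) :
    closedSquare a r ⊆ Metric.closedBall a r := fun x hx => by
  rw [mem_closedBall_iff_norm]
  simpa [mul_div_cancel₀] using euclidean_norm_le_of_forall_abs_le (x := x - a) hx

lemma closedBall_subset_closedSquare (a : Plane) (r : ℝ) :
    Metric.closedBall a r ⊆ closedSquare a (2 * r) := fun x hx i => by
  rw [mul_div_cancel_left₀ r two_ne_zero]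
  exact (PiLp.norm_apply_le (x - a) i).trans (mem_closedBall_iff_norm.mp hx)

lemma norm_le_one_of_mem_unitSquare (hx : x ∈ unitSquare) : ‖x‖ ≤ 1 := by
  rw [← square_zero_one] at hx
  simpa using closedSquare_subset_closedBall 0 1 (square_subset_closedSquare 0 1 hx)

lemma isCompact_closedSquare (a : Plane) (r : ℝ) : IsCompact (closedSquare a r) :=
  (isCompact_closedBall a r).of_isClosed_subset (isClosed_closedSquare a r)
    (closedSquare_subset_closedBall a r)

lemma mem_square_iff (hr : 0 < r) : x ∈ square a r ↔ r⁻¹ • (x - a) ∈ unitSquare := by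
  simp only [square, unitSquare, mem_ofPred_eq, PiLp.smul_apply, PiLp.sub_apply, smul_eq_mul,
    abs_mul, abs_inv, abs_of_pos hr]
  refine forall_congr' fun i => ?_
  rw [inv_mul_lt_iff₀ hr, mul_one_div]

lemma volume_square (a : Plane) (hr : 0 < r) : volume (square a r) = ENNReal.ofReal (r ^ 2) := by
  rw [square_eq_preimage_ball a hr, (PiLp.volume_preserving_ofLp (Fin 2)).measure_preimage
    measurableSet_ball.nullMeasurableSet, Real.volume_pi_ball _ (half_pos hr)]
  simp [mul_div_cancel₀]

lemma volume_closedSquare (a : Plane) (hr : 0 ≤ r) :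
    volume (closedSquare a r) = ENNReal.ofReal (r ^ 2) := by
  rw [closedSquare_eq_preimage_closedBall a hr,
    (PiLp.volume_preserving_ofLp (Fin 2)).measure_preimage
    measurableSet_closedBall.nullMeasurableSet,
    Real.volume_pi_closedBall _ (div_nonneg hr zero_le_two)]
  simp [mul_div_cancel₀]

lemma volume_unitSquare : volume unitSquare = 1 := by
  rw [← square_zero_one, volume_square 0 zero_lt_one]; simp

lemma indicator_square_comp_inv_smul_sub (G : Plane → ℝ) (a : Plane) (hr : 0 < r) :
    (square a r).indicator (fun x => G (r⁻¹ • (x - a))) =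
      fun x => unitSquare.indicator G (r⁻¹ • (x - a)) :=
  funext fun x => by
    classical simp only [indicator_apply, mem_square_iff hr]

lemma setIntegral_square_comp_inv_smul_sub (G : Plane → ℝ) (a : Plane) (hr : 0 < r) :
    ∫ x in square a r, G (r⁻¹ • (x - a)) = r ^ 2 * ∫ y in unitSquare, G y := by
  rw [← integral_indicator (isOpen_square a r).measurableSet,
    ← integral_indicator isOpen_unitSquare.measurableSet,
    indicator_square_comp_inv_smul_sub G a hr, integral_comp_inv_smul_sub]
  simp

lemma integrableOn_square_comp_inv_smul_sub {G : Plane → ℝ}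
    (hG : IntegrableOn G unitSquare volume) (a : Plane) (hr : 0 < r) :
    IntegrableOn (fun x => G (r⁻¹ • (x - a))) (square a r) volume := by
  rw [← integrable_indicator_iff (isOpen_square a r).measurableSet,
    indicator_square_comp_inv_smul_sub G a hr]
  exact integrable_comp_inv_smul_sub
    ((integrable_indicator_iff isOpen_unitSquare.measurableSet).mpr hG) a hr.ne'

end Squares

/-- `θ` is a bounded map on the plane with bounded weak gradient `Dθ` and bounded weak Hessian
`D2θ`, all of which vanish outside `S`. These are the perturbations which are glued together. -/
structure IsBddSobolev2 {m : ℕ} (S : Set Plane) (θ : Plane → Vec m)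
    (Dθ : Plane → GradSpace m) (D2θ : Plane → HessSpace m) : Prop where
  meas : Measurable θ
  meas_grad : Measurable Dθ
  meas_hess : Measurable D2θ
  bdd : ∃ B : ℝ, ∀ x, ‖θ x‖ ≤ B ∧ ‖Dθ x‖ ≤ B ∧ ‖D2θ x‖ ≤ B
  eq_zero : ∀ x ∉ S, θ x = 0 ∧ Dθ x = 0 ∧ D2θ x = 0
  weak : HasWeakDerivs univ θ Dθ D2θ

lemma memLp_of_bdd_of_eq_zero {α E : Type*} [MeasurableSpace α] {μ : Measure α}
    [NormedAddCommGroup E] {S : Set α} (hS : μ S ≠ ⊤) {F : α → E} (hF : AEStronglyMeasurable F μ)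
    {B : ℝ} (hB : ∀ x, ‖F x‖ ≤ B) (h0 : ∀ x ∉ S, F x = 0) (q : ℝ≥0∞) : MemLp F q μ := by
  refine ⟨hF, ?_⟩
  rw [← eLpNorm_restrict_eq_of_support_subset (s := S) fun x hx => by_contra fun h => hx (h0 x h)]
  refine (eLpNorm_le_of_ae_bound (ae_of_all _ hB)).trans_lt ?_
  exact ENNReal.mul_lt_top (ENNReal.rpow_lt_top_of_nonneg (by positivity) (by simpa using hS))
    ENNReal.ofReal_lt_top

lemma IsBddSobolev2.of_isTestFunction {m : ℕ} {S : Set Plane} {ψ : Plane → Vec m}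
    (hψ : IsTestFunction S ψ) : IsBddSobolev2 S ψ (classicalGrad ψ) (classicalHess ψ) := by
  obtain ⟨B₀, hB₀⟩ := hψ.exists_norm_le
  obtain ⟨B₁, hB₁⟩ := hψ.classicalGrad.exists_norm_le
  obtain ⟨B₂, hB₂⟩ := hψ.classicalHess.exists_norm_le
  exact ⟨hψ.contDiff.continuous.measurable, hψ.classicalGrad.contDiff.continuous.measurable,
    hψ.classicalHess.contDiff.continuous.measurable,
    ⟨max B₀ (max B₁ B₂), fun x => ⟨le_max_of_le_left (hB₀ x),
      le_max_of_le_right (le_max_of_le_left (hB₁ x)),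
      le_max_of_le_right (le_max_of_le_right (hB₂ x))⟩⟩,
    fun x hx => ⟨hψ.eq_zero hx, hψ.classicalGrad.eq_zero hx, hψ.classicalHess.eq_zero hx⟩,
    .of_contDiff hψ.contDiff⟩

namespace IsBddSobolev2

variable {m : ℕ} {S : Set Plane} {θ : Plane → Vec m} {Dθ : Plane → GradSpace m}
  {D2θ : Plane → HessSpace m}

lemma memLp (H : IsBddSobolev2 S θ Dθ D2θ) (hS : volume S ≠ ⊤) (q : ℝ≥0∞) :
    MemLp θ q volume ∧ MemLp Dθ q volume ∧ MemLp D2θ q volume := by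
  obtain ⟨B, hB⟩ := H.bdd
  exact ⟨memLp_of_bdd_of_eq_zero hS H.meas.aestronglyMeasurable (fun x => (hB x).1)
      (fun x hx => (H.eq_zero x hx).1) q,
    memLp_of_bdd_of_eq_zero hS H.meas_grad.aestronglyMeasurable (fun x => (hB x).2.1)
      (fun x hx => (H.eq_zero x hx).2.1) q,
    memLp_of_bdd_of_eq_zero hS H.meas_hess.aestronglyMeasurable (fun x => (hB x).2.2)
      (fun x hx => (H.eq_zero x hx).2.2) q⟩

lemma mono (H : IsBddSobolev2 S θ Dθ D2θ) {T : Set Plane} (h : S ⊆ T) :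
    IsBddSobolev2 T θ Dθ D2θ :=
  { H with eq_zero := fun x hx => H.eq_zero x fun hs => hx (h hs) }

lemma add {θ' : Plane → Vec m} {Dθ' : Plane → GradSpace m} {D2θ' : Plane → HessSpace m}
    (H : IsBddSobolev2 S θ Dθ D2θ) (H' : IsBddSobolev2 S θ' Dθ' D2θ') :
    IsBddSobolev2 S (fun x => θ x + θ' x) (fun x => Dθ x + Dθ' x) (fun x => D2θ x + D2θ' x) := by
  obtain ⟨B, hB⟩ := H.bdd
  obtain ⟨B', hB'⟩ := H'.bdd
  exact ⟨H.meas.add H'.meas, H.meas_grad.add H'.meas_grad, H.meas_hess.add H'.meas_hess,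
    ⟨B + B', fun x => ⟨norm_add_le_of_le (hB x).1 (hB' x).1,
      norm_add_le_of_le (hB x).2.1 (hB' x).2.1, norm_add_le_of_le (hB x).2.2 (hB' x).2.2⟩⟩,
    fun x hx => by simp [H.eq_zero x hx, H'.eq_zero x hx], H.weak.add H'.weak⟩

lemma zero (S : Set Plane) : IsBddSobolev2 S (fun _ => (0 : Vec m)) (fun _ => 0) (fun _ => 0) :=
  ⟨measurable_const, measurable_const, measurable_const, ⟨0, by simp⟩, by simp,
    HasWeakDerivs.zero _⟩

lemma sum {ι : Type*} {θ : ι → Plane → Vec m} {Dθ : ι → Plane → GradSpace m}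
    {D2θ : ι → Plane → HessSpace m} (s : Finset ι)
    (H : ∀ i ∈ s, IsBddSobolev2 S (θ i) (Dθ i) (D2θ i)) :
    IsBddSobolev2 S (fun x => ∑ i ∈ s, θ i x) (fun x => ∑ i ∈ s, Dθ i x)
      (fun x => ∑ i ∈ s, D2θ i x) := by
  classical
  induction s using Finset.induction_on with
  | empty => simpa using zero S
  | insert a s ha ih =>
    simp only [Finset.sum_insert ha]
    exact (H a (by simp)).add (ih fun i hi => H i (by simp [hi]))

lemma weak_rescale (H : IsBddSobolev2 S θ Dθ D2θ) (hS : volume S ≠ ⊤) (a : Plane) {r : ℝ}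
    (hr : r ≠ 0) : HasWeakDerivs univ (fun x => r ^ 2 • θ (r⁻¹ • (x - a)))
      (fun x => r • Dθ (r⁻¹ • (x - a))) (fun x => D2θ (r⁻¹ • (x - a))) := by
  obtain ⟨hθ, hDθ, hD2θ⟩ := H.memLp hS 1
  rw [memLp_one_iff_integrable] at hθ hDθ hD2θ
  refine ⟨fun i j => ?_, fun i j k => ?_⟩
  · have := ((H.weak.weak_grad i j).comp_inv_smul_sub (hθ.eval_piLp i) (hDθ.eval_piLp (i, j)) a
      hr).const_mul (r ^ 2)
    simpa [pow_two, mul_assoc, hr] using this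
  · have := ((H.weak.weak_hess i j k).comp_inv_smul_sub (hDθ.eval_piLp (i, j))
      (hD2θ.eval_piLp (i, j, k)) a hr).const_mul r
    simpa [hr] using this

lemma rescale (H : IsBddSobolev2 S θ Dθ D2θ) (hS : volume S ≠ ⊤) (a : Plane) {r : ℝ}
    (hr : r ≠ 0) {T : Set Plane} (hT : ∀ x, r⁻¹ • (x - a) ∈ S → x ∈ T) :
    IsBddSobolev2 T (fun x => r ^ 2 • θ (r⁻¹ • (x - a))) (fun x => r • Dθ (r⁻¹ • (x - a)))
      (fun x => D2θ (r⁻¹ • (x - a))) := by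
  obtain ⟨B, hB⟩ := H.bdd
  have hm : Measurable fun x : Plane => r⁻¹ • (x - a) := by fun_prop
  refine ⟨(H.meas.comp hm).const_smul (r ^ 2), (H.meas_grad.comp hm).const_smul r,
    H.meas_hess.comp hm, ⟨max (‖r ^ 2‖ * B) (max (‖r‖ * B) B), fun x => ?_⟩, fun x hx => ?_,
    H.weak_rescale hS a hr⟩
  · obtain ⟨h₀, h₁, h₂⟩ := hB (r⁻¹ • (x - a))
    rw [norm_smul, norm_smul]
    exact ⟨le_max_of_le_left (by gcongr), le_max_of_le_right (le_max_of_le_left (by gcongr)),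
      le_max_of_le_right (le_max_of_le_right h₂)⟩
  · simp [H.eq_zero _ fun h => hx (hT x h)]

end IsBddSobolev2

lemma HasWeakDerivs.of_forall_approx {m : ℕ} {θ : Plane → Vec m} {Dθ : Plane → GradSpace m}
    {D2θ : Plane → HessSpace m} (hθ : Integrable θ volume) (hDθ : Integrable Dθ volume)
    (hD2θ : Integrable D2θ volume)
    (H : ∀ ε : ℝ, 0 < ε → ∃ ψ : Plane → Vec m, IsTestFunction univ ψ ∧
      ∫ x, ‖θ x - ψ x‖ ≤ ε ∧ ∫ x, ‖Dθ x - classicalGrad ψ x‖ ≤ ε ∧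
      ∫ x, ‖D2θ x - classicalHess ψ x‖ ≤ ε) :
    HasWeakDerivs univ θ Dθ D2θ := by
  have test {ι : Type} [Fintype ι] {ψ : Plane → EuclideanSpace ℝ ι} (hψ : IsTestFunction univ ψ) :
      Integrable ψ volume := memLp_one_iff_integrable.mp (hψ.memLp 1)
  have coord {ι : Type} [Fintype ι] {F G : Plane → EuclideanSpace ℝ ι} (hF : Integrable F volume)
      (hG : Integrable G volume) {ε : ℝ} (h : ∫ x, ‖F x - G x‖ ≤ ε) (i : ι) :
      ∫ x, ‖F x i - G x i‖ ≤ ε := by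
    have hFG := hF.sub hG
    exact (integral_mono (hFG.eval_piLp i).norm hFG.norm
      fun x => PiLp.norm_apply_le (F x - G x) i).trans h
  refine ⟨fun i j => .of_forall_approx (hθ.eval_piLp i) (hDθ.eval_piLp (i, j)) fun ε hε => ?_,
    fun i j k => .of_forall_approx (hDθ.eval_piLp (i, j)) (hD2θ.eval_piLp (i, j, k))
      fun ε hε => ?_⟩
  all_goals
    obtain ⟨ψ, hψ, h₀, h₁, h₂⟩ := H ε hε
    have hψ₀ := test hψ
    have hψ₁ := test hψ.classicalGrad
    have hψ₂ := test hψ.classicalHess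
  · exact ⟨_, _, (of_contDiff hψ.contDiff).weak_grad i j, hψ₀.eval_piLp i, hψ₁.eval_piLp (i, j),
      coord hθ hψ₀ h₀ i, coord hDθ hψ₁ h₁ (i, j)⟩
  · exact ⟨_, _, (of_contDiff hψ.contDiff).weak_hess i j k, hψ₁.eval_piLp (i, j),
      hψ₂.eval_piLp (i, j, k), coord hDθ hψ₁ h₁ (i, j), coord hD2θ hψ₂ h₂ (i, j, k)⟩

lemma exists_bdd_ae_eq_of_memLp_top {α E : Type*} [MeasurableSpace α] {μ : Measure α}
    [NormedAddCommGroup E] [MeasurableSpace E] [BorelSpace E] {Q : Set α} (hQ : MeasurableSet Q)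
    {F : α → E} (hF : MemLp F ⊤ (μ.restrict Q)) :
    ∃ G : α → E, Measurable G ∧ (∃ B : ℝ, ∀ x, ‖G x‖ ≤ B) ∧ (∀ x ∉ Q, G x = 0) ∧
      G =ᵐ[μ.restrict Q] F := by
  obtain ⟨F', hF', hFF'⟩ := hF.1
  have hF'm : Measurable F' := hF'.measurable
  set B := (eLpNorm F ⊤ (μ.restrict Q)).toReal
  set S := Q ∩ {x | ‖F' x‖ ≤ B}
  have hs : MeasurableSet S := hQ.inter (measurableSet_le hF'm.norm measurable_const)
  refine ⟨S.indicator F', hF'm.indicator hs, ⟨B, fun x => ?_⟩, fun x hx => by simp [S, hx], ?_⟩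
  · by_cases hx : x ∈ S
    · rw [indicator_of_mem hx]; exact hx.2
    · rw [indicator_of_notMem hx, norm_zero]; exact ENNReal.toReal_nonneg
  · have hess : ∀ᵐ x ∂(μ.restrict Q), ‖F x‖ₑ ≤ eLpNorm F ⊤ (μ.restrict Q) := by
      simpa only [eLpNorm_exponent_top] using ae_le_eLpNormEssSup
    filter_upwards [hFF', hess, ae_restrict_mem hQ] with x hx hle hxQ
    have hB : ‖F' x‖ ≤ B := by
      rw [← hx, ← toReal_enorm]
      exact ENNReal.toReal_mono hF.2.ne hle
    rw [indicator_of_mem (show x ∈ S from ⟨hxQ, hB⟩), hx]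

lemma integral_norm_sub_le_of_ae_eq {α E : Type*} [MeasurableSpace α] {μ : Measure α}
    [NormedAddCommGroup E] {Q : Set α} {F G Ψ : α → E} {ε : ℝ} (hε : 0 ≤ ε)
    (hG : AEStronglyMeasurable G μ) (hΨ : AEStronglyMeasurable Ψ μ) (hG0 : ∀ x ∉ Q, G x = 0)
    (hΨ0 : ∀ x ∉ Q, Ψ x = 0) (hGF : G =ᵐ[μ.restrict Q] F)
    (h : ∫⁻ x in Q, ‖F x - Ψ x‖ₑ ∂μ ≤ ENNReal.ofReal ε) : ∫ x, ‖G x - Ψ x‖ ∂μ ≤ ε := by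
  rw [integral_norm_eq_lintegral_enorm (f := fun x => G x - Ψ x) (hG.sub hΨ)]
  refine ENNReal.toReal_le_of_le_ofReal hε (le_trans (le_of_eq ?_) h)
  have hsupp : Function.support (fun x => ‖G x - Ψ x‖ₑ) ⊆ Q := fun x hx => by
    by_contra hx'
    exact hx (by simp [hG0 x hx', hΨ0 x hx'])
  rw [← setLIntegral_eq_of_support_subset hsupp]
  exact lintegral_congr_ae (hGF.mono fun x hx => by simp only [hx])

lemma IsSobolev2InfZero.exists_isBddSobolev2 {m : ℕ} {Q : Set Plane} (hQ : MeasurableSet Q)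
    (hQf : volume Q ≠ ⊤) {φ : Plane → Vec m} {Dφ : Plane → GradSpace m}
    {D2φ : Plane → HessSpace m} (H : IsSobolev2InfZero Q φ Dφ D2φ) :
    ∃ (θ : Plane → Vec m) (Dθ : Plane → GradSpace m) (D2θ : Plane → HessSpace m),
      IsBddSobolev2 Q θ Dθ D2θ ∧ D2θ =ᵐ[volume.restrict Q] D2φ := by
  obtain ⟨θ, hm₀, ⟨B₀, hB₀⟩, hz₀, he₀⟩ := exists_bdd_ae_eq_of_memLp_top hQ H.isSobolev.memLp
  obtain ⟨Dθ, hm₁, ⟨B₁, hB₁⟩, hz₁, he₁⟩ :=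
    exists_bdd_ae_eq_of_memLp_top hQ H.isSobolev.memLp_grad
  obtain ⟨D2θ, hm₂, ⟨B₂, hB₂⟩, hz₂, he₂⟩ :=
    exists_bdd_ae_eq_of_memLp_top hQ H.isSobolev.memLp_hess
  have int {ι : Type} [Fintype ι] {G : Plane → EuclideanSpace ℝ ι} (hG : Measurable G) {B : ℝ}
      (hB : ∀ x, ‖G x‖ ≤ B) (h0 : ∀ x ∉ Q, G x = 0) : Integrable G volume :=
    memLp_one_iff_integrable.mp (memLp_of_bdd_of_eq_zero hQf hG.aestronglyMeasurable hB h0 1)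
  have approx {ι : Type} [Fintype ι] {G F Ψ : Plane → EuclideanSpace ℝ ι} (hG : Measurable G)
      (h0 : ∀ x ∉ Q, G x = 0) (hGF : G =ᵐ[volume.restrict Q] F) (hΨ : IsTestFunction Q Ψ) {ε : ℝ}
      (hε : 0 ≤ ε) (h : ∫⁻ x in Q, ‖F x - Ψ x‖ₑ ≤ ENNReal.ofReal ε) :
      ∫ x, ‖G x - Ψ x‖ ≤ ε :=
    integral_norm_sub_le_of_ae_eq hε hG.aestronglyMeasurable
      hΨ.contDiff.continuous.aestronglyMeasurable h0 (fun _ hx => hΨ.eq_zero hx) hGF h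
  refine ⟨θ, Dθ, D2θ, ⟨hm₀, hm₁, hm₂, ⟨max B₀ (max B₁ B₂), fun x => ⟨le_max_of_le_left (hB₀ x),
    le_max_of_le_right (le_max_of_le_left (hB₁ x)),
    le_max_of_le_right (le_max_of_le_right (hB₂ x))⟩⟩,
    fun x hx => ⟨hz₀ x hx, hz₁ x hx, hz₂ x hx⟩, .of_forall_approx (int hm₀ hB₀ hz₀)
      (int hm₁ hB₁ hz₁) (int hm₂ hB₂ hz₂) fun ε hε => ?_⟩, he₂⟩
  obtain ⟨ψ, hψ, hc, hs, hle⟩ := H.approx ε hε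
  have hψ : IsTestFunction Q ψ := ⟨hψ, hc, hs⟩
  exact ⟨ψ, hψ.mono (subset_univ Q),
    approx hm₀ hz₀ he₀ hψ hε.le (le_trans (le_self_add.trans le_self_add) hle.le),
    approx hm₁ hz₁ he₁ hψ.classicalGrad hε.le (le_trans (le_add_self.trans le_self_add) hle.le),
    approx hm₂ hz₂ he₂ hψ.classicalHess hε.le (le_trans le_add_self hle.le)⟩

lemma IsBddSobolev2.isSobolev2InfZero {m : ℕ} {Q K : Set Plane} (hQ : IsOpen Q)
    (hK : IsCompact K) (hKQ : K ⊆ Q) {θ : Plane → Vec m} {Dθ : Plane → GradSpace m}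
    {D2θ : Plane → HessSpace m} (H : IsBddSobolev2 K θ Dθ D2θ) :
    IsSobolev2InfZero Q θ Dθ D2θ := by
  obtain ⟨t₀, t₁, t₂⟩ := H.memLp hK.measure_lt_top.ne ⊤
  obtain ⟨s₀, s₁, s₂⟩ := H.memLp hK.measure_lt_top.ne 1
  have hw := H.weak.mono (subset_univ Q)
  refine ⟨⟨t₀.restrict Q, t₁.restrict Q, t₂.restrict Q, hw.weak_grad, hw.weak_hess⟩,
    fun ε hε => ?_⟩
  have hsupp : tsupport θ ⊆ K := closure_minimal
    (fun x hx => by_contra fun h => hx (H.eq_zero x h).1) hK.isClosed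
  have hε4 : ENNReal.ofReal (ε / 4) ≠ 0 := by simp [hε]
  obtain ⟨ψ, hψ, e₀, e₁, e₂⟩ := H.weak.exists_isTestFunction_approx le_rfl ENNReal.one_ne_top
    s₀ s₁ s₂ (hK.of_isClosed_subset (isClosed_tsupport _) hsupp) hQ (hsupp.trans hKQ) hε4
  simp only [eLpNorm_one_eq_lintegral_enorm] at e₀ e₁ e₂
  refine ⟨ψ, hψ.contDiff, hψ.hasCompactSupport, hψ.tsupport_subset, ?_⟩
  refine lt_of_le_of_lt (add_le_add (add_le_add ((setLIntegral_le_lintegral _ _).trans e₀)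
    ((setLIntegral_le_lintegral _ _).trans e₁)) ((setLIntegral_le_lintegral _ _).trans e₂)) ?_
  rw [← ENNReal.ofReal_add (by positivity) (by positivity),
    ← ENNReal.ofReal_add (by positivity) (by positivity)]
  exact (ENNReal.ofReal_lt_ofReal_iff hε).mpr (by linarith)

lemma exists_smooth_cutoff {K U : Set Plane} (hK : IsCompact K) (hU : IsOpen U) (hKU : K ⊆ U) :
    ∃ χ : Plane → ℝ, IsTestFunction U χ ∧
      ∃ V : Set Plane, IsOpen V ∧ K ⊆ V ∧ ∀ x ∈ V, χ x = 1 := by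
  obtain ⟨L, hL, hKL, hLU⟩ := exists_compact_between hK hU hKU
  obtain ⟨f, hf1, hf0, -⟩ := exists_contMDiffMap_one_nhds_of_subset_interior
    (n := ⊤) (modelWithCornersSelf ℝ Plane) hK.isClosed hKL
  obtain ⟨v, hv, hv1⟩ := Filter.eventually_iff_exists_mem.mp hf1
  have hs : tsupport f ⊆ L := closure_minimal
    (fun x hx => by_contra fun h => hx (hf0 x h)) hL.isClosed
  exact ⟨f, ⟨f.contMDiff.contDiff, hL.of_isClosed_subset (isClosed_tsupport _) hs, hs.trans hLU⟩,
    interior v, isOpen_interior, subset_interior_iff_mem_nhdsSet.mpr hv,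
    fun x hx => hv1 x (interior_subset hx)⟩

lemma planeBasis_apply (k j : Fin 2) : planeBasis k j = if j = k then 1 else 0 := by
  simp [planeBasis]

section Taylor

variable {m : ℕ} {ψ : Plane → Vec m}

lemma classicalGrad_sub {ψ' : Plane → Vec m} (hψ : ContDiff ℝ ∞ ψ) (hψ' : ContDiff ℝ ∞ ψ') :
    classicalGrad (ψ - ψ') = classicalGrad ψ - classicalGrad ψ' := by
  ext x a
  simp only [classicalGrad, Pi.sub_apply, PiLp.sub_apply]
  rw [fderiv_fun_sub ((contDiff_euclidean.mp hψ a.1).differentiable (by simp) x)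
    ((contDiff_euclidean.mp hψ' a.1).differentiable (by simp) x), sub_apply]

lemma classicalHess_sub {ψ' : Plane → Vec m} (hψ : ContDiff ℝ ∞ ψ) (hψ' : ContDiff ℝ ∞ ψ') :
    classicalHess (ψ - ψ') = classicalHess ψ - classicalHess ψ' := by
  ext x a
  have hd {ψ : Plane → Vec m} (h : ContDiff ℝ ∞ ψ) :
      DifferentiableAt ℝ (fun y => classicalGrad ψ y (a.1, a.2.1)) x :=
    (contDiff_euclidean.mp (contDiff_classicalGrad h) _).differentiable (by simp) x
  simp only [classicalHess, classicalGrad_sub hψ hψ', Pi.sub_apply, PiLp.sub_apply]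
  rw [fderiv_fun_sub (hd hψ) (hd hψ'), sub_apply]

lemma classicalGrad_smul_comp_add_smul (hψ : ContDiff ℝ ∞ ψ) (c : ℝ) (a : Plane) (r : ℝ)
    (y : Plane) :
    classicalGrad (fun y => c • ψ (a + r • y)) y = (c * r) • classicalGrad ψ (a + r • y) := by
  have hd (i : Fin m) : DifferentiableAt ℝ (fun z => ψ (a + r • z) i) y :=
    ((contDiff_euclidean.mp hψ i).comp (by fun_prop : ContDiff ℝ ∞ fun z : Plane =>
      a + r • z)).differentiable (by simp) y
  ext b
  simp only [classicalGrad, PiLp.smul_apply, smul_eq_mul]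
  rw [fderiv_const_mul (hd b.1), fderiv_comp_add_smul (fun z => ψ z b.1)]
  simp [mul_assoc]

lemma classicalHess_smul_comp_add_smul (hψ : ContDiff ℝ ∞ ψ) (c : ℝ) (a : Plane) (r : ℝ)
    (y : Plane) :
    classicalHess (fun y => c • ψ (a + r • y)) y = (c * r ^ 2) • classicalHess ψ (a + r • y) := by
  have hd (b) : DifferentiableAt ℝ (fun z => classicalGrad ψ (a + r • z) b) y :=
    ((contDiff_euclidean.mp (contDiff_classicalGrad hψ) b).comp (by fun_prop :
      ContDiff ℝ ∞ fun z : Plane => a + r • z)).differentiable (by simp) y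
  ext b
  simp only [classicalHess, classicalGrad_smul_comp_add_smul hψ, PiLp.smul_apply, smul_eq_mul]
  rw [fderiv_const_mul (hd _), fderiv_comp_add_smul (fun z => classicalGrad ψ z (b.1, b.2.1))]
  simp only [smul_apply, smul_eq_mul]
  ring

/-- The quadratic map with value `c`, gradient `L` and Hessian `ξ` at the origin. -/
noncomputable def quadraticMap (c : Vec m) (L : GradSpace m) (ξ : HessSpace m) (y : Plane) :
    Vec m :=
  WithLp.toLp 2 fun i => c i + ∑ j, L (i, j) * y j + 1 / 2 * ∑ j, ∑ k, ξ (i, j, k) * (y j * y k)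

variable (c : Vec m) (L : GradSpace m) {ξ : HessSpace m}

variable (ξ) in
lemma contDiff_quadraticMap : ContDiff ℝ ∞ (quadraticMap c L ξ) :=
  contDiff_euclidean.mpr fun i => by
    simp only [quadraticMap]
    fun_prop

lemma classicalGrad_quadraticMap (hξ : IsSymmHess ξ) (y : Plane) :
    classicalGrad (quadraticMap c L ξ) y =
      WithLp.toLp 2 fun a => L a + ∑ k, ξ (a.1, a.2, k) * y k := by
  ext ⟨i, l⟩
  have hd (j : Fin 2) : HasFDerivAt (fun y : Plane => y j)
      (EuclideanSpace.proj j : Plane →L[ℝ] ℝ) y :=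
    (EuclideanSpace.proj j : Plane →L[ℝ] ℝ).hasFDerivAt
  have h : HasFDerivAt (fun y => quadraticMap c L ξ y i) _ y :=
    (((HasFDerivAt.fun_sum (u := Finset.univ) fun j _ =>
      (hd j).const_mul (L (i, j))).const_add (c i)).add
    ((HasFDerivAt.fun_sum (u := Finset.univ) fun j _ => HasFDerivAt.fun_sum (u := Finset.univ)
      fun k _ => ((hd j).mul (hd k)).const_mul (ξ (i, j, k))).const_mul (1 / 2)))
  have hs := hξ i 0 1
  change fderiv ℝ (fun y => quadraticMap c L ξ y i) y (planeBasis l) = _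
  rw [h.fderiv]
  fin_cases l <;> simp [Fin.sum_univ_two, planeBasis_apply, hs] <;> ring

lemma classicalHess_quadraticMap (hξ : IsSymmHess ξ) (y : Plane) :
    classicalHess (quadraticMap c L ξ) y = ξ := by
  ext ⟨i, l, n⟩
  have hd (j : Fin 2) : HasFDerivAt (fun y : Plane => y j)
      (EuclideanSpace.proj j : Plane →L[ℝ] ℝ) y :=
    (EuclideanSpace.proj j : Plane →L[ℝ] ℝ).hasFDerivAt
  have h := ((HasFDerivAt.fun_sum (u := Finset.univ) fun k _ =>
    (hd k).const_mul (ξ (i, l, k))).const_add (L (i, l))).fderiv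
  simp only [classicalHess, classicalGrad_quadraticMap c L hξ]
  rw [h]
  fin_cases n <;> simp [planeBasis_apply]

/-- `g` is the difference, at the scale `r`, of the quadratic map which agrees with `ψ` to first
order at `x₀` and has Hessian `ξ`, and of `ψ`. -/
lemma exists_contDiff_classicalHess_eq_sub (hψ : ContDiff ℝ ∞ ψ) (hξ : IsSymmHess ξ)
    (x₀ : Plane) {r : ℝ} (hr : r ≠ 0) :
    ∃ g : Plane → Vec m, ContDiff ℝ ∞ g ∧ g 0 = 0 ∧ classicalGrad g 0 = 0 ∧
      ∀ y, classicalHess g y = ξ - classicalHess ψ (x₀ + r • y) := by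
  set ψ' : Plane → Vec m := fun y => r⁻¹ ^ 2 • ψ (x₀ + r • y)
  have hψ' : ContDiff ℝ ∞ ψ' := (hψ.comp (by fun_prop)).const_smul _
  set q := quadraticMap (ψ' 0) (classicalGrad ψ' 0) ξ
  have hq : ContDiff ℝ ∞ q := contDiff_quadraticMap _ _ _
  refine ⟨q - ψ', hq.sub hψ', ?_, ?_, fun y => ?_⟩
  · ext i; simp [q, quadraticMap]
  · rw [classicalGrad_sub hq hψ', Pi.sub_apply, classicalGrad_quadraticMap _ _ hξ]
    ext i; simp
  · rw [classicalHess_sub hq hψ', Pi.sub_apply, classicalHess_quadraticMap _ _ hξ,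
      classicalHess_smul_comp_add_smul hψ, ← mul_pow, inv_mul_cancel₀ hr, one_pow, one_smul]

end Taylor

lemma norm_le_of_forall_abs_apply_planeBasis_le {T : Plane →L[ℝ] ℝ} {t : ℝ}
    (ht : ∀ k, |T (planeBasis k)| ≤ t) : ‖T‖ ≤ 2 * t := by
  have ht0 : 0 ≤ t := (abs_nonneg _).trans (ht 0)
  refine ContinuousLinearMap.opNorm_le_bound _ (by positivity) fun v => ?_
  have hv : v = ∑ k, v k • planeBasis k := by
    ext j; fin_cases j <;> simp [planeBasis_apply]
  calc ‖T v‖ = ‖∑ k, v k * T (planeBasis k)‖ := by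
        conv_lhs => rw [hv, map_sum]
        simp only [map_smul, smul_eq_mul]
    _ ≤ ∑ _k : Fin 2, ‖v‖ * t := norm_sum_le_of_le _ fun k _ => by
        rw [norm_mul]
        gcongr
        exacts [PiLp.norm_apply_le v k, ht k]
    _ = 2 * t * ‖v‖ := by simp; ring

lemma abs_le_of_forall_partial_le {h : Plane → ℝ} (hd : Differentiable ℝ h) (h0 : h 0 = 0)
    {t : ℝ} (ht : ∀ y ∈ unitSquare, ∀ k, |fderiv ℝ h y (planeBasis k)| ≤ t) {y : Plane}
    (hy : y ∈ unitSquare) : |h y| ≤ 2 * t := by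
  have ht0 : 0 ≤ t := (abs_nonneg _).trans (ht y hy 0)
  have := convex_unitSquare.norm_image_sub_le_of_norm_fderiv_le (fun z _ => hd z)
    (fun z hz => norm_le_of_forall_abs_apply_planeBasis_le (ht z hz)) zero_mem_unitSquare hy
  rw [h0, sub_zero, sub_zero] at this
  exact this.trans (mul_le_of_le_one_right (by positivity) (norm_le_one_of_mem_unitSquare hy))

lemma exists_norm_add_le_of_classicalHess_le (m : ℕ) :
    ∃ A : ℝ, 0 ≤ A ∧ ∀ (g : Plane → Vec m) (t : ℝ), ContDiff ℝ ∞ g → g 0 = 0 →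
      classicalGrad g 0 = 0 → (∀ y ∈ unitSquare, ‖classicalHess g y‖ ≤ t) →
      ∀ y ∈ unitSquare, ‖g y‖ + ‖classicalGrad g y‖ + ‖classicalHess g y‖ ≤ A * t := by
  set c₀ := (Fintype.card (Fin m) : ℝ)
  set c₁ := (Fintype.card (Fin m × Fin 2) : ℝ)
  refine ⟨c₀ * (2 * (c₁ * 2)) + c₁ * 2 + 1, by positivity, fun g t hg h0 h1 ht y hy => ?_⟩
  have hgrad : ∀ y ∈ unitSquare, ‖classicalGrad g y‖ ≤ c₁ * (2 * t) := fun y hy =>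
    euclidean_norm_le_of_forall_abs_le fun a =>
      abs_le_of_forall_partial_le (h := fun y => classicalGrad g y a)
        ((contDiff_euclidean.mp (contDiff_classicalGrad hg) a).differentiable (by simp))
        (by simp [h1]) (fun z hz k =>
          (PiLp.norm_apply_le (classicalHess g z) (a.1, a.2, k)).trans (ht z hz)) hy
  have hval : ‖g y‖ ≤ c₀ * (2 * (c₁ * (2 * t))) :=
    euclidean_norm_le_of_forall_abs_le fun i =>
      abs_le_of_forall_partial_le (h := fun y => g y i)
        ((contDiff_euclidean.mp hg i).differentiable (by simp)) (by simp [h0])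
        (fun z hz k =>
          (PiLp.norm_apply_le (classicalGrad g z) (i, k)).trans (hgrad z hz)) hy
  linear_combination hval + hgrad y hy + ht y hy

lemma exists_truncation (m : ℕ) {K : Set Plane} (hK : IsCompact K) (hKQ : K ⊆ unitSquare) :
    ∃ A : ℝ, 0 ≤ A ∧ ∃ L : Set Plane, IsCompact L ∧ K ⊆ L ∧ L ⊆ unitSquare ∧
      ∀ (g : Plane → Vec m) (t : ℝ), ContDiff ℝ ∞ g → g 0 = 0 → classicalGrad g 0 = 0 →
      (∀ y ∈ unitSquare, ‖classicalHess g y‖ ≤ t) →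
      ∃ h : Plane → Vec m, IsTestFunction L h ∧
        (∀ y, ‖h y‖ ≤ A * t ∧ ‖classicalGrad h y‖ ≤ A * t ∧ ‖classicalHess h y‖ ≤ A * t) ∧
        ∀ y ∈ K, classicalHess h y = classicalHess g y := by
  obtain ⟨χ, hχ, V, hV, hKV, hχ1⟩ := exists_smooth_cutoff hK isOpen_unitSquare hKQ
  obtain ⟨M, hM⟩ := hχ.exists_abs_derivs_le
  obtain ⟨A, hA, hgA⟩ := exists_norm_add_le_of_classicalHess_le m
  have hM0 : 0 ≤ M := (abs_nonneg _).trans (hM 0).1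
  have hχL : IsTestFunction (tsupport χ) χ := ⟨hχ.contDiff, hχ.hasCompactSupport, subset_rfl⟩
  set c₁ := (Fintype.card (Fin m × Fin 2) : ℝ)
  set c₂ := (Fintype.card (Fin m × Fin 2 × Fin 2) : ℝ)
  refine ⟨(1 + c₁ + 2 * c₂) * (M * A), by positivity, tsupport χ, hχ.hasCompactSupport,
    fun x hx => subset_tsupport χ (by simp [hχ1 x (hKV hx)]), hχ.tsupport_subset,
    fun g t hg h0 h1 ht => ⟨fun y => χ y • g y, hχL.smul hg, fun y => ?_, fun y hy => ?_⟩⟩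
  · have ht0 : 0 ≤ t := (norm_nonneg _).trans (ht 0 zero_mem_unitSquare)
    by_cases hy : y ∈ unitSquare
    · obtain ⟨h₀, h₁, h₂⟩ := hM y
      set G := ‖g y‖ + ‖classicalGrad g y‖ + ‖classicalHess g y‖
      have hle {c a : ℝ} (hc : 0 ≤ c) (hca : c ≤ 1 + c₁ + 2 * c₂) (ha : a ≤ G) :
          c * (M * a) ≤ (1 + c₁ + 2 * c₂) * (M * A) * t := by
        have haA := ha.trans (hgA g t hg h0 h1 ht y hy)
        rw [mul_assoc _ (M * A), mul_assoc M]
        calc c * (M * a) ≤ c * (M * (A * t)) := by gcongr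
          _ ≤ _ := by gcongr
      have hc₁ : 0 ≤ c₁ := by positivity
      have hc₂ : 0 ≤ c₂ := by positivity
      have hg₀ := norm_nonneg (g y)
      have hg₁ := norm_nonneg (classicalGrad g y)
      have hg₂ := norm_nonneg (classicalHess g y)
      rw [classicalGrad_smul hχ.contDiff hg, classicalHess_smul hχ.contDiff hg, norm_smul]
      refine ⟨?_, (norm_cutoffGrad_le h₀ h₁).trans (hle hc₁ (by linarith) (by linarith)),
        (norm_cutoffHess_le h₀ h₁ h₂).trans ?_⟩
      · have := hle (a := ‖g y‖) zero_le_one (by linarith) (by linarith)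
        exact (mul_le_mul_of_nonneg_right h₀ hg₀).trans (by linarith)
      · refine le_of_eq_of_le ?_ (hle (c := 2 * c₂) (a := (‖g y‖ + ‖classicalGrad g y‖ +
          (‖classicalGrad g y‖ + ‖classicalHess g y‖)) / 2) (by linarith) (by linarith)
          (by linarith))
        ring
    · have htest := hχ.smul hg
      simp only [htest.eq_zero hy, htest.classicalGrad.eq_zero hy, htest.classicalHess.eq_zero hy,
        norm_zero, and_self]
      positivity
  · rw [classicalHess_smul hχ.contDiff hg]
    exact (cutoff_eq_of_eq_one hV hχ1 _ _ _ (hKV hy)).2.2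

lemma exists_insertion (m : ℕ) {η : ℝ} (hη0 : 0 < η) (hη1 : η < 1) :
    ∃ A : ℝ, 0 ≤ A ∧ ∃ L : Set Plane, IsCompact L ∧ L ⊆ unitSquare ∧
      ∀ (g : Plane → Vec m) (t : ℝ), ContDiff ℝ ∞ g → g 0 = 0 → classicalGrad g 0 = 0 →
      (∀ y ∈ unitSquare, ‖classicalHess g y‖ ≤ t) →
      ∀ (φ : Plane → Vec m) (Dφ : Plane → GradSpace m) (D2φ : Plane → HessSpace m) (B : ℝ),
      IsBddSobolev2 unitSquare φ Dφ D2φ → (∀ x, ‖φ x‖ ≤ B ∧ ‖Dφ x‖ ≤ B) →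
      ∃ (Θ : Plane → Vec m) (DΘ : Plane → GradSpace m) (D2Θ : Plane → HessSpace m),
        IsBddSobolev2 L Θ DΘ D2Θ ∧ (∀ y, ‖Θ y‖ ≤ A * t + B ∧ ‖DΘ y‖ ≤ A * t + B) ∧
        (∀ y ∈ square 0 (1 - η), D2Θ y = classicalHess g y + D2φ ((1 - η)⁻¹ • y)) ∧
        ∀ y ∉ square 0 (1 - η), ‖D2Θ y‖ ≤ A * t := by
  have hη : 0 < 1 - η := by linarith
  obtain ⟨A, hA, L, hL, hKL, hLQ, htrunc⟩ :=
    exists_truncation m (isCompact_closedSquare 0 (1 - η))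
      (square_zero_one ▸ closedSquare_subset_square 0 (by linarith : 1 - η < 1))
  refine ⟨A, hA, L, hL, hLQ, fun g t hg h0 h1 ht φ Dφ D2φ B hφ hB => ?_⟩
  obtain ⟨h, hh, hbd, heq⟩ := htrunc g t hg h0 h1 ht
  have hφη := hφ.rescale (by simp [volume_unitSquare]) 0 hη.ne' (T := L) fun x hx =>
    hKL (square_subset_closedSquare _ _ ((mem_square_iff hη).mpr hx))
  simp only [sub_zero] at hφη
  refine ⟨_, _, _, (IsBddSobolev2.of_isTestFunction hh).add hφη, fun y => ⟨?_, ?_⟩,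
    fun y hy => ?_, fun y hy => ?_⟩
  · refine norm_add_le_of_le (hbd y).1 ?_
    rw [norm_smul, Real.norm_of_nonneg (by positivity)]
    exact (mul_le_of_le_one_left (norm_nonneg _) (by nlinarith)).trans (hB _).1
  · refine norm_add_le_of_le (hbd y).2.1 ?_
    rw [norm_smul, Real.norm_of_nonneg hη.le]
    exact (mul_le_of_le_one_left (norm_nonneg _) (by linarith)).trans (hB _).2
  · rw [heq y (square_subset_closedSquare _ _ hy)]
  · have : (1 - η)⁻¹ • y ∉ unitSquare := fun h => hy ((mem_square_iff hη).mpr (by simpa using h))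
    rw [(hφ.eq_zero _ this).2.2, add_zero]
    exact (hbd y).2.2

section Quasiconvexification

variable {m : ℕ} {g : HessSpace m → ℝ} {ξ : HessSpace m} {c : ℝ}

lemma quasiconvexification2_le_setIntegral (hg : ∀ ξ, 0 ≤ g ξ) {φ : Plane → Vec m}
    {Dφ : Plane → GradSpace m} {D2φ : Plane → HessSpace m}
    (hφ : IsSobolev2InfZero unitSquare φ Dφ D2φ) :
    quasiconvexification2 g ξ ≤ ∫ x in unitSquare, g (ξ + D2φ x) := by
  refine csInf_le ⟨0, ?_⟩ ⟨φ, Dφ, D2φ, hφ, rfl⟩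
  rintro I ⟨φ, Dφ, D2φ, -, rfl⟩
  exact integral_nonneg fun x => hg _

lemma isSobolev2InfZero_zero (m : ℕ) : IsSobolev2InfZero unitSquare (fun _ => (0 : Vec m))
    (fun _ => 0) (fun _ => 0) :=
  (IsBddSobolev2.zero ∅).isSobolev2InfZero isOpen_unitSquare isCompact_empty (empty_subset _)

lemma le_quasiconvexification2
    (h : ∀ (φ : Plane → Vec m) (Dφ : Plane → GradSpace m) (D2φ : Plane → HessSpace m),
      IsSobolev2InfZero unitSquare φ Dφ D2φ → c ≤ ∫ x in unitSquare, g (ξ + D2φ x)) :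
    c ≤ quasiconvexification2 g ξ := by
  refine le_csInf ⟨_, _, _, _, isSobolev2InfZero_zero m, rfl⟩ ?_
  rintro I ⟨φ, Dφ, D2φ, hφ, rfl⟩
  exact h φ Dφ D2φ hφ

lemma quasiconvexification2_nonneg (hg : ∀ ξ, 0 ≤ g ξ) : 0 ≤ quasiconvexification2 g ξ :=
  le_quasiconvexification2 fun _ _ _ _ => integral_nonneg fun _ => hg _

lemma quasiconvexification2_le (hg : ∀ ξ, 0 ≤ g ξ) (ξ : HessSpace m) :
    quasiconvexification2 g ξ ≤ g ξ := by
  simpa [measureReal_def, volume_unitSquare] using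
    quasiconvexification2_le_setIntegral (ξ := ξ) hg (isSobolev2InfZero_zero m)

lemma exists_isBddSobolev2_setIntegral_lt (h : quasiconvexification2 g ξ < c) :
    ∃ (θ : Plane → Vec m) (Dθ : Plane → GradSpace m) (D2θ : Plane → HessSpace m),
      IsBddSobolev2 unitSquare θ Dθ D2θ ∧ ∫ y in unitSquare, g (ξ + D2θ y) < c := by
  by_contra! hc
  refine h.not_ge (le_quasiconvexification2 fun φ Dφ D2φ hφ => ?_)
  obtain ⟨θ, Dθ, D2θ, hθ, hae⟩ := hφ.exists_isBddSobolev2 isOpen_unitSquare.measurableSet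
    (by simp [volume_unitSquare])
  refine (hc θ Dθ D2θ hθ).trans_eq (integral_congr_ae (hae.mono fun y hy => ?_))
  simp only [hy]

end Quasiconvexification

lemma add_rpow_le_two_rpow_mul {p a b : ℝ} (hp : 1 ≤ p) (ha : 0 ≤ a) (hb : 0 ≤ b) :
    (a + b) ^ p ≤ 2 ^ (p - 1) * (a ^ p + b ^ p) := by
  lift a to NNReal using ha
  lift b to NNReal using hb
  exact_mod_cast NNReal.rpow_add_le_mul_rpow_add_rpow a b hp

/-- A measurable nonnegative integrand of growth `p` in the Hessian, which depends on the gradient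
in a relatively Lipschitz way. -/
structure IsGrowthIntegrand {m : ℕ} (p C : ℝ) (f : GradSpace m → HessSpace m → ℝ) : Prop where
  one_le : 1 ≤ p
  measurable : Measurable (Function.uncurry f)
  nonneg : ∀ v ξ, 0 ≤ f v ξ
  le : ∀ v ξ, f v ξ ≤ C * (1 + ‖ξ‖ ^ p)
  lip : ∀ v v' ξ, |f v ξ - f v' ξ| ≤ C * ‖v - v'‖ * max (f v ξ) (f v' ξ)

namespace IsGrowthIntegrand

variable {m : ℕ} {p C : ℝ} {f : GradSpace m → HessSpace m → ℝ}

lemma const_nonneg (H : IsGrowthIntegrand p C f) : 0 ≤ C := by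
  have := (H.nonneg 0 0).trans (H.le 0 0)
  rw [norm_zero, Real.zero_rpow (by linarith [H.one_le])] at this
  linarith

lemma integrable_norm_rpow (H : IsGrowthIntegrand p C f) {α E : Type*} [MeasurableSpace α]
    {μ : Measure α} [NormedAddCommGroup E] {F : α → E} (hF : MemLp F (ENNReal.ofReal p) μ) :
    Integrable (fun x => ‖F x‖ ^ p) μ := by
  have hp : 0 < p := one_pos.trans_le H.one_le
  simpa only [ENNReal.toReal_ofReal hp.le] using
    hF.integrable_norm_rpow (by simpa using hp) ENNReal.ofReal_ne_top

lemma integrable_growth (H : IsGrowthIntegrand p C f) {α E : Type*} [MeasurableSpace α]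
    {μ : Measure α} [IsFiniteMeasure μ] [NormedAddCommGroup E] {F : α → E}
    (hF : MemLp F (ENNReal.ofReal p) μ) : Integrable (fun x => 1 + ‖F x‖ ^ p) μ :=
  (integrable_const 1).add (H.integrable_norm_rpow hF)

lemma integrable (H : IsGrowthIntegrand p C f) {α : Type*} [MeasurableSpace α] {μ : Measure α}
    [IsFiniteMeasure μ] {V : α → GradSpace m} {F : α → HessSpace m} (hV : AEStronglyMeasurable V μ)
    (hF : MemLp F (ENNReal.ofReal p) μ) : Integrable (fun x => f (V x) (F x)) μ := by
  refine ((H.integrable_growth hF).const_mul C).mono' ?_ (ae_of_all _ fun x => ?_)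
  · exact (H.measurable.comp_aemeasurable
      (hV.aemeasurable.prodMk hF.1.aemeasurable)).aestronglyMeasurable
  · rw [Real.norm_of_nonneg (H.nonneg _ _)]
    exact H.le _ _

lemma integrableOn (H : IsGrowthIntegrand p C f) {S : Set Plane} (hS : MeasurableSet S)
    (hSf : volume S ≠ ⊤) {V : Plane → GradSpace m} {F : Plane → HessSpace m} (hV : Measurable V)
    (hF : Measurable F) {B : ℝ} (hB : ∀ y ∈ S, ‖F y‖ ≤ B) :
    IntegrableOn (fun y => f (V y) (F y)) S volume := by
  have : IsFiniteMeasure (volume.restrict S) := ⟨by simpa using hSf.lt_top⟩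
  exact H.integrable hV.aestronglyMeasurable (MemLp.of_bound hF.aestronglyMeasurable B
    ((ae_restrict_mem hS).mono hB))

lemma integrableOn_unitSquare_of_isSobolev2InfZero (H : IsGrowthIntegrand p C f)
    (v : GradSpace m) (ξ : HessSpace m) {φ : Plane → Vec m} {Dφ : Plane → GradSpace m}
    {D2φ : Plane → HessSpace m} (hφ : IsSobolev2InfZero unitSquare φ Dφ D2φ) :
    IntegrableOn (fun y => f v (ξ + D2φ y)) unitSquare volume := by
  have : IsFiniteMeasure (volume.restrict unitSquare) := ⟨by simp [volume_unitSquare]⟩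
  exact H.integrable aestronglyMeasurable_const
    (((memLp_const ξ).add hφ.isSobolev.memLp_hess).mono_exponent le_top)

lemma integrableOn_unitSquare_of_isBddSobolev2 (H : IsGrowthIntegrand p C f) (v : GradSpace m)
    (ξ : HessSpace m) {S : Set Plane} {θ : Plane → Vec m} {Dθ : Plane → GradSpace m}
    {D2θ : Plane → HessSpace m} (hθ : IsBddSobolev2 S θ Dθ D2θ) :
    IntegrableOn (fun y => f v (ξ + D2θ y)) unitSquare volume := by
  obtain ⟨B, hB⟩ := hθ.bdd
  exact H.integrableOn isOpen_unitSquare.measurableSet (by simp [volume_unitSquare])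
    measurable_const (measurable_const.add hθ.meas_hess) (B := ‖ξ‖ + B)
    fun y _ => norm_add_le_of_le le_rfl (hB y).2.2

lemma quasiconvexification2_le_growth (H : IsGrowthIntegrand p C f) (v : GradSpace m)
    (ξ : HessSpace m) : quasiconvexification2 (f v) ξ ≤ C * (1 + ‖ξ‖ ^ p) :=
  (quasiconvexification2_le (H.nonneg v) ξ).trans (H.le v ξ)

lemma le_one_add_mul (H : IsGrowthIntegrand p C f) {v v' : GradSpace m} (ξ : HessSpace m) {s : ℝ}
    (hs : C * ‖v' - v‖ ≤ s) (hs1 : s ≤ 1 / 2) : f v' ξ ≤ (1 + 2 * s) * f v ξ := by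
  have hs0 : 0 ≤ s := (mul_nonneg H.const_nonneg (norm_nonneg _)).trans hs
  have h0 := H.nonneg v ξ
  have h0' := H.nonneg v' ξ
  rcases le_total (f v' ξ) (f v ξ) with h | h
  · nlinarith
  · have hlip := H.lip v' v ξ
    rw [max_eq_left h, abs_of_nonneg (by linarith)] at hlip
    have hsub : f v' ξ * (1 - s) ≤ f v ξ := by nlinarith
    calc f v' ξ ≤ f v' ξ * ((1 - s) * (1 + 2 * s)) := le_mul_of_one_le_right h0' (by nlinarith)
      _ = (1 + 2 * s) * (f v' ξ * (1 - s)) := by ring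
      _ ≤ _ := by gcongr

lemma quasiconvexification2_le_one_add_mul (H : IsGrowthIntegrand p C f) {v v' : GradSpace m}
    (ξ : HessSpace m) {s : ℝ} (hs : C * ‖v' - v‖ ≤ s) (hs1 : s ≤ 1 / 2) :
    quasiconvexification2 (f v') ξ ≤ (1 + 2 * s) * quasiconvexification2 (f v) ξ := by
  have hs0 : 0 ≤ s := (mul_nonneg H.const_nonneg (norm_nonneg _)).trans hs
  rw [← div_le_iff₀' (by positivity)]
  refine le_quasiconvexification2 fun φ Dφ D2φ hφ => ?_
  rw [div_le_iff₀' (by positivity), ← integral_const_mul]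
  exact (quasiconvexification2_le_setIntegral (H.nonneg v') hφ).trans (integral_mono
    (H.integrableOn_unitSquare_of_isSobolev2InfZero v' ξ hφ)
    ((H.integrableOn_unitSquare_of_isSobolev2InfZero v ξ hφ).const_mul _)
    fun y => H.le_one_add_mul _ hs hs1)

lemma quasiconvexification2_le_add_min (H : IsGrowthIntegrand p C f) (v v' : GradSpace m)
    (ξ : HessSpace m) : quasiconvexification2 (f v') ξ ≤
      quasiconvexification2 (f v) ξ + C * (min 1 (2 * C * ‖v' - v‖) * (1 + ‖ξ‖ ^ p)) := by
  have hQ := H.quasiconvexification2_le_growth v ξ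
  have hQ0 := quasiconvexification2_nonneg (ξ := ξ) (H.nonneg v)
  rcases le_total 1 (2 * C * ‖v' - v‖) with h | h
  · rw [min_eq_left h]
    linarith [H.quasiconvexification2_le_growth v' ξ]
  · rw [min_eq_right h]
    have hC := H.const_nonneg
    calc _ ≤ (1 + 2 * (C * ‖v' - v‖)) * quasiconvexification2 (f v) ξ :=
          H.quasiconvexification2_le_one_add_mul ξ le_rfl (by linarith)
      _ = quasiconvexification2 (f v) ξ +
          2 * C * ‖v' - v‖ * quasiconvexification2 (f v) ξ := by ring
      _ ≤ quasiconvexification2 (f v) ξ + 2 * C * ‖v' - v‖ * (C * (1 + ‖ξ‖ ^ p)) := by gcongr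
      _ = _ := by ring

end IsGrowthIntegrand

section Layer

variable {η : ℝ}

lemma measureReal_square (a : Plane) {r : ℝ} (hr : 0 < r) : volume.real (square a r) = r ^ 2 := by
  rw [measureReal_def, volume_square a hr, ENNReal.toReal_ofReal (sq_nonneg r)]

lemma square_subset_unitSquare (hη0 : 0 < η) : square 0 (1 - η) ⊆ unitSquare := fun _ hy =>
  square_zero_one ▸ closedSquare_subset_square 0 (by linarith : 1 - η < 1)
    (square_subset_closedSquare _ _ hy)

lemma measureReal_unitSquare_diff_square_le (hη0 : 0 < η) (hη1 : η < 1) :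
    volume.real (unitSquare \ square 0 (1 - η)) ≤ 2 * η := by
  rw [measureReal_sdiff (square_subset_unitSquare hη0) (isOpen_square _ _).measurableSet
    (by simp [volume_unitSquare]), measureReal_square 0 (by linarith), measureReal_def,
    volume_unitSquare, ENNReal.toReal_one]
  nlinarith

lemma setIntegral_unitSquare_le {G h : Plane → ℝ} {κ M : ℝ} (hη0 : 0 < η) (hη1 : η < 1)
    (hκ : 0 ≤ κ) (hM : 0 ≤ M) (hG : IntegrableOn G unitSquare volume)
    (hh : IntegrableOn h unitSquare volume) (hh0 : ∀ y, 0 ≤ h y)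
    (hcore : ∀ y ∈ square 0 (1 - η), G y ≤ κ * h ((1 - η)⁻¹ • y))
    (hlayer : ∀ y ∈ unitSquare, y ∉ square 0 (1 - η) → G y ≤ M) :
    ∫ y in unitSquare, G y ≤ κ * (∫ y in unitSquare, h y) + 2 * η * M := by
  have hη : 0 < 1 - η := by linarith
  set S := square 0 (1 - η)
  have hSm : MeasurableSet S := (isOpen_square _ _).measurableSet
  have hsub : S ⊆ unitSquare := square_subset_unitSquare hη0
  have hDm : MeasurableSet (unitSquare \ S) := isOpen_unitSquare.measurableSet.diff hSm
  have hcoreInt : ∫ y in S, G y ≤ κ * ∫ y in unitSquare, h y := by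
    have hscale := setIntegral_square_comp_inv_smul_sub h 0 hη
    have hInt := integrableOn_square_comp_inv_smul_sub hh 0 hη
    simp only [sub_zero] at hscale hInt
    calc ∫ y in S, G y ≤ ∫ y in S, κ * h ((1 - η)⁻¹ • y) :=
          setIntegral_mono_on (hG.mono_set hsub) (hInt.const_mul κ) hSm hcore
      _ = κ * ((1 - η) ^ 2 * ∫ y in unitSquare, h y) := by rw [integral_const_mul, hscale]
      _ ≤ κ * ∫ y in unitSquare, h y := mul_le_mul_of_nonneg_left
          (mul_le_of_le_one_left (integral_nonneg hh0) (by nlinarith)) hκ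
  have hlayerInt : ∫ y in unitSquare \ S, G y ≤ 2 * η * M := by
    calc ∫ y in unitSquare \ S, G y ≤ ∫ _y in unitSquare \ S, M :=
          setIntegral_mono_on (hG.mono_set sdiff_subset) (integrableOn_const
            (measure_ne_top_of_subset sdiff_subset (by simp [volume_unitSquare]))) hDm
            fun y hy => hlayer y hy.1 hy.2
      _ ≤ 2 * η * M := by
          rw [setIntegral_const, smul_eq_mul]
          exact mul_le_mul_of_nonneg_right (measureReal_unitSquare_diff_square_le hη0 hη1) hM
  rw [← union_sdiff_cancel hsub, setIntegral_union disjoint_sdiff_right hDm (hG.mono_set hsub)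
    (hG.mono_set sdiff_subset), union_sdiff_cancel hsub]
  exact add_le_add hcoreInt hlayerInt

end Layer

/-- The summand `max (a - N) 0` has small integral for large `N`, uniformly in `s`. -/
lemma min_one_mul_le {s κ a N p : ℝ} (hs : 0 ≤ s) (hκ : 0 < κ) (ha : 0 ≤ a) (hN : 0 ≤ N)
    (hp : 0 ≤ p) : min 1 s * a ≤ κ * a + max (a - N) 0 + N * (s / κ) ^ p := by
  have hmax := le_max_right (a - N) 0
  have hsκ : 0 ≤ (s / κ) ^ p := by positivity
  rcases le_total s κ with h | h
  · have : min 1 s * a ≤ κ * a := mul_le_mul_of_nonneg_right ((min_le_right _ _).trans h) ha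
    nlinarith
  · have h1 : 1 ≤ (s / κ) ^ p := Real.one_le_rpow ((one_le_div hκ).mpr h) hp
    have : min 1 s * a ≤ a := mul_le_of_le_one_left ha (min_le_left _ _)
    nlinarith [le_max_left (a - N) 0, mul_nonneg hκ.le ha]

lemma one_add_rpow_le {p a b c : ℝ} (hp : 1 ≤ p) (ha : 0 ≤ a) (hb : 0 ≤ b) (hc : 0 ≤ c)
    (h : c ≤ a + b) : 1 + c ^ p ≤ 2 ^ (p - 1) * (1 + a ^ p + b ^ p) := by
  have h1 : (1 : ℝ) ≤ 2 ^ (p - 1) := Real.one_le_rpow one_le_two (by linarith)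
  linarith [(Real.rpow_le_rpow hc h (by linarith)).trans (add_rpow_le_two_rpow_mul hp ha hb)]

lemma exists_pos_lt_one_mul_lt {ε : ℝ} (hε : 0 < ε) (b : ℝ) :
    ∃ η : ℝ, 0 < η ∧ η < 1 ∧ b * η < ε := by
  obtain ⟨c, hc, hbc⟩ := exists_pos_mul_lt hε |b|
  refine ⟨min c (1 / 2), by positivity, (min_le_right _ _).trans_lt (by norm_num), ?_⟩
  calc b * min c (1 / 2) ≤ |b| * c := by gcongr; exacts [le_abs_self b, min_le_left _ _]
    _ < ε := hbc

lemma norm_smul_le_mul {E : Type*} [SeminormedAddCommGroup E] [NormedSpace ℝ E] {x : E} {r B : ℝ}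
    (hr : 0 ≤ r) (hx : ‖x‖ ≤ B) : ‖r • x‖ ≤ r * B := by
  rw [norm_smul, Real.norm_of_nonneg hr]
  gcongr

lemma norm_sq_smul_le {E : Type*} [SeminormedAddCommGroup E] [NormedSpace ℝ E] {x : E} {r B : ℝ}
    (hr : 0 ≤ r) (hr1 : r ≤ 1) (hx : ‖x‖ ≤ B) : ‖r ^ 2 • x‖ ≤ r * B := by
  rw [sq, mul_smul]
  exact norm_smul_le_mul hr ((norm_smul_le_mul hr hx).trans
    (mul_le_of_le_one_left ((norm_nonneg x).trans hx) hr1))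

lemma sq_mul_le_setIntegral_square {G : Plane → ℝ} (hG : Continuous G) {x₀ : Plane} {r c : ℝ}
    (hr : 0 < r) (hc : ∀ x ∈ square x₀ r, c ≤ G x) : r ^ 2 * c ≤ ∫ x in square x₀ r, G x := by
  rw [← measureReal_square x₀ hr, ← smul_eq_mul, ← setIntegral_const]
  exact setIntegral_mono_on (integrableOn_const (by simp [volume_square x₀ hr]))
    ((hG.continuousOn.integrableOn_compact (isCompact_closedSquare x₀ r)).mono_set
      (square_subset_closedSquare _ _)) (isOpen_square _ _).measurableSet hc

namespace IsGrowthIntegrand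

variable {m : ℕ} {p C : ℝ} {f : GradSpace m → HessSpace m → ℝ}

/-- A competitor at `ξ` is shrunk to a slightly smaller square and corrected by a quadratic map, so
that it also competes at `ξ'`. -/
lemma exists_quasiconvexification2_le_add (H : IsGrowthIntegrand p C f) {η : ℝ} (hη0 : 0 < η)
    (hη1 : η < 1) : ∃ L : ℝ, 0 ≤ L ∧ ∀ v ξ ξ', IsSymmHess (ξ' - ξ) →
      quasiconvexification2 (f v) ξ' ≤ quasiconvexification2 (f v) ξ
        + C * 2 ^ p * (η * (1 + ‖ξ‖ ^ p)) + L * ‖ξ' - ξ‖ ^ p := by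
  have hp := H.one_le
  have hC := H.const_nonneg
  obtain ⟨A, hA, K, hK, hKQ, hins⟩ := exists_insertion m hη0 hη1
  refine ⟨C * 2 ^ p * (η * (A + 1) ^ p), by positivity, fun v ξ ξ' hsymm => ?_⟩
  set t := ‖ξ' - ξ‖
  have ht : 0 ≤ t := norm_nonneg _
  refine le_of_forall_pos_le_add fun ε hε => ?_
  obtain ⟨θ, Dθ, D2θ, hθ, hlt⟩ := exists_isBddSobolev2_setIntegral_lt
    (lt_add_of_pos_right (quasiconvexification2 (f v) ξ) hε)
  obtain ⟨B, hB⟩ := hθ.bdd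
  have hsymm' : IsSymmHess (ξ - ξ') := fun i j k => by
    simpa using congrArg Neg.neg (hsymm i j k)
  have hhess (y : Plane) : classicalHess (quadraticMap 0 0 (ξ - ξ')) y = ξ - ξ' :=
    classicalHess_quadraticMap 0 0 hsymm' y
  obtain ⟨Θ, DΘ, D2Θ, hΘ, -, hcore, hlayer⟩ := hins (quadraticMap 0 0 (ξ - ξ')) t
    (contDiff_quadraticMap 0 0 _) (by ext; simp [quadraticMap])
    (by ext; simp [classicalGrad_quadraticMap 0 0 hsymm'])
    (fun y _ => by rw [hhess, norm_sub_rev]) θ Dθ D2θ B hθ (fun x => ⟨(hB x).1, (hB x).2.1⟩)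
  have hle := setIntegral_unitSquare_le (κ := 1)
    (M := C * (2 ^ (p - 1) * (1 + ‖ξ‖ ^ p + ((A + 1) * t) ^ p)))
    hη0 hη1 zero_le_one (by positivity)
    (H.integrableOn_unitSquare_of_isBddSobolev2 v ξ' hΘ)
    (H.integrableOn_unitSquare_of_isBddSobolev2 v ξ hθ) (fun y => H.nonneg _ _)
    (fun y hy => by rw [hcore y hy, hhess, one_mul, ← add_assoc, add_sub_cancel])
    (fun y _ hy => (H.le _ _).trans (mul_le_mul_of_nonneg_left ?_ hC))
  · have hQ := quasiconvexification2_le_setIntegral (ξ := ξ') (H.nonneg v)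
      (hΘ.isSobolev2InfZero isOpen_unitSquare hK hKQ)
    rw [Real.mul_rpow (by positivity) ht, Real.rpow_sub_one two_ne_zero] at hle
    linarith
  · exact one_add_rpow_le hp (norm_nonneg _) (by positivity) (norm_nonneg _)
      (by linarith [norm_add_le_of_le (norm_le_norm_add_norm_sub' ξ' ξ) (hlayer y hy)])

lemma exists_quasiconvexification2_le_add_add (H : IsGrowthIntegrand p C f) {η : ℝ} (hη0 : 0 < η)
    (hη1 : η < 1) {N : ℝ} (hN : 0 ≤ N) : ∃ L : ℝ, 0 ≤ L ∧ ∀ v v' ξ ξ', IsSymmHess (ξ' - ξ) →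
      quasiconvexification2 (f v') ξ' ≤ quasiconvexification2 (f v) ξ
        + C * ((2 ^ p + 1) * (η * (1 + ‖ξ‖ ^ p)) + max (1 + ‖ξ‖ ^ p - N) 0)
        + L * (‖v' - v‖ ^ p + ‖ξ' - ξ‖ ^ p) := by
  have hp := H.one_le
  have hC := H.const_nonneg
  obtain ⟨L, hL, hhess⟩ := H.exists_quasiconvexification2_le_add hη0 hη1
  refine ⟨max (C * (N * (2 * C / η) ^ p)) L, le_max_of_le_right hL, fun v v' ξ ξ' hsymm => ?_⟩
  have hmin := mul_le_mul_of_nonneg_left (min_one_mul_le (s := 2 * C * ‖v' - v‖)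
    (by positivity) hη0 (by positivity : 0 ≤ 1 + ‖ξ‖ ^ p) hN (by linarith : 0 ≤ p)) hC
  rw [mul_div_right_comm, Real.mul_rpow (by positivity) (norm_nonneg _)] at hmin
  have hLv := mul_le_mul_of_nonneg_right (le_max_left (C * (N * (2 * C / η) ^ p)) L)
    (by positivity : 0 ≤ ‖v' - v‖ ^ p)
  have hLξ := mul_le_mul_of_nonneg_right (le_max_right (C * (N * (2 * C / η) ^ p)) L)
    (by positivity : 0 ≤ ‖ξ' - ξ‖ ^ p)
  linarith [hhess v' ξ ξ' hsymm, H.quasiconvexification2_le_add_min v v' ξ]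

lemma continuous_quasiconvexification2 (H : IsGrowthIntegrand p C f) {T : Type*}
    [TopologicalSpace T] {V : T → GradSpace m} {X : T → HessSpace m} (hV : Continuous V)
    (hX : Continuous X) (hs : ∀ x, IsSymmHess (X x)) :
    Continuous fun x => quasiconvexification2 (f (V x)) (X x) := by
  have hp := H.one_le
  have hC := H.const_nonneg
  refine continuous_iff_continuousAt.mpr fun x₀ => Metric.continuousAt_iff'.mpr fun ε hε => ?_
  set N := 2 + ‖X x₀‖ ^ p
  obtain ⟨η, hη0, hη1, hηε⟩ := exists_pos_lt_one_mul_lt (half_pos hε) (C * ((2 ^ p + 1) * N))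
  obtain ⟨L, -, hQ⟩ := H.exists_quasiconvexification2_le_add_add hη0 hη1 (N := N) (by positivity)
  have hsymm (x y : T) : IsSymmHess (X x - X y) := fun i j k => by
    simp only [PiLp.sub_apply, hs x i j k, hs y i j k]
  have hbound : ∀ᶠ x in nhds x₀, 1 + ‖X x‖ ^ p < N := by
    have hc : Continuous fun x => 1 + ‖X x‖ ^ p := by fun_prop (disch := grind)
    exact hc.continuousAt.eventually_lt_const (by linarith)
  have hsmall : ∀ᶠ x in nhds x₀, L * (‖V x - V x₀‖ ^ p + ‖X x - X x₀‖ ^ p) < ε / 2 := by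
    have hc : Continuous fun x => L * (‖V x - V x₀‖ ^ p + ‖X x - X x₀‖ ^ p) := by
      fun_prop (disch := grind)
    exact hc.continuousAt.eventually_lt_const
      (by simp [Real.zero_rpow (by linarith : p ≠ 0), hε])
  have hstep (x y : T) (h : 1 + ‖X x‖ ^ p ≤ N)
      (h' : L * (‖V y - V x‖ ^ p + ‖X y - X x‖ ^ p) < ε / 2) :
      quasiconvexification2 (f (V y)) (X y) < quasiconvexification2 (f (V x)) (X x) + ε := by
    have hle := hQ (V x) (V y) (X x) (X y) (hsymm y x)
    rw [max_eq_right (by linarith), add_zero] at hle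
    have : C * ((2 ^ p + 1) * (η * (1 + ‖X x‖ ^ p))) ≤ C * ((2 ^ p + 1) * (η * N)) := by gcongr
    linarith
  filter_upwards [hbound, hsmall] with x hx hx'
  rw [Real.dist_eq, abs_sub_lt_iff]
  constructor
  · linarith [hstep x₀ x (by simp only [N]; linarith) hx']
  · linarith [hstep x x₀ hx.le (by simpa only [norm_sub_rev] using hx')]

lemma exists_setIntegral_insertion_le (H : IsGrowthIntegrand p C f) (v₀ : GradSpace m)
    (ξ₀ : HessSpace m) {ε : ℝ} (hε : 0 < ε) :
    ∃ t > 0, ∃ B : ℝ, ∀ g : Plane → Vec m, ContDiff ℝ ∞ g → g 0 = 0 → classicalGrad g 0 = 0 →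
      (∀ y ∈ unitSquare, ‖classicalHess g y‖ ≤ t) →
      ∃ (Θ : Plane → Vec m) (DΘ : Plane → GradSpace m) (D2Θ : Plane → HessSpace m),
        IsBddSobolev2 unitSquare Θ DΘ D2Θ ∧ (∀ y, ‖Θ y‖ ≤ B ∧ ‖DΘ y‖ ≤ B) ∧
        ∀ V : Plane → GradSpace m, Measurable V → (∀ y ∈ unitSquare, ‖V y - v₀‖ ≤ t) →
          ∫ y in unitSquare, f (V y) (ξ₀ - classicalHess g y + D2Θ y) ≤
            quasiconvexification2 (f v₀) ξ₀ + ε := by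
  have hp := H.one_le
  have hC := H.const_nonneg
  set q := quasiconvexification2 (f v₀) ξ₀
  have hq : 0 ≤ q := quasiconvexification2_nonneg (H.nonneg v₀)
  set M := C * (1 + (‖ξ₀‖ + 1) ^ p)
  obtain ⟨η, hη0, hη1, hηε⟩ := exists_pos_lt_one_mul_lt (half_pos (half_pos hε)) (2 * M)
  obtain ⟨φ, Dφ, D2φ, hφ, hφlt⟩ := exists_isBddSobolev2_setIntegral_lt
    (lt_add_of_pos_right q (half_pos hε))
  obtain ⟨B, hB⟩ := hφ.bdd
  obtain ⟨A, hA, K, -, hKQ, hins⟩ := exists_insertion m hη0 hη1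
  obtain ⟨t, ht, htε⟩ := exists_pos_mul_lt (lt_min one_pos (half_pos (half_pos hε)))
    (A + 1 + 2 * C + 2 * C * (q + ε / 2))
  obtain ⟨ht1, htε⟩ := lt_min_iff.mp htε
  have hAt : 0 ≤ (A + 1) * t := by positivity
  have hCt : 0 ≤ C * t := by positivity
  have hqt : 0 ≤ C * (q + ε / 2) * t := by positivity
  refine ⟨t, ht, A * t + B, fun g hg h0 h1 hgt => ?_⟩
  obtain ⟨Θ, DΘ, D2Θ, hΘ, hΘb, hcore, hlayer⟩ :=
    hins g t hg h0 h1 hgt φ Dφ D2φ B hφ fun x => ⟨(hB x).1, (hB x).2.1⟩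
  refine ⟨Θ, DΘ, D2Θ, hΘ.mono hKQ, hΘb, fun V hV hVt => ?_⟩
  obtain ⟨B', hB'⟩ := hΘ.bdd
  have hhess (y : Plane) (hy : y ∈ unitSquare) : ‖ξ₀ - classicalHess g y‖ ≤ ‖ξ₀‖ + t :=
    norm_sub_le_of_le le_rfl (hgt y hy)
  have hmeas : Measurable fun y => ξ₀ - classicalHess g y + D2Θ y :=
    (measurable_const.sub (contDiff_classicalHess hg).continuous.measurable).add hΘ.meas_hess
  have hle := setIntegral_unitSquare_le (κ := 1 + 2 * (C * t)) (M := M) hη0 hη1 (by positivity)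
    (by positivity)
    (H.integrableOn isOpen_unitSquare.measurableSet (by simp [volume_unitSquare]) hV hmeas
      fun y hy => norm_add_le_of_le (hhess y hy) (hB' y).2.2)
    (H.integrableOn_unitSquare_of_isBddSobolev2 v₀ ξ₀ hφ) (fun y => H.nonneg _ _)
    (fun y hy => ?_) (fun y hyQ hy => (H.le _ _).trans ?_)
  · have := mul_le_mul_of_nonneg_left hφlt.le (by positivity : 0 ≤ 1 + 2 * (C * t))
    linarith
  · rw [hcore y hy, ← add_assoc, sub_add_cancel]
    exact H.le_one_add_mul _ (mul_le_mul_of_nonneg_left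
      (hVt y (square_subset_unitSquare hη0 hy)) hC) (by linarith)
  · simp only [M]
    gcongr
    linarith [norm_add_le_of_le (hhess y hyQ) (hlayer y hy)]

lemma exists_local_perturbation (H : IsGrowthIntegrand p C f) {ψ : Plane → Vec m}
    (hψ : ContDiff ℝ ∞ ψ) (x₀ : Plane) {ε : ℝ} (hε : 0 < ε) :
    ∃ r₀ > 0, ∀ r : ℝ, 0 < r → r < r₀ →
      ∃ (θ : Plane → Vec m) (Dθ : Plane → GradSpace m) (D2θ : Plane → HessSpace m),
        IsBddSobolev2 (square x₀ r) θ Dθ D2θ ∧ (∀ x, ‖θ x‖ ≤ ε ∧ ‖Dθ x‖ ≤ ε) ∧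
        ∫ x in square x₀ r, f (classicalGrad ψ x + Dθ x) (classicalHess ψ x + D2θ x) ≤
          (∫ x in square x₀ r, quasiconvexification2 (f (classicalGrad ψ x)) (classicalHess ψ x))
            + ε * r ^ 2 := by
  set q : Plane → ℝ := fun x => quasiconvexification2 (f (classicalGrad ψ x)) (classicalHess ψ x)
  obtain ⟨t, ht, B, hins⟩ := H.exists_setIntegral_insertion_le (classicalGrad ψ x₀)
    (classicalHess ψ x₀) (half_pos hε)
  have hgrad := (contDiff_classicalGrad hψ).continuous
  have hhess := (contDiff_classicalHess hψ).continuous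
  have hq : Continuous q :=
    H.continuous_quasiconvexification2 hgrad hhess (isSymmHess_classicalHess hψ)
  obtain ⟨ρ, hρ, hclose⟩ := Metric.eventually_nhds_iff.mp
    ((Metric.continuousAt_iff'.mp hgrad.continuousAt _ (half_pos ht)).and
      ((Metric.continuousAt_iff'.mp hhess.continuousAt _ ht).and
        (Metric.continuousAt_iff'.mp hq.continuousAt _ (half_pos hε))))
  obtain ⟨c, hc0, hc1, hcB⟩ := exists_pos_lt_one_mul_lt (lt_min hε (half_pos ht)) B
  refine ⟨min ρ c, lt_min hρ hc0, fun r hr hrlt => ?_⟩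
  obtain ⟨hrρ, hrc⟩ := lt_min_iff.mp hrlt
  have hdist (x : Plane) (hx : x ∈ square x₀ r) : dist x x₀ < ρ :=
    (closedSquare_subset_closedBall x₀ r (square_subset_closedSquare _ _ hx)).trans_lt hrρ
  have hdist' (y : Plane) (hy : y ∈ unitSquare) : dist (x₀ + r • y) x₀ < ρ :=
    hdist _ ((mem_square_iff hr).mpr (by simpa [smul_smul, hr.ne'] using hy))
  obtain ⟨g, hg, hg0, hg1, hgψ⟩ := exists_contDiff_classicalHess_eq_sub hψ
    (isSymmHess_classicalHess hψ x₀) x₀ hr.ne'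
  obtain ⟨Θ, DΘ, D2Θ, hΘ, hΘB, hΘf⟩ := hins g hg hg0 hg1 fun y hy => by
    rw [hgψ, ← dist_eq_norm, dist_comm]
    exact (hclose (hdist' y hy)).2.1.le
  have hB : 0 ≤ B := (norm_nonneg _).trans (hΘB 0).1
  have hrB : r * B ≤ ε ∧ r * B ≤ t / 2 := le_min_iff.mp (by nlinarith)
  refine ⟨_, _, _, hΘ.rescale (by simp [volume_unitSquare]) x₀ hr.ne'
    fun x hx => (mem_square_iff hr).mpr hx, fun x =>
      ⟨(norm_sq_smul_le hr.le (hrc.trans hc1).le (hΘB _).1).trans hrB.1,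
        (norm_smul_le_mul hr.le (hΘB _).2).trans hrB.1⟩, ?_⟩
  · have hscale := setIntegral_square_comp_inv_smul_sub
      (fun y => f (classicalGrad ψ (x₀ + r • y) + r • DΘ y)
        (classicalHess ψ (x₀ + r • y) + D2Θ y)) x₀ hr
    simp only [smul_inv_smul₀ hr.ne', add_sub_cancel] at hscale
    have hle := hΘf (fun y => classicalGrad ψ (x₀ + r • y) + r • DΘ y)
      ((hgrad.measurable.comp (by fun_prop)).add (hΘ.meas_grad.const_smul r)) fun y hy => ?_
    · simp only [hgψ, sub_sub_cancel] at hle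
      have := sq_mul_le_setIntegral_square hq (c := q x₀ - ε / 2) hr fun x hx => by
        linarith [(abs_lt.mp (hclose (hdist x hx)).2.2).1]
      rw [hscale]
      nlinarith [mul_le_mul_of_nonneg_left hle (sq_nonneg r)]
    · rw [add_sub_right_comm, ← add_halves t]
      refine norm_add_le_of_le ?_ ?_
      · exact dist_eq_norm (classicalGrad ψ _) _ ▸ (hclose (hdist' y hy)).1.le
      · exact (norm_smul_le_mul hr.le (hΘB y).2).trans hrB.2

end IsGrowthIntegrand

section Vitali

lemma exists_finset_measure_diff_biUnion_lt {α ι : Type*} [MeasurableSpace α] [Countable ι]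
    {μ : Measure α} {U : Set α} (hU : MeasurableSet U) (hUf : μ U ≠ ⊤) {s : ι → Set α}
    (hs : ∀ i, MeasurableSet (s i)) (h : μ (U \ ⋃ i, s i) = 0) {ν : ℝ≥0∞} (hν : 0 < ν) :
    ∃ F : Finset ι, μ (U \ ⋃ i ∈ F, s i) < ν := by
  have htends := tendsto_measure_iInter_atTop (μ := μ) (s := fun F : Finset ι => U \ ⋃ i ∈ F, s i)
    (fun F => (hU.diff (F.measurableSet_biUnion fun i _ => hs i)).nullMeasurableSet)
    (fun F G hFG => sdiff_subset_sdiff_right (biUnion_subset_biUnion_left hFG))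
    ⟨∅, measure_ne_top_of_subset sdiff_subset hUf⟩
  rw [← sdiff_iUnion, ← iUnion_eq_iUnion_finset, h] at htends
  exact (htends.eventually_lt_const hν).exists

variable {U : Set Plane} {r₀ : Plane → ℝ}

lemma volume_closedSquare_diff_square (a : Plane) {r : ℝ} (hr : 0 < r) :
    volume (closedSquare a r \ square a r) = 0 := by
  rw [measure_sdiff (square_subset_closedSquare _ _)
    (isOpen_square _ _).measurableSet.nullMeasurableSet (by simp [volume_square a hr]),
    volume_square a hr, volume_closedSquare a hr.le, tsub_self]

lemma exists_countable_disjoint_closedSquare_ae (hU : IsOpen U) (hr₀ : ∀ x, 0 < r₀ x) :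
    ∃ u : Set (Plane × ℝ), u.Countable ∧
      (∀ a ∈ u, 0 < a.2 ∧ a.2 < r₀ a.1 ∧ closedSquare a.1 a.2 ⊆ U) ∧
      u.PairwiseDisjoint (fun a => closedSquare a.1 a.2) ∧
      volume (U \ ⋃ a ∈ u, closedSquare a.1 a.2) = 0 := by
  refine (Vitali.exists_disjoint_covering_ae volume U
    {a : Plane × ℝ | 0 < a.2 ∧ a.2 < r₀ a.1 ∧ closedSquare a.1 a.2 ⊆ U} 36
    (fun a => a.2) (fun a => a.1) (fun a => closedSquare a.1 a.2)
    (fun a _ => closedSquare_subset_closedBall _ _) ?_ ?_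
    (fun a _ => isClosed_closedSquare _ _) ?_).imp
    fun u ⟨hut, huc, hud, hu0⟩ => ⟨huc, fun a ha => hut ha, hud, hu0⟩
  · intro a ha
    refine (measure_mono (closedBall_subset_closedSquare _ _)).trans ?_
    rw [volume_closedSquare _ (by linarith [ha.1]), volume_closedSquare _ ha.1.le,
      show ((36 : NNReal) : ℝ≥0∞) = ENNReal.ofReal 36 by simp, ← ENNReal.ofReal_mul (by simp)]
    exact ENNReal.ofReal_le_ofReal (by ring_nf; rfl)
  · exact fun a ha => ⟨a.1, interior_maximal (square_subset_closedSquare a.1 a.2)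
      (isOpen_square _ _) ((mem_square_iff ha.1).mpr (by simpa using zero_mem_unitSquare))⟩
  · intro x hx ε hε
    obtain ⟨ρ, hρ, hρU⟩ := Metric.isOpen_iff.mp hU x hx
    obtain ⟨r, hr, hrlt⟩ := exists_between (lt_min hε (lt_min hρ (hr₀ x)))
    obtain ⟨hrε, hrρ, hrr₀⟩ := by simpa only [lt_min_iff] using hrlt
    exact ⟨(x, r), ⟨hr, hrr₀, (closedSquare_subset_closedBall _ _).trans
      ((Metric.closedBall_subset_ball hrρ).trans hρU)⟩, hrε.le, rfl⟩

lemma exists_finite_disjoint_square (hU : IsOpen U) (hUf : volume U ≠ ⊤)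
    (hr₀ : ∀ x, 0 < r₀ x) {ν : ℝ≥0∞} (hν : 0 < ν) :
    ∃ (ι : Type) (_ : Fintype ι) (a : ι → Plane) (r : ι → ℝ),
      (∀ i, 0 < r i ∧ r i < r₀ (a i) ∧ square (a i) (r i) ⊆ U) ∧
      Pairwise (Function.onFun Disjoint fun i => square (a i) (r i)) ∧
      volume (U \ ⋃ i, square (a i) (r i)) < ν := by
  obtain ⟨u, huc, hu, hud, hu0⟩ := exists_countable_disjoint_closedSquare_ae hU hr₀
  have : Countable u := huc
  have hnull : volume (U \ ⋃ i : u, square i.1.1 i.1.2) = 0 := by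
    refine measure_mono_null (t := (U \ ⋃ a ∈ u, closedSquare a.1 a.2) ∪
      ⋃ i : u, closedSquare i.1.1 i.1.2 \ square i.1.1 i.1.2) ?_ (measure_union_null hu0
        (measure_iUnion_null fun i => volume_closedSquare_diff_square _ (hu i i.2).1))
    rintro x ⟨hxU, hx⟩
    by_cases hxc : x ∈ ⋃ a ∈ u, closedSquare a.1 a.2
    · obtain ⟨a, ha, hxa⟩ := mem_iUnion₂.mp hxc
      exact .inr (mem_iUnion.mpr ⟨⟨a, ha⟩, hxa, fun h => hx (mem_iUnion.mpr ⟨⟨a, ha⟩, h⟩)⟩)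
    · exact .inl ⟨hxU, hxc⟩
  obtain ⟨F, hF⟩ := exists_finset_measure_diff_biUnion_lt hU.measurableSet hUf
    (fun i : u => (isOpen_square i.1.1 i.1.2).measurableSet) hnull hν
  refine ⟨F, inferInstance, fun i => i.1.1.1, fun i => i.1.1.2, fun i => ?_, fun i j hij => ?_, ?_⟩
  · obtain ⟨h0, h1, h2⟩ := hu _ i.1.2
    exact ⟨h0, h1, (square_subset_closedSquare _ _).trans h2⟩
  · exact (hud i.1.2 j.1.2 fun h => hij (Subtype.ext (Subtype.ext h))).mono
      (square_subset_closedSquare _ _) (square_subset_closedSquare _ _)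
  · rwa [iUnion_subtype]

end Vitali

lemma IsBddSobolev2.exists_glue {m : ℕ} {ι : Type*} [Finite ι] {S : ι → Set Plane}
    (hS : Pairwise (Function.onFun Disjoint S)) {θ : ι → Plane → Vec m}
    {Dθ : ι → Plane → GradSpace m} {D2θ : ι → Plane → HessSpace m}
    (H : ∀ i, IsBddSobolev2 (S i) (θ i) (Dθ i) (D2θ i)) :
    ∃ (θ' : Plane → Vec m) (Dθ' : Plane → GradSpace m) (D2θ' : Plane → HessSpace m),
      IsBddSobolev2 (⋃ i, S i) θ' Dθ' D2θ' ∧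
      ∀ i, ∀ x ∈ S i, θ' x = θ i x ∧ Dθ' x = Dθ i x ∧ D2θ' x = D2θ i x := by
  cases nonempty_fintype ι
  refine ⟨_, _, _, IsBddSobolev2.sum Finset.univ fun i _ => (H i).mono (subset_iUnion S i),
    fun i x hx => ?_⟩
  have hzero (j : ι) (hji : j ≠ i) := (H j).eq_zero x (disjoint_right.mp (hS hji) hx)
  exact ⟨Fintype.sum_eq_single i fun j hj => (hzero j hj).1,
    Fintype.sum_eq_single i fun j hj => (hzero j hj).2.1,
    Fintype.sum_eq_single i fun j hj => (hzero j hj).2.2⟩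

lemma IsGrowthIntegrand.exists_global_perturbation {m : ℕ} {p C : ℝ}
    {f : GradSpace m → HessSpace m → ℝ} (H : IsGrowthIntegrand p C f) {T : Set Plane}
    {ψ : Plane → Vec m} (hψ : IsTestFunction T ψ) {V : Set Plane} (hV : IsOpen V)
    (hVf : volume V ≠ ⊤) {ε : ℝ} (hε : 0 < ε) {ν : ℝ≥0∞} (hν : 0 < ν) :
    ∃ (S : Set Plane) (θ : Plane → Vec m) (Dθ : Plane → GradSpace m) (D2θ : Plane → HessSpace m),
      MeasurableSet S ∧ S ⊆ V ∧ volume (V \ S) < ν ∧ IsBddSobolev2 S θ Dθ D2θ ∧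
      (∀ x, ‖θ x‖ ≤ ε ∧ ‖Dθ x‖ ≤ ε) ∧
      ∫ x in S, f (classicalGrad ψ x + Dθ x) (classicalHess ψ x + D2θ x) ≤
        (∫ x in S, quasiconvexification2 (f (classicalGrad ψ x)) (classicalHess ψ x))
          + ε * volume.real V := by
  choose r₀ hr₀ hloc using fun x₀ => H.exists_local_perturbation hψ.contDiff x₀ hε
  obtain ⟨ι, _, a, r, hr, hdisj, hν⟩ := exists_finite_disjoint_square hV hVf hr₀ hν
  choose θi Dθi D2θi hθi hθiε hE using fun i => hloc (a i) (r i) (hr i).1 (hr i).2.1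
  obtain ⟨θ, Dθ, D2θ, hθ, heq⟩ := IsBddSobolev2.exists_glue hdisj hθi
  set S := ⋃ i, square (a i) (r i)
  have hSm (i : ι) : MeasurableSet (square (a i) (r i)) := (isOpen_square _ _).measurableSet
  have hSV : S ⊆ V := iUnion_subset fun i => (hr i).2.2
  have hgrad := hψ.classicalGrad.contDiff.continuous
  have hhess := hψ.classicalHess.contDiff.continuous
  have hq := H.continuous_quasiconvexification2 hgrad hhess (isSymmHess_classicalHess hψ.contDiff)
  have hInt : IntegrableOn (fun x => f (classicalGrad ψ x + Dθ x) (classicalHess ψ x + D2θ x)) S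
      volume := by
    obtain ⟨B, hB⟩ := hψ.classicalHess.exists_norm_le
    obtain ⟨B', hB'⟩ := hθ.bdd
    exact H.integrableOn (.iUnion hSm) (measure_ne_top_of_subset hSV hVf)
      (hgrad.measurable.add hθ.meas_grad) (hhess.measurable.add hθ.meas_hess)
      fun x _ => norm_add_le_of_le (hB x) (hB' x).2.2
  refine ⟨S, θ, Dθ, D2θ, .iUnion hSm, hSV, hν, hθ, fun x => ?_, ?_⟩
  · by_cases hx : x ∈ S
    · obtain ⟨i, hi⟩ := mem_iUnion.mp hx
      rw [(heq i x hi).1, (heq i x hi).2.1]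
      exact hθiε i x
    · simp [hθ.eq_zero x hx, hε.le]
  · have hvol : ∑ i, r i ^ 2 ≤ volume.real V := by
      simp_rw [← fun i => measureReal_square (a i) (hr i).1]
      rw [← measureReal_iUnion_fintype hdisj hSm
        fun i => measure_ne_top_of_subset (hr i).2.2 hVf]
      exact measureReal_mono hSV hVf
    rw [integral_iUnion_fintype hSm hdisj fun i => hInt.mono_set
        (subset_iUnion (fun i => square (a i) (r i)) i),
      integral_iUnion_fintype hSm hdisj fun i => (hq.continuousOn.integrableOn_compact
        (isCompact_closedSquare (a i) (r i))).mono_set (square_subset_closedSquare _ _)]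
    calc _ ≤ ∑ i, ((∫ x in square (a i) (r i), quasiconvexification2 (f (classicalGrad ψ x))
          (classicalHess ψ x)) + ε * r i ^ 2) := by
          refine Finset.sum_le_sum fun i _ => (hE i).trans' (setIntegral_congr_fun (hSm i)
            fun x hx => ?_).le
          simp only [heq i x hx]
      _ ≤ _ := by
          rw [Finset.sum_add_distrib, ← Finset.mul_sum]
          gcongr

section Symmetrization

variable {m : ℕ}

/-- The symmetrization of `ξ` in its last two indices. Composing with it extends the relaxed
density from symmetric to all `ξ` in a continuous way, which yields measurability. -/
noncomputable def symmHess (ξ : HessSpace m) : HessSpace m :=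
  WithLp.toLp 2 fun a => (ξ a + ξ (a.1, a.2.2, a.2.1)) / 2

lemma isSymmHess_symmHess (ξ : HessSpace m) : IsSymmHess (symmHess ξ) := fun i j k => by
  simp [symmHess, add_comm]

lemma IsSymmHess.symmHess_eq {ξ : HessSpace m} (h : IsSymmHess ξ) : symmHess ξ = ξ := by
  ext ⟨i, j, k⟩
  simp [symmHess, h i k j]

lemma continuous_symmHess : Continuous (symmHess : HessSpace m → HessSpace m) :=
  (PiLp.continuous_toLp 2 _).comp (continuous_pi fun a => by fun_prop)

end Symmetrization

section IntegralBounds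

variable {α : Type*} [MeasurableSpace α] {μ : Measure α}

lemma exists_integral_max_sub_lt {a : α → ℝ} (ha : Integrable a μ) (ha0 : ∀ x, 0 ≤ a x) {σ : ℝ}
    (hσ : 0 < σ) : ∃ N : ℕ, ∫ x, max (a x - N) 0 ∂μ < σ := by
  have htends := tendsto_integral_of_dominated_convergence (μ := μ)
    (F := fun (N : ℕ) x => max (a x - N) 0) (f := fun _ => 0) a
    (fun N => (ha.1.sub aestronglyMeasurable_const).sup aestronglyMeasurable_const) ha
    (fun N => ae_of_all _ fun x => by
      rw [Real.norm_of_nonneg (le_max_right _ _)]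
      exact max_le (by linarith [Nat.cast_nonneg (α := ℝ) N]) (ha0 x))
    (ae_of_all _ fun x => tendsto_const_nhds.congr' <| by
      filter_upwards [Filter.eventually_ge_atTop ⌈a x⌉₊] with N hN
      rw [max_eq_right (by linarith [Nat.ceil_le.mp hN])])
  rw [integral_zero] at htends
  exact (htends.eventually_lt_const hσ).exists

lemma exists_forall_setIntegral_lt {g : α → ℝ} (hg : Integrable g μ) {σ : ℝ} (hσ : 0 < σ) :
    ∃ ν : ℝ≥0∞, 0 < ν ∧ ∀ s, μ s < ν → ∫ x in s, g x ∂μ < σ := by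
  obtain ⟨ν, hν, h⟩ := exists_pos_setLIntegral_lt_of_measure_lt hg.2.ne
    (ε := ENNReal.ofReal σ) (by simpa using hσ)
  refine ⟨ν, hν, fun s hs => (Real.le_norm_self _).trans_lt ?_⟩
  rw [← toReal_enorm]
  exact (ENNReal.lt_ofReal_iff_toReal_lt enorm_ne_top).mp
    ((enorm_integral_le_lintegral_enorm _).trans_lt (h s hs))

variable {E : Type*} [NormedAddCommGroup E]

lemma integral_norm_rpow_le {F : α → E} {p τ : ℝ} (hp : 0 < p) (hτ : 0 ≤ τ)
    (hF : MemLp F (ENNReal.ofReal p) μ)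
    (h : eLpNorm F (ENNReal.ofReal p) μ ≤ ENNReal.ofReal τ) : ∫ x, ‖F x‖ ^ p ∂μ ≤ τ ^ p := by
  rw [hF.eLpNorm_eq_integral_rpow_norm (by simpa using hp) ENNReal.ofReal_ne_top,
    ENNReal.ofReal_le_ofReal_iff hτ, ENNReal.toReal_ofReal hp.le] at h
  exact (Real.rpow_inv_le_iff_of_pos (integral_nonneg fun x => by positivity) hτ hp).mp h

lemma exists_pos_mul_rpow_lt {p σ : ℝ} (hp : 0 < p) (b : ℝ) (hσ : 0 < σ) :
    ∃ τ : ℝ, 0 < τ ∧ b * τ ^ p < σ := by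
  obtain ⟨η, hη, -, hbη⟩ := exists_pos_lt_one_mul_lt hσ b
  exact ⟨η ^ p⁻¹, by positivity, by rwa [Real.rpow_inv_rpow hη.le hp.ne']⟩

end IntegralBounds

namespace IsGrowthIntegrand

variable {m : ℕ} {p C : ℝ} {f : GradSpace m → HessSpace m → ℝ} {α : Type*} [MeasurableSpace α]
  {μ : Measure α} [IsFiniteMeasure μ] {V : α → GradSpace m} {F : α → HessSpace m}

lemma integrable_quasiconvexification2 (H : IsGrowthIntegrand p C f)
    (hV : AEStronglyMeasurable V μ) (hF : MemLp F (ENNReal.ofReal p) μ)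
    (hs : ∀ᵐ x ∂μ, IsSymmHess (F x)) :
    Integrable (fun x => quasiconvexification2 (f (V x)) (F x)) μ := by
  have hcont : Continuous fun z : GradSpace m × HessSpace m =>
      quasiconvexification2 (f z.1) (symmHess z.2) :=
    H.continuous_quasiconvexification2 continuous_fst (continuous_symmHess.comp continuous_snd)
      fun z => isSymmHess_symmHess _
  refine ((H.integrable_growth hF).const_mul C).mono' ?_ (ae_of_all _ fun x => ?_)
  · refine (hcont.comp_aestronglyMeasurable (hV.prodMk hF.1)).congr ?_
    filter_upwards [hs] with x hx
    rw [hx.symmHess_eq]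
  · rw [Real.norm_of_nonneg (quasiconvexification2_nonneg (H.nonneg _))]
    exact H.quasiconvexification2_le_growth _ _

lemma exists_integrable_quasiconvexification2_le (H : IsGrowthIntegrand p C f)
    (hF : MemLp F (ENNReal.ofReal p) μ) {σ : ℝ} (hσ : 0 < σ) :
    ∃ b : α → ℝ, Integrable b μ ∧ ∫ x, b x ∂μ < σ ∧ ∃ L : ℝ, 0 ≤ L ∧
      ∀ v v' x ξ', IsSymmHess (ξ' - F x) → quasiconvexification2 (f v') ξ' ≤
        quasiconvexification2 (f v) (F x) + b x + L * (‖v' - v‖ ^ p + ‖ξ' - F x‖ ^ p) := by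
  set a : α → ℝ := fun x => 1 + ‖F x‖ ^ p
  have ha : Integrable a μ := H.integrable_growth hF
  obtain ⟨κ, hκ, hCκ⟩ := exists_pos_mul_lt (half_pos hσ) C
  obtain ⟨N, hN⟩ := exists_integral_max_sub_lt ha (fun x => by positivity) hκ
  obtain ⟨η, hη0, hη1, hη⟩ := exists_pos_lt_one_mul_lt (half_pos hσ)
    (C * (2 ^ p + 1) * ∫ x, a x ∂μ)
  obtain ⟨L, hL, hQ⟩ := H.exists_quasiconvexification2_le_add_add hη0 hη1 N.cast_nonneg
  have hamul : Integrable (fun x => (2 ^ p + 1) * (η * a x)) μ := (ha.const_mul η).const_mul _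
  have hamax : Integrable (fun x => max (a x - N) 0) μ :=
    (ha.sub (integrable_const _)).sup (integrable_const 0)
  refine ⟨fun x => C * ((2 ^ p + 1) * (η * a x) + max (a x - N) 0),
    (hamul.add hamax).const_mul C, ?_, L, hL, fun v v' x ξ' hξ' => hQ v v' (F x) ξ' hξ'⟩
  rw [integral_const_mul, integral_add hamul hamax, integral_const_mul, integral_const_mul]
  have := mul_le_mul_of_nonneg_left hN.le H.const_nonneg
  linarith

lemma exists_integral_quasiconvexification2_le (H : IsGrowthIntegrand p C f)
    (hV : MemLp V (ENNReal.ofReal p) μ) (hF : MemLp F (ENNReal.ofReal p) μ)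
    (hs : ∀ᵐ x ∂μ, IsSymmHess (F x)) {σ : ℝ} (hσ : 0 < σ) :
    ∃ τ : ℝ, 0 < τ ∧ ∀ (V' : α → GradSpace m) (F' : α → HessSpace m),
      MemLp V' (ENNReal.ofReal p) μ → MemLp F' (ENNReal.ofReal p) μ →
      (∀ᵐ x ∂μ, IsSymmHess (F' x)) →
      eLpNorm (V' - V) (ENNReal.ofReal p) μ ≤ ENNReal.ofReal τ →
      eLpNorm (F' - F) (ENNReal.ofReal p) μ ≤ ENNReal.ofReal τ →
      ∫ x, quasiconvexification2 (f (V' x)) (F' x) ∂μ ≤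
        (∫ x, quasiconvexification2 (f (V x)) (F x) ∂μ) + σ := by
  have hp0 : 0 < p := one_pos.trans_le H.one_le
  obtain ⟨b, hb, hbσ, L, hL, hQ⟩ := H.exists_integrable_quasiconvexification2_le hF (half_pos hσ)
  obtain ⟨τ, hτ, hLτ⟩ := exists_pos_mul_rpow_lt hp0 (2 * L) (half_pos hσ)
  refine ⟨τ, hτ, fun V' F' hV' hF' hs' hVτ hFτ => ?_⟩
  have hVint := H.integrable_norm_rpow (hV'.sub hV)
  have hFint := H.integrable_norm_rpow (hF'.sub hF)
  have hQint := H.integrable_quasiconvexification2 hV.1 hF hs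
  have hQb : Integrable (fun x => quasiconvexification2 (f (V x)) (F x) + b x) μ := hQint.add hb
  have hL' : Integrable (fun x => L * (‖(V' - V) x‖ ^ p + ‖(F' - F) x‖ ^ p)) μ :=
    (hVint.add hFint).const_mul L
  have hLint : L * ((∫ x, ‖(V' - V) x‖ ^ p ∂μ) + ∫ x, ‖(F' - F) x‖ ^ p ∂μ) ≤
      L * (τ ^ p + τ ^ p) := by
    gcongr
    exacts [integral_norm_rpow_le hp0 hτ.le (hV'.sub hV) hVτ,
      integral_norm_rpow_le hp0 hτ.le (hF'.sub hF) hFτ]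
  calc ∫ x, quasiconvexification2 (f (V' x)) (F' x) ∂μ
      ≤ ∫ x, (quasiconvexification2 (f (V x)) (F x) + b x
          + L * (‖(V' - V) x‖ ^ p + ‖(F' - F) x‖ ^ p)) ∂μ := by
        refine integral_mono_ae (H.integrable_quasiconvexification2 hV'.1 hF' hs') (hQb.add hL') ?_
        filter_upwards [hs, hs'] with x hx hx'
        exact hQ _ _ _ _ fun i j k => by simp [hx i j k, hx' i j k]
    _ = (∫ x, quasiconvexification2 (f (V x)) (F x) ∂μ) + (∫ x, b x ∂μ)
          + L * ((∫ x, ‖(V' - V) x‖ ^ p ∂μ) + ∫ x, ‖(F' - F) x‖ ^ p ∂μ) := by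
        rw [integral_add hQb hL', integral_add hQint hb,
          integral_const_mul, integral_add hVint hFint]
    _ ≤ _ := by linarith

lemma exists_setIntegral_growth_le (H : IsGrowthIntegrand p C f)
    (hF : MemLp F (ENNReal.ofReal p) μ) {σ : ℝ} (hσ : 0 < σ) :
    ∃ τ : ℝ, 0 < τ ∧ ∃ ν : ℝ≥0∞, 0 < ν ∧ ∀ F' : α → HessSpace m,
      MemLp F' (ENNReal.ofReal p) μ →
      eLpNorm (F' - F) (ENNReal.ofReal p) μ ≤ ENNReal.ofReal τ →
      ∀ s, μ s < ν → C * ∫ x in s, (1 + ‖F' x‖ ^ p) ∂μ ≤ σ := by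
  have hp0 : 0 < p := one_pos.trans_le H.one_le
  set K : ℝ := C * 2 ^ (p - 1)
  have hK : 0 ≤ K := mul_nonneg H.const_nonneg (by positivity)
  obtain ⟨κ, hκ, hKκ⟩ := exists_pos_mul_lt (half_pos hσ) K
  obtain ⟨ν, hν, hνκ⟩ := exists_forall_setIntegral_lt (H.integrable_growth hF) hκ
  obtain ⟨τ, hτ, hKτ⟩ := exists_pos_mul_rpow_lt hp0 K (half_pos hσ)
  refine ⟨τ, hτ, ν, hν, fun F' hF' hFτ s hs => ?_⟩
  have hFint := H.integrable_norm_rpow (hF'.sub hF)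
  have hFs : ∫ x in s, ‖(F' - F) x‖ ^ p ∂μ ≤ τ ^ p :=
    (setIntegral_le_integral hFint (ae_of_all _ fun x => by positivity)).trans
      (integral_norm_rpow_le hp0 hτ.le (hF'.sub hF) hFτ)
  calc C * ∫ x in s, (1 + ‖F' x‖ ^ p) ∂μ
      ≤ C * ∫ x in s, 2 ^ (p - 1) * (1 + ‖F x‖ ^ p + ‖(F' - F) x‖ ^ p) ∂μ := by
        refine mul_le_mul_of_nonneg_left (setIntegral_mono (H.integrable_growth hF').integrableOn
          (((H.integrable_growth hF).add hFint).const_mul _).integrableOn fun x => ?_)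
          H.const_nonneg
        exact one_add_rpow_le H.one_le (norm_nonneg _) (norm_nonneg _) (norm_nonneg _)
          (norm_le_insert' _ _)
    _ = K * (∫ x in s, (1 + ‖F x‖ ^ p) ∂μ) + K * ∫ x in s, ‖(F' - F) x‖ ^ p ∂μ := by
        rw [integral_const_mul, integral_add (H.integrable_growth hF).integrableOn
          hFint.integrableOn]
        ring
    _ ≤ K * κ + K * τ ^ p := by gcongr; exact (hνκ s hs).le
    _ ≤ σ := by linarith

end IsGrowthIntegrand

lemma sobolev1Norm_le {m : ℕ} (Ω : Set Plane) {p : ℝ} (hp : 1 ≤ p) (u : Plane → Vec m)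
    (Du : Plane → GradSpace m) :
    sobolev1Norm Ω p u Du ≤ eLpNorm u (ENNReal.ofReal p) (volume.restrict Ω)
      + eLpNorm Du (ENNReal.ofReal p) (volume.restrict Ω) := by
  have hp0 : 0 < p := one_pos.trans_le hp
  have h0 : ENNReal.ofReal p ≠ 0 := by simpa using hp0
  rw [eLpNorm_eq_lintegral_rpow_enorm_toReal h0 ENNReal.ofReal_ne_top,
    eLpNorm_eq_lintegral_rpow_enorm_toReal h0 ENNReal.ofReal_ne_top, ENNReal.toReal_ofReal hp0.le]
  simpa only [sobolev1Norm, ← ENNReal.rpow_mul, one_div_mul_cancel hp0.ne', ENNReal.rpow_one] using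
    ENNReal.rpow_add_rpow_le_add ((∫⁻ x in Ω, ‖u x‖ₑ ^ p) ^ (1 / p))
      ((∫⁻ x in Ω, ‖Du x‖ₑ ^ p) ^ (1 / p)) hp

lemma eLpNorm_sub_le_of_le {α E : Type*} [MeasurableSpace α] {μ : Measure α}
    [NormedAddCommGroup E] {q : ℝ≥0∞} (hq : 1 ≤ q) {u z w : α → E} (hu : AEStronglyMeasurable u μ)
    (hz : AEStronglyMeasurable z μ) (hw : AEStronglyMeasurable w μ) {a b : ℝ≥0∞}
    (hzu : eLpNorm (z - u) q μ ≤ a) (hwz : eLpNorm (w - z) q μ ≤ b) :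
    eLpNorm (u - w) q μ ≤ a + b := by
  rw [eLpNorm_sub_comm, ← sub_add_sub_cancel' z u w]
  exact (eLpNorm_add_le (hz.sub hu) (hw.sub hz) hq).trans (add_le_add hzu hwz)

lemma sobolev1Norm_sub_lt {m : ℕ} {Ω : Set Plane} {p δ : ℝ} (hp : 1 ≤ p) (hδ : 0 < δ)
    {u z w : Plane → Vec m} {Du Dz Dw : Plane → GradSpace m} {D2u D2z D2w : Plane → HessSpace m}
    (hu : IsSobolev2 Ω (ENNReal.ofReal p) u Du D2u) (hz : IsSobolev2 Ω (ENNReal.ofReal p) z Dz D2z)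
    (hw : IsSobolev2 Ω (ENNReal.ofReal p) w Dw D2w)
    (hzu : eLpNorm (z - u) (ENNReal.ofReal p) (volume.restrict Ω) ≤ ENNReal.ofReal (δ / 8))
    (hDzu : eLpNorm (Dz - Du) (ENNReal.ofReal p) (volume.restrict Ω) ≤ ENNReal.ofReal (δ / 8))
    (hwz : eLpNorm (w - z) (ENNReal.ofReal p) (volume.restrict Ω) ≤ ENNReal.ofReal (δ / 8))
    (hDwz : eLpNorm (Dw - Dz) (ENNReal.ofReal p) (volume.restrict Ω) ≤ ENNReal.ofReal (δ / 8)) :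
    sobolev1Norm Ω p (fun x => u x - w x) (fun x => Du x - Dw x) < ENNReal.ofReal δ := by
  have hq : 1 ≤ ENNReal.ofReal p := by simpa using hp
  calc sobolev1Norm Ω p (fun x => u x - w x) (fun x => Du x - Dw x)
      ≤ eLpNorm (u - w) (ENNReal.ofReal p) (volume.restrict Ω)
        + eLpNorm (Du - Dw) (ENNReal.ofReal p) (volume.restrict Ω) := sobolev1Norm_le Ω hp _ _
    _ ≤ ENNReal.ofReal (δ / 8) + ENNReal.ofReal (δ / 8)
        + (ENNReal.ofReal (δ / 8) + ENNReal.ofReal (δ / 8)) :=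
        add_le_add (eLpNorm_sub_le_of_le hq hu.memLp.1 hz.memLp.1 hw.memLp.1 hzu hwz)
          (eLpNorm_sub_le_of_le hq hu.memLp_grad.1 hz.memLp_grad.1 hw.memLp_grad.1 hDzu hDwz)
    _ < ENNReal.ofReal δ := by
        rw [← ENNReal.ofReal_add (by positivity) (by positivity),
          ← ENNReal.ofReal_add (by positivity) (by positivity), ENNReal.ofReal_lt_ofReal_iff hδ]
        linarith

lemma exists_pos_mul_lt_and_forall_eLpNorm_le {α : Type*} [MeasurableSpace α] (μ : Measure α)
    [IsFiniteMeasure μ] (q : ℝ≥0∞) {τ : ℝ} (hτ : 0 < τ) :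
    ∃ ε : ℝ, 0 < ε ∧ ε * μ.real univ < τ ∧ ∀ {E : Type*} [NormedAddCommGroup E] (F : α → E),
      (∀ x, ‖F x‖ ≤ ε) → eLpNorm F q μ ≤ ENNReal.ofReal τ := by
  have hc : μ univ ^ q.toReal⁻¹ ≠ ⊤ :=
    ENNReal.rpow_ne_top_of_nonneg (by positivity) (measure_ne_top μ _)
  obtain ⟨ε, hε, hcε⟩ := exists_pos_mul_lt hτ (max (μ.real univ) (μ univ ^ q.toReal⁻¹).toReal)
  rw [max_mul_of_nonneg _ _ hε.le, max_lt_iff] at hcε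
  refine ⟨ε, hε, by linarith, fun F hF => (eLpNorm_le_of_ae_bound (ae_of_all _ hF)).trans ?_⟩
  rw [← ENNReal.ofReal_toReal hc, ← ENNReal.ofReal_mul ENNReal.toReal_nonneg]
  exact ENNReal.ofReal_le_ofReal hcε.2.le

lemma measure_sdiff_lt_of_lt_half {α : Type*} [MeasurableSpace α] {μ : Measure α} {s t r : Set α}
    {ν : ℝ≥0∞} (hst : μ (s \ t) < ν / 2) (htr : μ (t \ r) < ν / 2) : μ (s \ r) < ν :=
  calc μ (s \ r) ≤ μ (s \ t ∪ t \ r) := measure_mono (sdiff_triangle s t r)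
    _ ≤ μ (s \ t) + μ (t \ r) := measure_union_le _ _
    _ < ν / 2 + ν / 2 := ENNReal.add_lt_add hst htr
    _ = ν := ENNReal.add_halves ν

lemma exists_isTestFunction_eq_one_of_measure_ne_top {Ω : Set Plane} (hΩ : IsOpen Ω)
    (hΩf : volume Ω ≠ ⊤) {ν : ℝ≥0∞} (hν : ν ≠ 0) :
    ∃ χ : Plane → ℝ, IsTestFunction Ω χ ∧ ∃ V : Set Plane, IsOpen V ∧ V ⊆ Ω ∧
      volume (Ω \ V) < ν ∧ ∀ x ∈ V, χ x = 1 := by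
  obtain ⟨K, hKΩ, hK, hKν⟩ := hΩ.measurableSet.exists_isCompact_sdiff_lt hΩf hν
  obtain ⟨χ, hχ, V, hV, hKV, h1⟩ := exists_smooth_cutoff hK hΩ hKΩ
  refine ⟨χ, hχ, V, hV, fun x hx => by_contra fun hxΩ => ?_,
    (measure_mono (sdiff_subset_sdiff_right hKV)).trans_lt hKν, h1⟩
  simpa [hχ.eq_zero hxΩ] using h1 x hx

lemma IsSobolev2.exists_eq_isTestFunction_on {m : ℕ} {Ω : Set Plane} {q : ℝ≥0∞}
    {u : Plane → Vec m} {Du : Plane → GradSpace m} {D2u : Plane → HessSpace m}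
    (hu : IsSobolev2 Ω q u Du D2u) (hq : 1 ≤ q) (hqt : q ≠ ⊤) (hΩ : IsOpen Ω)
    (hΩf : volume Ω ≠ ⊤) {ν τ : ℝ≥0∞} (hν : ν ≠ 0) (hτ : τ ≠ 0) :
    ∃ (z : Plane → Vec m) (Dz : Plane → GradSpace m) (D2z : Plane → HessSpace m),
      IsSobolev2 Ω q z Dz D2z ∧ eLpNorm (z - u) q (volume.restrict Ω) ≤ τ ∧
      eLpNorm (Dz - Du) q (volume.restrict Ω) ≤ τ ∧
      eLpNorm (D2z - D2u) q (volume.restrict Ω) ≤ τ ∧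
      ∃ (ψ : Plane → Vec m) (V : Set Plane), IsTestFunction Ω ψ ∧ IsOpen V ∧ V ⊆ Ω ∧
        volume (Ω \ V) < ν ∧ ∀ x ∈ V, Dz x = classicalGrad ψ x ∧ D2z x = classicalHess ψ x := by
  obtain ⟨χ, hχ, V, hV, hVΩ, hVν, h1⟩ :=
    exists_isTestFunction_eq_one_of_measure_ne_top hΩ hΩf hν
  obtain ⟨hχu, hχDu, hχD2u⟩ := hu.memLp_cutoff hΩ.measurableSet hχ
  have hχuW := hu.hasWeakDerivs.cutoff hχ
  obtain ⟨ψ, hψ, hψ0, hψ1, hψ2⟩ := hχuW.exists_isTestFunction_approx hq hqt hχu hχDu hχD2u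
    hχ.hasCompactSupport.smul_right hΩ ((tsupport_smul_subset_left χ u).trans hχ.tsupport_subset)
    hτ
  have hW := hu.hasWeakDerivs.add
    (((HasWeakDerivs.of_contDiff hψ.contDiff).sub hχuW).mono (subset_univ Ω))
  have hle {E : Type} [NormedAddCommGroup E] (U F G : Plane → E)
      (h : eLpNorm (F - G) q volume ≤ τ) :
      eLpNorm ((fun x => U x + (G x - F x)) - U) q (volume.restrict Ω) ≤ τ := by
    have hGF : (fun x => U x + (G x - F x)) - U = G - F := by ext1 x; simp
    rw [hGF, eLpNorm_sub_comm]
    exact (eLpNorm_mono_measure _ Measure.restrict_le_self).trans h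
  refine ⟨_, _, _, ⟨hu.memLp.add (((hψ.memLp q).sub hχu).restrict Ω),
    hu.memLp_grad.add (((hψ.classicalGrad.memLp q).sub hχDu).restrict Ω),
    hu.memLp_hess.add (((hψ.classicalHess.memLp q).sub hχD2u).restrict Ω),
    hW.weak_grad, hW.weak_hess⟩, hle _ _ _ hψ0, hle _ _ _ hψ1, hle _ _ _ hψ2,
    ψ, V, hψ, hV, hVΩ, hVν, fun x hx => ?_⟩
  obtain ⟨-, hgrad, hhess⟩ := cutoff_eq_of_eq_one hV h1 u Du D2u hx
  simp [hgrad, hhess]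

lemma IsGrowthIntegrand.setIntegral_le_add_setIntegral_growth {m : ℕ} {p C : ℝ}
    {f : GradSpace m → HessSpace m → ℝ} (H : IsGrowthIntegrand p C f) {α : Type*}
    [MeasurableSpace α] {μ : Measure α} {S Ω : Set α} (hS : MeasurableSet S)
    (hΩ : MeasurableSet Ω) (hΩf : μ Ω ≠ ⊤) (hSΩ : S ⊆ Ω) {V : α → GradSpace m}
    {F G : α → HessSpace m} (hV : AEStronglyMeasurable V (μ.restrict Ω))
    (hF : MemLp F (ENNReal.ofReal p) (μ.restrict Ω))
    (hG : MemLp G (ENNReal.ofReal p) (μ.restrict Ω)) (hFG : ∀ x ∉ S, F x = G x) :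
    ∫ x in Ω, f (V x) (F x) ∂μ ≤
      (∫ x in S, f (V x) (F x) ∂μ) + C * ∫ x in Ω \ S, (1 + ‖G x‖ ^ p) ∂μ := by
  have : IsFiniteMeasure (μ.restrict Ω) := ⟨by simpa using hΩf.lt_top⟩
  have hf : IntegrableOn (fun x => f (V x) (F x)) Ω μ := H.integrable hV hF
  have hg : IntegrableOn (fun x => C * (1 + ‖G x‖ ^ p)) Ω μ := (H.integrable_growth hG).const_mul C
  rw [← integral_const_mul, ← sub_le_iff_le_add', ← setIntegral_sdiff hS hf hSΩ]
  refine setIntegral_mono_on (hf.mono_set sdiff_subset) (hg.mono_set sdiff_subset)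
    (hΩ.diff hS) fun x hx => ?_
  simpa only [hFG x hx.2] using H.le (V x) (F x)

lemma IsGrowthIntegrand.exists_perturbation_setIntegral_le {m : ℕ} {p C : ℝ}
    {f : GradSpace m → HessSpace m → ℝ} (H : IsGrowthIntegrand p C f) {Ω : Set Plane}
    (hΩ : IsOpen Ω) (hΩf : volume Ω ≠ ⊤) {z : Plane → Vec m} {Dz : Plane → GradSpace m}
    {D2z : Plane → HessSpace m} (hz : IsSobolev2 Ω (ENNReal.ofReal p) z Dz D2z) {T : Set Plane}
    {ψ : Plane → Vec m} (hψ : IsTestFunction T ψ) {V : Set Plane} (hV : IsOpen V) (hVΩ : V ⊆ Ω)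
    (hzψ : ∀ x ∈ V, Dz x = classicalGrad ψ x ∧ D2z x = classicalHess ψ x) {ε : ℝ} (hε : 0 < ε)
    {ν : ℝ≥0∞} (hν : 0 < ν) :
    ∃ (w : Plane → Vec m) (Dw : Plane → GradSpace m) (D2w : Plane → HessSpace m) (S : Set Plane),
      IsSobolev2 Ω (ENNReal.ofReal p) w Dw D2w ∧ (∀ x, ‖(w - z) x‖ ≤ ε) ∧
      (∀ x, ‖(Dw - Dz) x‖ ≤ ε) ∧ volume (V \ S) < ν ∧
      ∫ x in Ω, f (Dw x) (D2w x) ≤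
        (∫ x in Ω, quasiconvexification2 (f (Dz x)) (D2z x))
          + ε * volume.real Ω + C * ∫ x in Ω \ S, (1 + ‖D2z x‖ ^ p) := by
  have : IsFiniteMeasure (volume.restrict Ω) := ⟨by simpa using hΩf.lt_top⟩
  obtain ⟨S, θ, Dθ, D2θ, hS, hSV, hVS, hθ, hθε, hE⟩ :=
    H.exists_global_perturbation hψ hV (measure_ne_top_of_subset hVΩ hΩf) hε hν
  have hSΩ : S ⊆ Ω := hSV.trans hVΩ
  obtain ⟨hθ0, hθ1, hθ2⟩ := hθ.memLp (measure_ne_top_of_subset hSΩ hΩf) (ENNReal.ofReal p)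
  have hweak := hz.hasWeakDerivs.add (hθ.weak.mono (subset_univ Ω))
  have hw : IsSobolev2 Ω (ENNReal.ofReal p) (fun x => z x + θ x) (fun x => Dz x + Dθ x)
      (fun x => D2z x + D2θ x) :=
    ⟨hz.memLp.add (hθ0.restrict Ω), hz.memLp_grad.add (hθ1.restrict Ω),
      hz.memLp_hess.add (hθ2.restrict Ω), hweak.weak_grad, hweak.weak_hess⟩
  refine ⟨_, _, _, S, hw, fun x => by simpa using (hθε x).1, fun x => by simpa using (hθε x).2,
    hVS, ?_⟩
  have hcongr (F : Plane → GradSpace m → HessSpace m → ℝ) :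
      ∫ x in S, F x (classicalGrad ψ x) (classicalHess ψ x) = ∫ x in S, F x (Dz x) (D2z x) :=
    setIntegral_congr_fun hS fun x hx => by simp only [hzψ x (hSV hx)]
  rw [hcongr fun x v ξ => f (v + Dθ x) (ξ + D2θ x),
    hcongr fun _ v ξ => quasiconvexification2 (f v) ξ] at hE
  have hQ : IntegrableOn (fun x => quasiconvexification2 (f (Dz x)) (D2z x)) Ω volume :=
    H.integrable_quasiconvexification2 hz.memLp_grad.1 hz.memLp_hess
      (hz.hasWeakDerivs.isSymmHess_ae hΩ)
  calc ∫ x in Ω, f (Dz x + Dθ x) (D2z x + D2θ x)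
      ≤ (∫ x in S, f (Dz x + Dθ x) (D2z x + D2θ x)) + C * ∫ x in Ω \ S, (1 + ‖D2z x‖ ^ p) :=
        H.setIntegral_le_add_setIntegral_growth hS hΩ.measurableSet hΩf hSΩ hw.memLp_grad.1
          hw.memLp_hess hz.memLp_hess fun x hx => by rw [(hθ.eq_zero x hx).2.2, add_zero]
    _ ≤ (∫ x in S, quasiconvexification2 (f (Dz x)) (D2z x)) + ε * volume.real V
          + C * ∫ x in Ω \ S, (1 + ‖D2z x‖ ^ p) := by gcongr
    _ ≤ _ := by
        gcongr
        exact ae_of_all _ fun x => quasiconvexification2_nonneg (H.nonneg _)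

lemma IsGrowthIntegrand.exists_eq_isTestFunction_on {m : ℕ} {p C : ℝ}
    {f : GradSpace m → HessSpace m → ℝ} (H : IsGrowthIntegrand p C f) {Ω : Set Plane}
    (hΩ : IsOpen Ω) (hΩf : volume Ω ≠ ⊤) {u : Plane → Vec m} {Du : Plane → GradSpace m}
    {D2u : Plane → HessSpace m} (hu : IsSobolev2 Ω (ENNReal.ofReal p) u Du D2u) {σ : ℝ}
    (hσ : 0 < σ) :
    ∃ (z : Plane → Vec m) (Dz : Plane → GradSpace m) (D2z : Plane → HessSpace m),
      IsSobolev2 Ω (ENNReal.ofReal p) z Dz D2z ∧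
      eLpNorm (z - u) (ENNReal.ofReal p) (volume.restrict Ω) ≤ ENNReal.ofReal σ ∧
      eLpNorm (Dz - Du) (ENNReal.ofReal p) (volume.restrict Ω) ≤ ENNReal.ofReal σ ∧
      ∫ x in Ω, quasiconvexification2 (f (Dz x)) (D2z x) ≤
        (∫ x in Ω, quasiconvexification2 (f (Du x)) (D2u x)) + σ ∧
      ∃ (ψ : Plane → Vec m) (V : Set Plane), IsTestFunction Ω ψ ∧ IsOpen V ∧ V ⊆ Ω ∧
        (∀ x ∈ V, Dz x = classicalGrad ψ x ∧ D2z x = classicalHess ψ x) ∧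
        ∃ ν : ℝ≥0∞, 0 < ν ∧ ∀ S, volume (V \ S) < ν →
          C * ∫ x in Ω \ S, (1 + ‖D2z x‖ ^ p) ≤ σ := by
  have : IsFiniteMeasure (volume.restrict Ω) := ⟨by simpa using hΩf.lt_top⟩
  obtain ⟨τ₁, hτ₁, hQ⟩ := H.exists_integral_quasiconvexification2_le hu.memLp_grad hu.memLp_hess
    (hu.hasWeakDerivs.isSymmHess_ae hΩ) hσ
  obtain ⟨τ₂, hτ₂, ν, hν, hsmall⟩ := H.exists_setIntegral_growth_le hu.memLp_hess hσ
  obtain ⟨τ, hτ, hττ₁, hττ₂, hτσ⟩ : ∃ τ > 0, τ ≤ τ₁ ∧ τ ≤ τ₂ ∧ τ ≤ σ :=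
    ⟨min τ₁ (min τ₂ σ), by positivity, by simp⟩
  have hν2 : 0 < ν / 2 := ENNReal.half_pos hν.ne'
  obtain ⟨z, Dz, D2z, hz, hzu, hDzu, hD2zu, ψ, V, hψ, hV, hVΩ, hVν, hzψ⟩ :=
    hu.exists_eq_isTestFunction_on (by simpa using H.one_le) ENNReal.ofReal_ne_top hΩ hΩf
      hν2.ne' (τ := ENNReal.ofReal τ) (by simpa using hτ)
  refine ⟨z, Dz, D2z, hz, hzu.trans (ENNReal.ofReal_le_ofReal hτσ),
    hDzu.trans (ENNReal.ofReal_le_ofReal hτσ), hQ Dz D2z hz.memLp_grad hz.memLp_hess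
      (hz.hasWeakDerivs.isSymmHess_ae hΩ) (hDzu.trans (ENNReal.ofReal_le_ofReal hττ₁))
      (hD2zu.trans (ENNReal.ofReal_le_ofReal hττ₁)),
    ψ, V, hψ, hV, hVΩ, hzψ, ν / 2, hν2, fun S hVS => ?_⟩
  have hrest := hsmall D2z hz.memLp_hess (hD2zu.trans (ENNReal.ofReal_le_ofReal hττ₂)) (Ω \ S)
    ((Measure.restrict_apply_le _ _).trans_lt (measure_sdiff_lt_of_lt_half hVν hVS))
  rwa [Measure.restrict_restrict_of_subset sdiff_subset] at hrest

theorem proposition4p1_general {m : ℕ} (p : ℝ) (hp : 1 ≤ p)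
    (f : GradSpace m → HessSpace m → ℝ) (hf : Measurable (Function.uncurry f)) (C : ℝ)
    (hgrowth : ∀ v ξ, 0 ≤ f v ξ ∧ f v ξ ≤ C * (1 + ‖ξ‖ ^ p))
    (hlip : ∀ v v' ξ, |f v ξ - f v' ξ| ≤ C * ‖v - v'‖ * max (f v ξ) (f v' ξ))
    (Ω : Set Plane) (hΩ : IsOpen Ω) (hΩf : volume Ω ≠ ⊤)
    (u : Plane → Vec m) (Du : Plane → GradSpace m) (D2u : Plane → HessSpace m)
    (hu : IsSobolev2 Ω (ENNReal.ofReal p) u Du D2u) (δ : ℝ) (hδ : 0 < δ) :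
    ∃ (w : Plane → Vec m) (Dw : Plane → GradSpace m) (D2w : Plane → HessSpace m),
      IsSobolev2 Ω (ENNReal.ofReal p) w Dw D2w ∧
      sobolev1Norm Ω p (fun x => u x - w x) (fun x => Du x - Dw x) < ENNReal.ofReal δ ∧
      IntegrableOn (fun x => f (Dw x) (D2w x)) Ω volume ∧
      IntegrableOn (fun x => quasiconvexification2 (f (Du x)) (D2u x)) Ω volume ∧
      ∫ x in Ω, f (Dw x) (D2w x) <
        (∫ x in Ω, quasiconvexification2 (f (Du x)) (D2u x)) + δ := by
  have H : IsGrowthIntegrand p C f :=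
    ⟨hp, hf, fun v ξ => (hgrowth v ξ).1, fun v ξ => (hgrowth v ξ).2, hlip⟩
  have : IsFiniteMeasure (volume.restrict Ω) := ⟨by simpa using hΩf.lt_top⟩
  have hδ8 : 0 < δ / 8 := by positivity
  obtain ⟨z, Dz, D2z, hz, hzu, hDzu, hzQ, ψ, V, hψ, hV, hVΩ, hzψ, ν, hν, hrest⟩ :=
    H.exists_eq_isTestFunction_on hΩ hΩf hu hδ8
  obtain ⟨ε, hε, hεΩ, hεL⟩ := exists_pos_mul_lt_and_forall_eLpNorm_le
    (volume.restrict Ω) (ENNReal.ofReal p) hδ8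
  rw [measureReal_restrict_apply_univ] at hεΩ
  obtain ⟨w, Dw, D2w, S, hw, hwz, hDwz, hVS, hwQ⟩ :=
    H.exists_perturbation_setIntegral_le hΩ hΩf hz hψ hV hVΩ hzψ hε hν
  refine ⟨w, Dw, D2w, hw, sobolev1Norm_sub_lt hp hδ hu hz hw hzu hDzu (hεL _ hwz) (hεL _ hDwz),
    H.integrable hw.memLp_grad.1 hw.memLp_hess, H.integrable_quasiconvexification2
      hu.memLp_grad.1 hu.memLp_hess (hu.hasWeakDerivs.isSymmHess_ae hΩ), ?_⟩
  linarith [hrest S hVS]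

theorem proposition4p1 {m : ℕ} (p : ℝ) (hp : 1 ≤ p)
    (f : GradSpace m → HessSpace m → ℝ) (hf : Measurable (Function.uncurry f))
    (C : ℝ)
    (hgrowth : ∀ v ξ, 0 ≤ f v ξ ∧ f v ξ ≤ C * (1 + ‖ξ‖ ^ p))
    (hlip : ∀ v v' ξ, |f v ξ - f v' ξ| ≤ C * ‖v - v'‖ * max (f v ξ) (f v' ξ))
    (hlipQ : ∀ v v' ξ,
      |quasiconvexification2 (f v) ξ - quasiconvexification2 (f v') ξ| ≤
        C * ‖v - v'‖ * max (quasiconvexification2 (f v) ξ) (quasiconvexification2 (f v') ξ))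
    (Ω : Set Plane) (hΩ : IsOpen Ω) (hΩb : Bornology.IsBounded Ω) (hΩs : HasSmoothBoundary Ω)
    (u : Plane → Vec m) (Du : Plane → GradSpace m) (D2u : Plane → HessSpace m)
    (hu : IsSobolev2 Ω (ENNReal.ofReal p) u Du D2u)
    (δ : ℝ) (hδ : 0 < δ) :
    ∃ (w : Plane → Vec m) (Dw : Plane → GradSpace m) (D2w : Plane → HessSpace m),
      IsSobolev2 Ω (ENNReal.ofReal p) w Dw D2w ∧
      sobolev1Norm Ω p (fun x => u x - w x) (fun x => Du x - Dw x) < ENNReal.ofReal δ ∧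
      IntegrableOn (fun x => f (Dw x) (D2w x)) Ω volume ∧
      IntegrableOn (fun x => quasiconvexification2 (f (Du x)) (D2u x)) Ω volume ∧
      ∫ x in Ω, f (Dw x) (D2w x) <
        (∫ x in Ω, quasiconvexification2 (f (Du x)) (D2u x)) + δ :=
  proposition4p1_general p hp f hf C hgrowth hlip Ω hΩ hΩb.measure_lt_top.ne u Du D2u hu δ hδ
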